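/- Let $m\ge 0$, $n=m+1$, and consider the controlled Hamiltonian system $$\dot q=\partial_pH,\qquad \dot p=-\partial_qH+G(q)u,\qquad H(q,p)=\tfrac12p^TM(q)^{-1}p+V(q),\qquad (1)$$ with $(q,p)\in\mathbb R^n\times\mathbb R^n$, $u\in\mathbb R^m$, where $M,V,G$ are smooth on $\mathbb R^n$, $M(q)$ is an $n\times n$ symmetric positive definite matrix and $G(q)$ is an $n\times m$ matrix of rank $m$ for every $q$ (one degree of underactuation). Assume that $(q,p)=(0,0)$ is an equilibrium of (1) for $u=0$, and let $\Sigma^\ell$, $\dot x=Ax+Bu$, be the linearization of (1) at $(q,p)=(0,0)$, $u=0$. Let $\mathcal C(\mathbb R^n)$ be the set of smooth $(0,3)$-tensor fields $C=(C_{ijk}(q))$ on $\mathbb R^n$ with $C_{ijk}=C_{jik}$ and $C_{ijk}+C_{jki}+C_{kij}=0$ for all $i,j,k$. Say that (1) can be transformed to the desired form if there are an open neighbourhood $U$ of $0$ in $\mathbb R^n$, smooth symmetric positive definite matrices $\widehat M(q)$ ($n\times n$) and $K_v(q)$ ($m\times m$) and a smooth function $\widehat V(q)$ on $U$, a tensor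 field $C\in\mathcal C(\mathbb R^n)$, and a smooth feedback law $u=u(q,p)$ on $U\times\mathbb R^n$, such that $\widehat H(q,p)=\tfrac12p^T\widehat M(q)^{-1}p+\widehat V(q)$ has a nondegenerate local minimum at $(0,0)$ and, on $U\times\mathbb R^n$, the system (1) with $u=u(q,p)$ is $$\dot q=M^{-1}\widehat M\,\partial_p\widehat H,\qquad \dot p=-\widehat MM^{-1}\partial_q\widehat H-GK_vG^T\partial_p\widehat H+C(\widehat M^{-1}p,\widehat M^{-1}p,\cdot),\qquad (2)$$ where the $k$-th component of the last term is $\sum_{i,j}C_{ijk}(\widehat M^{-1}p)_i(\widehat M^{-1}p)_j$. Call a linear dynamics $\dot x=Fx$ oscillatory if $F$ is diagonalizable over $\mathbb C$ and each eigenvalue of $F$ is a nonzero purely imaginary number. The uncontrollable dynamics of $\Sigma^\ell$ is the one induced by $A$ on the quotient of the state space by the controllable subspace $\sum_{k\ge0}\operatorname{im}(A^kB)$. Then (1) can be transformed to the desired form if and only if $\Sigma^\ell$ is controllable or its uncontrollable dynamics is oscillatory. Moreover, for every such transformation, the origin of the closed-loop system (2) is locally exponentially stable if and only if $\Sigma^\ell$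 is controllable. -/

import Mathlib

open scoped Matrix ContDiff

noncomputable section

namespace IDAPBC

/-- Phase space `ℝⁿ × ℝⁿ` of pairs `(q, p)`. -/
abbrev Phase (n : ℕ) : Type := (Fin n → ℝ) × (Fin n → ℝ)

/-! ### Hamiltonians and partial gradients -/

/-- The vector `∂_q F` of partial derivatives with respect to the positions. -/
def gradQ {n : ℕ} (F : Phase n → ℝ) (x : Phase n) : Fin n → ℝ :=
  fun i => fderiv ℝ (fun q : Fin n → ℝ => F (q, x.2)) x.1 (Pi.single i 1)

/-- The vector `∂_p F` of partial derivatives with respect to the momenta. -/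
def gradP {n : ℕ} (F : Phase n → ℝ) (x : Phase n) : Fin n → ℝ :=
  fun i => fderiv ℝ (fun p : Fin n → ℝ => F (x.1, p)) x.2 (Pi.single i 1)

/-- `(q, p) ↦ ½ pᵀ M(q)⁻¹ p + V(q)`. -/
def mechHamiltonian {n : ℕ} (M : (Fin n → ℝ) → Matrix (Fin n) (Fin n) ℝ)
    (V : (Fin n → ℝ) → ℝ) (x : Phase n) : ℝ :=
  (1 / 2) * (x.2 ⬝ᵥ ((M x.1)⁻¹ *ᵥ x.2)) + V x.1

/-- A controlled Hamiltonian system with `n` degrees of freedom and `m` inputs: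
mass matrix `M`, potential `V`, input matrix `G` of rank `m`, all smooth on `ℝⁿ`. -/
structure ControlledHamiltonian (n m : ℕ) where
  M : (Fin n → ℝ) → Matrix (Fin n) (Fin n) ℝ
  V : (Fin n → ℝ) → ℝ
  G : (Fin n → ℝ) → Matrix (Fin n) (Fin m) ℝ
  smooth_M : ∀ i j, ContDiff ℝ ∞ (fun q => M q i j)
  smooth_V : ContDiff ℝ ∞ V
  smooth_G : ∀ i j, ContDiff ℝ ∞ (fun q => G q i j)
  posDef_M : ∀ q, (M q).PosDef
  rank_G : ∀ q, (G q).rank = m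

namespace ControlledHamiltonian

variable {n m : ℕ}

/-- The Hamiltonian `H` of the system. -/
def H (S : ControlledHamiltonian n m) : Phase n → ℝ := mechHamiltonian S.M S.V

/-- Right-hand side of `q̇ = ∂_p H`, `ṗ = -∂_q H + G(q) u`. -/
def field (S : ControlledHamiltonian n m) (x : Phase n) (u : Fin m → ℝ) : Phase n :=
  (gradP S.H x, -gradQ S.H x + S.G x.1 *ᵥ u)

/-- State matrix (as a linear map) of the linearization at the origin with zero input. -/
def linA (S : ControlledHamiltonian n m) : Phase n →L[ℝ] Phase n :=
  fderiv ℝ (fun x => S.field x 0) 0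

/-- Input matrix (as a linear map) of the linearization at the origin with zero input. -/
def linB (S : ControlledHamiltonian n m) : (Fin m → ℝ) →L[ℝ] Phase n :=
  fderiv ℝ (fun u => S.field 0 u) 0

end ControlledHamiltonian

/-! ### Gyroscopic tensors and the desired form -/

/-- The `(0,3)`-tensor with components `C i j k` is gyroscopic: symmetric in the first two
arguments, with vanishing cyclic sums. -/
def IsGyroscopic {n : ℕ} (C : Fin n → Fin n → Fin n → ℝ) : Prop :=
  (∀ i j k, C i j k = C j i k) ∧ ∀ i j k, C i j k + C j k i + C k i j = 0

/-- The set `𝒞(ℝⁿ)` of smooth tensor fields on `ℝⁿ` that are pointwise gyroscopic. -/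
def gyroscopicFields (n : ℕ) : Set ((Fin n → ℝ) → Fin n → Fin n → Fin n → ℝ) :=
  {C | (∀ i j k, ContDiff ℝ ∞ (fun q => C q i j k)) ∧ ∀ q, IsGyroscopic (C q)}

/-- The covector with components `∑ i j, C i j k * v i * v j`. -/
def contract {n : ℕ} (C : Fin n → Fin n → Fin n → ℝ) (v : Fin n → ℝ) : Fin n → ℝ :=
  fun k => ∑ i, ∑ j, C i j k * v i * v j

/-- The data of a design: a region `U` of positions, the desired mass matrix, the desired
potential, the damping gain, the gyroscopic tensor field, and the feedback law. -/
structure Design (n m : ℕ) where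
  U : Set (Fin n → ℝ)
  Mhat : (Fin n → ℝ) → Matrix (Fin n) (Fin n) ℝ
  Vhat : (Fin n → ℝ) → ℝ
  Kv : (Fin n → ℝ) → Matrix (Fin m) (Fin m) ℝ
  C : (Fin n → ℝ) → Fin n → Fin n → Fin n → ℝ
  u : Phase n → Fin m → ℝ

namespace Design

variable {n m : ℕ}

/-- The desired Hamiltonian. -/
def Hhat (D : Design n m) : Phase n → ℝ := mechHamiltonian D.Mhat D.Vhat

/-- The part `U × ℝⁿ` of phase space over `U`. -/
def domain (D : Design n m) : Set (Phase n) := D.U ×ˢ Set.univ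

/-- Right-hand side of the desired closed-loop system
`q̇ = M⁻¹ M̂ ∂_p Ĥ`,
`ṗ = -M̂ M⁻¹ ∂_q Ĥ - G K_v Gᵀ ∂_p Ĥ + C(M̂⁻¹ p, M̂⁻¹ p, ·)`. -/
def desiredField (S : ControlledHamiltonian n m) (D : Design n m) (x : Phase n) : Phase n :=
  (((S.M x.1)⁻¹ * D.Mhat x.1) *ᵥ gradP D.Hhat x,
    -((D.Mhat x.1 * (S.M x.1)⁻¹) *ᵥ gradQ D.Hhat x)
      - (S.G x.1 * D.Kv x.1 * (S.G x.1)ᵀ) *ᵥ gradP D.Hhat x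
      + contract (D.C x.1) ((D.Mhat x.1)⁻¹ *ᵥ x.2))

end Design

/-- `f` has a local minimum at `x` and its second derivative at `x` is a nondegenerate
bilinear form. -/
def HasNondegenerateLocalMin {E : Type*} [NormedAddCommGroup E] [NormedSpace ℝ E]
    (f : E → ℝ) (x : E) : Prop :=
  IsLocalMin f x ∧ ∀ v : E, (∀ w : E, fderiv ℝ (fderiv ℝ f) x v w = 0) → v = 0

/-- The feedback of `D` turns `S` into the desired form over the open neighbourhood `D.U` of the
origin, with admissible smooth data. -/
structure IsTransformedBy {n m : ℕ} (S : ControlledHamiltonian n m) (D : Design n m) : Prop where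
  isOpen_U : IsOpen D.U
  zero_mem_U : (0 : Fin n → ℝ) ∈ D.U
  smooth_Mhat : ∀ i j, ContDiffOn ℝ ∞ (fun q => D.Mhat q i j) D.U
  posDef_Mhat : ∀ q ∈ D.U, (D.Mhat q).PosDef
  smooth_Vhat : ContDiffOn ℝ ∞ D.Vhat D.U
  smooth_Kv : ∀ i j, ContDiffOn ℝ ∞ (fun q => D.Kv q i j) D.U
  posDef_Kv : ∀ q ∈ D.U, (D.Kv q).PosDef
  gyroscopic_C : D.C ∈ gyroscopicFields n
  smooth_u : ContDiffOn ℝ ∞ D.u D.domain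
  nondegenerate_min : HasNondegenerateLocalMin D.Hhat (0 : Phase n)
  matching : ∀ x ∈ D.domain, S.field x (D.u x) = D.desiredField S x

/-! ### Linear control systems `ẋ = A x + B u` -/

section Linear

variable {E W : Type*} [NormedAddCommGroup E] [NormedSpace ℝ E]
  [NormedAddCommGroup W] [NormedSpace ℝ W]

/-- Every state can be steered to every other state in finite time by a continuous input. -/
def IsControllable (A : E →L[ℝ] E) (B : W →L[ℝ] E) : Prop :=
  ∀ x₀ x₁ : E, ∃ T : ℝ, 0 < T ∧ ∃ (u : ℝ → W) (x : ℝ → E), Continuous u ∧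
    (∀ t ∈ Set.Icc 0 T, HasDerivWithinAt x (A (x t) + B (u t)) (Set.Icc 0 T) t) ∧
    x 0 = x₀ ∧ x T = x₁

/-- The controllable subspace `∑ₖ im (Aᵏ B)`. -/
def controllableSubspace (A : E →L[ℝ] E) (B : W →L[ℝ] E) : Submodule ℝ E :=
  ⨆ k : ℕ, LinearMap.range ((A ^ k).toLinearMap ∘ₗ B.toLinearMap)

theorem controllableSubspace_le_comap (A : E →L[ℝ] E) (B : W →L[ℝ] E) :
    controllableSubspace A B ≤ (controllableSubspace A B).comap A.toLinearMap := by
  refine iSup_le fun k => ?_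
  rintro _ ⟨w, rfl⟩
  refine Submodule.mem_iSup_of_mem (k + 1) ⟨w, ?_⟩
  simp [pow_succ']

/-- The uncontrollable dynamics: the map induced by `A` on the quotient of the state space by the
controllable subspace (the uncontrollable block of a Kalman decomposition). -/
def uncontrollablePart (A : E →L[ℝ] E) (B : W →L[ℝ] E) :
    Module.End ℝ (E ⧸ controllableSubspace A B) :=
  Submodule.mapQ _ _ A.toLinearMap (controllableSubspace_le_comap A B)

end Linear

/-- The linear dynamics `ẋ = A x` is oscillatory: `A` is diagonalizable over `ℂ` and every
eigenvalue is a nonzero purely imaginary number. -/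
def IsOscillatory {X : Type*} [AddCommGroup X] [Module ℝ X] (A : Module.End ℝ X) : Prop :=
  (⨆ μ : ℂ, Module.End.eigenspace
      (LinearMap.baseChange ℂ A : Module.End ℂ (TensorProduct ℝ ℂ X)) μ) = ⊤ ∧
  ∀ μ : ℂ, Module.End.HasEigenvalue
      (LinearMap.baseChange ℂ A : Module.End ℂ (TensorProduct ℝ ℂ X)) μ → μ ≠ 0 ∧ μ.re = 0

/-! ### Exponential stability -/

section Stability

variable {E : Type*} [NormedAddCommGroup E] [NormedSpace ℝ E]

/-- `x` is a solution of `ẋ = f(x)` on `[0, ∞)` that stays in `Ω`. -/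
def IsForwardSolution (f : E → E) (Ω : Set E) (x : ℝ → E) : Prop :=
  ∀ t : ℝ, 0 ≤ t → x t ∈ Ω ∧ HasDerivWithinAt x (f (x t)) (Set.Ici 0) t

/-- The origin is a locally exponentially stable equilibrium of `ẋ = f(x)`, `x ∈ Ω`: from every
initial state near the origin a solution exists for all positive times, and every solution
starting there decays exponentially, with uniform constants. -/
def IsLocallyExponentiallyStable (f : E → E) (Ω : Set E) : Prop :=
  ∃ δ c a : ℝ, 0 < δ ∧ 0 < c ∧ 0 < a ∧
    (∀ x₀ : E, ‖x₀‖ < δ → ∃ x : ℝ → E, IsForwardSolution f Ω x ∧ x 0 = x₀) ∧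
    (∀ x : ℝ → E, IsForwardSolution f Ω x → ‖x 0‖ < δ →
      ∀ t : ℝ, 0 ≤ t → ‖x t‖ ≤ c * Real.exp (-a * t) * ‖x 0‖)

end Stability

end IDAPBC

end

/-! Let `g` span the left kernel of `G(0)`, a line since there is one degree of underactuation. In
the linearization, y = (Mg)·q satisfies ẏ = g·p and ÿ = -(Hess V g)·q, and the input enters neither
equation. Functionals annihilating the controllable subspace are combinations of y and ẏ. Hence a
dichotomy: if Hess V g is not a multiple of Mg, the system is controllable; if Hess V g = c Mg, the
uncontrollable dynamics is ÿ = -cy, which is oscillatory exactly when c > 0. The condition of the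
theorem thus excludes only Hess V g = c Mg with c ≤ 0.

Necessity. By matching, the closed loop linearizes to A + BK. Its g-component gives Hess V g = Hess
V̂ z with z = M⁻¹M̂g (`hess_mulVec_eq`). If Hess V g = c Mg, then 0 < z·Hess V̂ z = c g·M̂g, so c >
0.

Sufficiency. The condition provides a constant vector z with (Mg)·z > 0 and (Hess V g)·z > 0
(`exists_dotProduct_pos`). Extend g to a smooth annihilator field of G and ask for M̂g = f Mz with a
scalar f > 0. The position equation holds for any M̂, and the momentum equation can be solved for u
as soon as its g-component holds. The potential part of that component reads ∂_z V̂ = f⁻¹ g·∂V,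
solvable along the lines of direction z with positive definite Hessian (`exists_potential`). The
kinetic part asks the gyroscopic term to realize a quadratic form Q in the velocities. Since
C(v,v,v) = 0, this forces Q(g) = 0, which is a linear equation for the derivative of f along z
(`kinetic_matching`); once Q(g) = 0, an explicit gyroscopic tensor realizes Q
(`dotProduct_contract_gyroForm`).

Stability. In the parallel case the oscillator (y, ẏ) survives in A + BK and rules out exponential
decay. In the controllable case the Hessian of Ĥ is a quadratic Lyapunov function whose dissipation
is observable; averaging it along the linear flow makes it strict (`exists_strict_lyapunov`), and
Lyapunov's indirect method concludes. -/

noncomputable section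

namespace IDAPBC

/-! ### Parametric integrals, cut-offs and second-order conditions for minima -/

section Analysis
open scoped Topology
open Set Filter

/-- Differentiation under the integral sign replaces the target `F` by `E →L[ℝ] F`, so the induction
on `k` must run over all targets at once. -/
theorem contDiff_nat_intervalIntegral {E : Type} [NormedAddCommGroup E] [NormedSpace ℝ E]
    [FiniteDimensional ℝ E] (k : ℕ) :
    ∀ {F : Type} [NormedAddCommGroup F] [NormedSpace ℝ F] [CompleteSpace F]
      {f : E × ℝ → F}, ContDiff ℝ k f →
      ContDiff ℝ k (fun x => ∫ t in (0 : ℝ)..1, f (x, t)) := by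
  induction k with
  | zero =>
    intro F _ _ _ f hf
    simp only [Nat.cast_zero, contDiff_zero] at hf ⊢
    exact intervalIntegral.continuous_parametric_intervalIntegral_of_continuous'
      (f := fun x t => f (x, t)) hf 0 1
  | succ k ih =>
    intro F _ _ _ f hf
    have hd : Differentiable ℝ f := hf.differentiable (by simp)
    have hf' : ContDiff ℝ k (fun y : E × ℝ =>
        (fderiv ℝ f y).comp (ContinuousLinearMap.inl ℝ E ℝ)) :=
      (hf.fderiv_right (by simp)).clm_comp contDiff_const
    have key : ∀ x, HasFDerivAt (fun x => ∫ t in (0 : ℝ)..1, f (x, t))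
        (∫ t in (0 : ℝ)..1, (fderiv ℝ f (x, t)).comp (ContinuousLinearMap.inl ℝ E ℝ)) x := by
      intro x
      have hc := hf'.continuous
      obtain ⟨b, hb⟩ := ((isCompact_closedBall x 1).prod
        (isCompact_Icc (a := (0 : ℝ)) (b := 1))).exists_bound_of_continuousOn hc.continuousOn
      refine intervalIntegral.hasFDerivAt_integral_of_dominated_of_fderiv_le
        (F := fun x t => f (x, t))
        (F' := fun x t => (fderiv ℝ f (x, t)).comp (ContinuousLinearMap.inl ℝ E ℝ))
        (bound := fun _ => b)
        (Metric.closedBall_mem_nhds x one_pos) ?_ ?_ ?_ ?_ ?_ ?_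
      · refine Eventually.of_forall fun y => ?_
        exact (hf.continuous.comp (by fun_prop)).aestronglyMeasurable
      · exact (hf.continuous.comp (by fun_prop)).intervalIntegrable _ _
      · exact (hc.comp (by fun_prop : Continuous fun t : ℝ => (x, t))).aestronglyMeasurable
      · refine Eventually.of_forall fun t ht y hy => hb (y, t) ⟨hy, ?_⟩
        rw [uIoc_of_le zero_le_one] at ht
        exact Ioc_subset_Icc_self ht
      · exact intervalIntegrable_const
      · refine Eventually.of_forall fun t _ y _ => ?_
        exact (hd (y, t)).hasFDerivAt.comp y
          (hasFDerivAt_prodMk_left y t)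
    rw [Nat.cast_succ, contDiff_succ_iff_hasFDerivAt]
    exact ⟨_, ih hf', key⟩

theorem contDiff_intervalIntegral {E : Type} [NormedAddCommGroup E] [NormedSpace ℝ E]
    [FiniteDimensional ℝ E] {f : E × ℝ → ℝ} (hf : ContDiff ℝ ∞ f) :
    ContDiff ℝ ∞ (fun x => ∫ t in (0 : ℝ)..1, f (x, t)) :=
  contDiff_infty.2 fun k => contDiff_nat_intervalIntegral k (contDiff_infty.1 hf k)

/-- Every smooth function is the derivative of a smooth function in a given constant direction. -/
theorem exists_fderiv_apply_eq {E : Type} [NormedAddCommGroup E] [NormedSpace ℝ E]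
    [FiniteDimensional ℝ E] {z : E} (hz : z ≠ 0) {s : E → ℝ} (hs : ContDiff ℝ ∞ s) :
    ∃ F : E → ℝ, ContDiff ℝ ∞ F ∧ ∀ q, fderiv ℝ F q z = s q := by
  obtain ⟨l, hl⟩ := SeparatingDual.exists_eq_one (R := ℝ) hz
  -- `F q` is the integral of `s` along the line of direction `z` from the hyperplane `l = 0` to
  -- `q`, rescaled to fixed limits so that its smoothness is that of a parametric integral.
  let F : E → ℝ := fun q => ∫ t in (0 : ℝ)..1, l q * s (q - ((1 - t) * l q) • z)
  have hF : ContDiff ℝ ∞ F := by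
    refine contDiff_intervalIntegral (f := fun y : E × ℝ =>
      l y.1 * s (y.1 - ((1 - y.2) * l y.1) • z)) ?_
    fun_prop
  refine ⟨F, hF, fun q => ?_⟩
  have h1 : HasDerivAt (fun τ : ℝ => F (q + τ • z)) (fderiv ℝ F q z) 0 := by
    have h := ((hF.differentiable (by simp)) q).hasFDerivAt
    have h2 : HasDerivAt (fun τ : ℝ => q + τ • z) z 0 := by
      simpa using ((hasDerivAt_id (0 : ℝ)).smul_const z).const_add q
    have h' : HasFDerivAt F (fderiv ℝ F q) (q + (0 : ℝ) • z) := by simpa using h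
    exact h'.comp_hasDerivAt _ h2
  -- In the unscaled variable, moving `q` along `z` changes only the upper limit; the fundamental
  -- theorem of calculus then applies.
  have h2 : (fun τ : ℝ => F (q + τ • z)) =
      fun τ => ∫ σ in (0 : ℝ)..(l q + τ), s (q - (l q - σ) • z) := by
    funext τ
    simp only [F, map_add, map_smul, hl, smul_eq_mul, mul_one]
    have := intervalIntegral.mul_integral_comp_mul_right
      (f := fun σ => s (q - (l q - σ) • z)) (a := 0) (b := 1) (l q + τ)
    rw [zero_mul, one_mul] at this
    rw [← this, ← intervalIntegral.integral_const_mul]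
    congr 1
    funext t
    congr 2
    module
  have h3 : HasDerivAt (fun τ : ℝ => F (q + τ • z)) (s q) 0 := by
    rw [h2]
    have hcont : Continuous fun σ : ℝ => s (q - (l q - σ) • z) :=
      hs.continuous.comp (by fun_prop)
    have h4 := intervalIntegral.integral_hasDerivAt_right (hcont.intervalIntegrable 0 (l q + 0))
      (hcont.stronglyMeasurableAtFilter _ _) hcont.continuousAt
    have h5 := h4.comp (0 : ℝ) ((hasDerivAt_id (0 : ℝ)).const_add (l q))
    simpa [Function.comp_def] using h5
  exact h1.unique h3

theorem exists_bump {E : Type*} [NormedAddCommGroup E] [NormedSpace ℝ E]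
    [FiniteDimensional ℝ E] {U : Set E} {x : E} (hU : U ∈ 𝓝 x) :
    ∃ χ : E → ℝ, ContDiff ℝ ∞ χ ∧ HasCompactSupport χ ∧ tsupport χ ⊆ U ∧
      ∀ᶠ y in 𝓝 x, χ y = 1 := by
  obtain ⟨r, hr, hrU⟩ := Metric.nhds_basis_closedBall.mem_iff.1 hU
  let b : ContDiffBump x := ⟨r / 2, r, by linarith, by linarith⟩
  refine ⟨b, b.contDiff, b.hasCompactSupport, ?_, ?_⟩
  · rw [b.tsupport_eq]; exact hrU
  · exact b.eventuallyEq_one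

/-- Outside `U` the product vanishes near each point. This globalizes local data: the truncated
vector field, the logarithmic derivative of the mass factor, and the gyroscopic tensor. -/
theorem contDiff_smul_of_tsupport_subset {E F : Type*} [NormedAddCommGroup E] [NormedSpace ℝ E]
    [NormedAddCommGroup F] [NormedSpace ℝ F] {χ : E → ℝ} (hχ : ContDiff ℝ ∞ χ)
    {U : Set E} (hU : IsOpen U) (hs : tsupport χ ⊆ U) {f : E → F} (hf : ContDiffOn ℝ ∞ f U) :
    ContDiff ℝ ∞ (fun x => χ x • f x) := by
  rw [contDiff_iff_contDiffAt]
  intro x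
  by_cases hx : x ∈ U
  · exact hχ.contDiffAt.smul (hf.contDiffAt (hU.mem_nhds hx))
  · have : (fun x => χ x • f x) =ᶠ[𝓝 x] fun _ => 0 := by
      have : (tsupport χ)ᶜ ∈ 𝓝 x := (isClosed_tsupport χ).isOpen_compl.mem_nhds
        fun h => hx (hs h)
      filter_upwards [this] with y hy
      rw [image_eq_zero_of_notMem_tsupport hy, zero_smul]
    exact contDiffAt_const.congr_of_eventuallyEq this

theorem fderiv_comp_smul_hasDerivAt {E : Type*} [NormedAddCommGroup E] [NormedSpace ℝ E]
    {f : E → ℝ} {v : E} {t : ℝ} (hf : DifferentiableAt ℝ f (t • v)) :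
    HasDerivAt (fun s : ℝ => f (s • v)) (fderiv ℝ f (t • v) v) t := by
  have h2 : HasDerivAt (fun τ : ℝ => τ • v) v t := by
    simpa using (hasDerivAt_id t).smul_const v
  exact hf.hasFDerivAt.comp_hasDerivAt t h2

/-- Second derivative test for a local minimum. -/
theorem isLocalMin_of_coercive_snd_deriv {E : Type*} [NormedAddCommGroup E] [NormedSpace ℝ E]
    {f : E → ℝ} {B : E →L[ℝ] E →L[ℝ] ℝ} (hd : ∀ᶠ x in 𝓝 (0 : E), DifferentiableAt ℝ f x)
    (h0 : fderiv ℝ f 0 = 0) (hB : HasFDerivAt (fderiv ℝ f) B 0) {κ : ℝ} (hκ : 0 < κ)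
    (hpos : ∀ v, κ * ‖v‖ ^ 2 ≤ B v v) : IsLocalMin f 0 := by
  -- The gradient is linearized with the coercivity constant as tolerance, so the derivative of `f`
  -- along each short ray stays nonnegative.
  have h1 := hB.isLittleO.def hκ
  simp only [h0, sub_zero] at h1
  obtain ⟨r, hr, hball⟩ := Metric.eventually_nhds_iff_ball.1 (h1.and hd)
  refine Metric.eventually_nhds_iff_ball.2 ⟨r, hr, fun v hv => ?_⟩
  have hmem : ∀ t ∈ Icc (0 : ℝ) 1, t • v ∈ Metric.ball (0 : E) r := by
    intro t ht
    rw [mem_ball_zero_iff] at hv ⊢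
    rw [norm_smul, Real.norm_of_nonneg ht.1]
    nlinarith [norm_nonneg v, ht.2]
  have hder : ∀ t ∈ Icc (0 : ℝ) 1,
      HasDerivAt (fun s : ℝ => f (s • v)) (fderiv ℝ f (t • v) v) t := fun t ht =>
    fderiv_comp_smul_hasDerivAt (hball _ (hmem t ht)).2
  have hmono : MonotoneOn (fun s : ℝ => f (s • v)) (Icc 0 1) := by
    refine monotoneOn_of_hasDerivWithinAt_nonneg (convex_Icc 0 1)
      (f' := fun t => fderiv ℝ f (t • v) v)
      (fun t ht => (hder t ht).continuousAt.continuousWithinAt)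
      (fun t ht => (hder t (interior_subset ht)).hasDerivWithinAt) fun t ht => ?_
    have ht' := interior_subset ht
    have h2 := (hball _ (hmem t ht')).1
    have h3 := (fderiv ℝ f (t • v) - B (t • v)).le_opNorm v
    rw [norm_smul, Real.norm_of_nonneg ht'.1] at h2
    have h4 : |fderiv ℝ f (t • v) v - t * B v v| ≤ κ * (t * ‖v‖) * ‖v‖ := by
      have h5 := h3.trans (mul_le_mul_of_nonneg_right h2 (norm_nonneg v))
      simpa using h5
    have h5 := (abs_le.1 h4).1
    nlinarith [mul_le_mul_of_nonneg_left (hpos v) ht'.1]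
  have := hmono (left_mem_Icc.2 zero_le_one) (right_mem_Icc.2 zero_le_one) zero_le_one
  simpa using this

/-- Second-order necessary condition for a local minimum. -/
theorem snd_deriv_nonneg_of_isLocalMin {E : Type*} [NormedAddCommGroup E] [NormedSpace ℝ E]
    {f : E → ℝ} {B : E →L[ℝ] E →L[ℝ] ℝ} (hd : ∀ᶠ x in 𝓝 (0 : E), DifferentiableAt ℝ f x)
    (hB : HasFDerivAt (fderiv ℝ f) B 0) (hmin : IsLocalMin f 0) (v : E) : 0 ≤ B v v := by
  by_contra! hneg
  have h0 : fderiv ℝ f 0 = 0 := hmin.fderiv_eq_zero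
  have hlim : Tendsto (fun t : ℝ => t • v) (𝓝 0) (𝓝 (0 : E)) := by
    have : Continuous fun t : ℝ => t • v := by fun_prop
    simpa using this.tendsto 0
  have hψ : HasDerivAt (fun t : ℝ => fderiv ℝ f (t • v) v) (B v v) 0 := by
    have h2 : HasDerivAt (fun τ : ℝ => τ • v) v 0 := by
      simpa using (hasDerivAt_id (0 : ℝ)).smul_const v
    have hB' : HasFDerivAt (fderiv ℝ f) B ((0 : ℝ) • v) := by simpa using hB
    have h3 : HasDerivAt (fun t : ℝ => fderiv ℝ f (t • v)) (B v) 0 := hB'.comp_hasDerivAt 0 h2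
    exact (ContinuousLinearMap.apply ℝ ℝ v).hasFDerivAt.comp_hasDerivAt 0 h3
  -- With half of `-(B v v)` as tolerance, the derivative of `f` along the ray at time `t` is at
  -- most `t * B v v / 2 < 0`.
  have h1 := hψ.isLittleO.def (c := -(B v v) / 2) (by linarith)
  have h2 := (h1.and (hlim.eventually (hd.and hmin)))
  obtain ⟨r, hr, hball⟩ := Metric.eventually_nhds_iff_ball.1 h2
  have hmem : ∀ t ∈ Icc (0 : ℝ) (r / 2), t ∈ Metric.ball (0 : ℝ) r := by
    intro t ht
    rw [mem_ball_zero_iff, Real.norm_of_nonneg ht.1]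
    linarith [ht.2]
  have hder : ∀ t ∈ Icc (0 : ℝ) (r / 2),
      HasDerivAt (fun s : ℝ => f (s • v)) (fderiv ℝ f (t • v) v) t := fun t ht =>
    fderiv_comp_smul_hasDerivAt (hball _ (hmem t ht)).2.1
  have hanti : StrictAntiOn (fun s : ℝ => f (s • v)) (Icc 0 (r / 2)) := by
    refine strictAntiOn_of_hasDerivWithinAt_neg (convex_Icc 0 (r / 2))
      (f' := fun t => fderiv ℝ f (t • v) v)
      (fun t ht => (hder t ht).continuousAt.continuousWithinAt)
      (fun t ht => (hder t (interior_subset ht)).hasDerivWithinAt) fun t ht => ?_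
    have ht' := interior_subset ht
    rw [interior_Icc] at ht
    have h3 := (hball _ (hmem t ht')).1
    simp only [zero_smul, h0, zero_apply, sub_zero, smul_eq_mul] at h3
    rw [Real.norm_eq_abs, Real.norm_of_nonneg ht'.1] at h3
    have h5 := (abs_le.1 h3).2
    nlinarith [ht.1]
  have h4 := hanti (left_mem_Icc.2 (by linarith)) (right_mem_Icc.2 (by linarith))
    (by linarith : (0 : ℝ) < r / 2)
  have h5 := (hball _ (hmem (r / 2) (right_mem_Icc.2 (by linarith)))).2.2
  simp only [zero_smul] at h4
  linarith

/-- A continuous function, homogeneous of degree two and positive away from the origin, is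
coercive. -/
theorem exists_coercive {E : Type*} [NormedAddCommGroup E] [NormedSpace ℝ E]
    [FiniteDimensional ℝ E] {Q : E → ℝ} (hQ : Continuous Q)
    (hhom : ∀ (t : ℝ) x, Q (t • x) = t ^ 2 * Q x) (hpos : ∀ x, x ≠ 0 → 0 < Q x) :
    ∃ κ : ℝ, 0 < κ ∧ ∀ x, κ * ‖x‖ ^ 2 ≤ Q x := by
  have hQ0 : Q 0 = 0 := by simpa using hhom 0 0
  rcases subsingleton_or_nontrivial E with hE | hE
  · exact ⟨1, one_pos, fun x => by rw [Subsingleton.elim x 0, hQ0]; simp⟩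
  obtain ⟨x0, hx0, hmin⟩ := (isCompact_sphere (0 : E) 1).exists_isMinOn
    (NormedSpace.sphere_nonempty.2 zero_le_one) hQ.continuousOn
  have hx0' : x0 ≠ 0 := by
    rintro rfl
    simp at hx0
  refine ⟨Q x0, hpos x0 hx0', fun x => ?_⟩
  by_cases hx : x = 0
  · simp [hx, hQ0]
  have hn : ‖x‖ ≠ 0 := norm_ne_zero_iff.2 hx
  have h1 : ‖x‖⁻¹ • x ∈ Metric.sphere (0 : E) 1 := by
    simp [norm_smul, hn]
  have h2 := hmin h1
  simp only [mem_ofPred_eq, hhom] at h2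
  have h3 : 0 < ‖x‖ ^ 2 := by positivity
  calc Q x0 * ‖x‖ ^ 2 ≤ (‖x‖⁻¹ ^ 2 * Q x) * ‖x‖ ^ 2 := by gcongr
    _ = Q x := by field_simp

end Analysis

/-! ### Linear flows, controllability and oscillatory dynamics -/

section LinearControl
open scoped Topology
open Set Filter

variable {E W : Type*} [NormedAddCommGroup E] [NormedSpace ℝ E]
  [NormedAddCommGroup W] [NormedSpace ℝ W]

/-- The flow `t ↦ exp (t A)` of a linear vector field. -/
def linFlow (A : E →L[ℝ] E) (t : ℝ) : E →L[ℝ] E := NormedSpace.exp (t • A)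

theorem linFlow_zero (A : E →L[ℝ] E) : linFlow A 0 = 1 := by
  simp [linFlow]

theorem hasDerivAt_linFlow [FiniteDimensional ℝ E] (A : E →L[ℝ] E) (t : ℝ) :
    HasDerivAt (linFlow A) (A * linFlow A t) t := by
  have : CompleteSpace E := FiniteDimensional.complete ℝ E
  exact hasDerivAt_exp_smul_const' A t

theorem continuous_linFlow [FiniteDimensional ℝ E] (A : E →L[ℝ] E) : Continuous (linFlow A) :=
  continuous_iff_continuousAt.2 fun t => (hasDerivAt_linFlow A t).continuousAt

theorem hasDerivAt_linFlow_apply [FiniteDimensional ℝ E] (A : E →L[ℝ] E) (x : E) (t : ℝ) :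
    HasDerivAt (fun t => linFlow A t x) (A (linFlow A t x)) t :=
  (ContinuousLinearMap.apply ℝ E x).hasFDerivAt.comp_hasDerivAt t (hasDerivAt_linFlow A t)

theorem linFlow_comm (A : E →L[ℝ] E) (t : ℝ) (x : E) :
    linFlow A t (A x) = A (linFlow A t x) := by
  have h : Commute (linFlow A t) A := ((Commute.refl A).smul_left t).exp_left
  exact congrArg (fun L : E →L[ℝ] E => L x) h.eq

theorem linFlow_mul_linFlow_neg [FiniteDimensional ℝ E] (A : E →L[ℝ] E) (t : ℝ) (x : E) :
    linFlow A t (linFlow (-A) t x) = x := by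
  have : CompleteSpace E := FiniteDimensional.complete ℝ E
  have h : linFlow A t * linFlow (-A) t = 1 := by
    let _ : NormedAlgebra ℚ (E →L[ℝ] E) := NormedAlgebra.restrictScalars ℚ ℝ (E →L[ℝ] E)
    unfold linFlow
    rw [← NormedSpace.exp_add_of_commute]
    · simp
    · exact ((Commute.refl A).neg_right).smul_left t |>.smul_right t
  exact congrArg (fun L : E →L[ℝ] E => L x) h

/-- Each differentiation in time brings out one more factor `A`; one-sided derivatives suffice at
the endpoints. Evaluated at time zero, this turns vanishing along the flow into a Kalman-type
condition. -/
theorem apply_pow_linFlow_eq_zero [FiniteDimensional ℝ E] {H : Type*} [NormedAddCommGroup H]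
    [NormedSpace ℝ H]
    (A : E →L[ℝ] E) (L : E →L[ℝ] H) (x : E)
    (h : ∀ t ∈ Icc (0 : ℝ) 1, L (linFlow A t x) = 0) (k : ℕ) :
    ∀ t ∈ Icc (0 : ℝ) 1, L ((A ^ k) (linFlow A t x)) = 0 := by
  induction k with
  | zero => simpa using h
  | succ k ih =>
    intro t ht
    have h1 : HasDerivAt (fun t => L ((A ^ k) (linFlow A t x)))
        (L ((A ^ k) (A (linFlow A t x)))) t :=
      (L.comp (A ^ k)).hasFDerivAt.comp_hasDerivAt t (hasDerivAt_linFlow_apply A x t)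
    have h2 : HasDerivWithinAt (fun t => L ((A ^ k) (linFlow A t x))) 0 (Icc 0 1) t :=
      (hasDerivWithinAt_const t (Icc (0 : ℝ) 1) (0 : H)).congr ih (ih t ht)
    have h3 := (uniqueDiffOn_Icc (zero_lt_one' ℝ) t ht).eq_deriv _ h1.hasDerivWithinAt h2
    rw [pow_succ]
    exact h3

/-- The Kalman rank condition, in dual form, implies controllability. -/
theorem isControllable_of_dual [FiniteDimensional ℝ E] (A : E →L[ℝ] E) (B : W →L[ℝ] E)
    (h : ∀ φ : E →L[ℝ] ℝ, (∀ (k : ℕ) w, φ ((A ^ k) (B w)) = 0) → φ = 0) :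
    IsControllable A B := by
  have : CompleteSpace E := FiniteDimensional.complete ℝ E
  have hcont : ∀ u : C(ℝ, W), Continuous fun s => linFlow (-A) s (B (u s)) := fun u =>
    (continuous_linFlow (-A)).clm_apply (B.continuous.comp u.continuous)
  -- By variation of constants, an input `u` steers `x₀` to `x₁` in unit time as soon as `R u =
  -- exp(-A) x₁ - x₀`, so surjectivity of `R` is enough.
  let R : C(ℝ, W) →ₗ[ℝ] E :=
    { toFun := fun u => ∫ s in (0 : ℝ)..1, linFlow (-A) s (B (u s))
      map_add' := fun u v => by
        simp only [ContinuousMap.add_apply, map_add]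
        exact intervalIntegral.integral_add ((hcont u).intervalIntegrable _ _)
          ((hcont v).intervalIntegrable _ _)
      map_smul' := fun c u => by
        simp only [ContinuousMap.smul_apply, map_smul, RingHom.id_apply]
        exact intervalIntegral.integral_smul _ _ }
  have hR : LinearMap.range R = ⊤ := by
    by_contra hne
    obtain ⟨φ, hφ0, hφ⟩ := Submodule.exists_le_ker_of_lt_top _ (lt_top_iff_ne_top.2 hne)
    let φ' : E →L[ℝ] ℝ := LinearMap.toContinuousLinearMap φ
    have hφ' : φ' = 0 := by
      refine h φ' fun k w => ?_
      let ψ : ℝ → ℝ := fun s => φ' (linFlow (-A) s (B w))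
      have hψ : Continuous ψ :=
        φ'.continuous.comp ((continuous_linFlow (-A)).clm_apply continuous_const)
      have hint : ∫ s in (0 : ℝ)..1, ψ s * ψ s = 0 := by
        -- Testing the functional against the input `ψ • w` turns its vanishing on the range of `R`
        -- into `∫ ψ² = 0`.
        let u : C(ℝ, W) := ⟨fun s => ψ s • w, hψ.smul continuous_const⟩
        have h1 : φ' (R u) = 0 := hφ ⟨u, rfl⟩
        have h2 : φ' (R u) = ∫ s in (0 : ℝ)..1, φ' (linFlow (-A) s (B (u s))) :=
          (φ'.intervalIntegral_comp_comm ((hcont u).intervalIntegrable 0 1)).symm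
        rw [h2] at h1
        simpa [u, ψ] using h1
      have hz : ∀ t ∈ Icc (0 : ℝ) 1, φ' (linFlow (-A) t (B w)) = 0 := by
        intro t ht
        by_contra hne
        have := intervalIntegral.integral_pos zero_lt_one (hψ.mul hψ).continuousOn
          (fun s _ => mul_self_nonneg (ψ s)) ⟨t, ht, mul_self_pos.2 hne⟩
        exact this.ne' hint
      have h3 := apply_pow_linFlow_eq_zero (-A) φ' (B w) hz k 0 (by simp)
      rw [linFlow_zero, neg_pow] at h3
      rcases neg_one_pow_eq_or (E →L[ℝ] E) k with h4 | h4 <;> simpa [h4] using h3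
    apply hφ0
    ext x
    exact congrArg (fun L : E →L[ℝ] ℝ => L x) hφ'
  intro x₀ x₁
  obtain ⟨u, hu⟩ : linFlow (-A) 1 x₁ - x₀ ∈ LinearMap.range R := hR ▸ Submodule.mem_top
  refine ⟨1, one_pos, u,
    fun t => linFlow A t (x₀ + ∫ s in (0 : ℝ)..t, linFlow (-A) s (B (u s))), u.continuous,
    fun t _ => ?_, by simp [linFlow_zero], ?_⟩
  · have h1 := (hasDerivAt_linFlow A t).clm_apply
      ((intervalIntegral.integral_hasDerivAt_right ((hcont u).intervalIntegrable 0 t)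
        ((hcont u).stronglyMeasurableAtFilter _ _) (hcont u).continuousAt).const_add x₀)
    rw [linFlow_mul_linFlow_neg] at h1
    exact h1.hasDerivWithinAt
  · have h1 : ∫ s in (0 : ℝ)..1, linFlow (-A) s (B (u s)) = linFlow (-A) 1 x₁ - x₀ := hu
    simp only [h1, add_sub_cancel, linFlow_mul_linFlow_neg]

/-- A quotient of the state space on which the input does not act obstructs controllability. -/
theorem not_isControllable_of_intertwines {H : Type*} [NormedAddCommGroup H] [NormedSpace ℝ H]
    {A : E →L[ℝ] E} {B : W →L[ℝ] E} (φ : E →L[ℝ] H) (Λ : H →L[ℝ] H)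
    (hA : ∀ x, φ (A x) = Λ (φ x)) (hB : ∀ w, φ (B w) = 0) (hφ : φ ≠ 0) :
    ¬ IsControllable A B := by
  intro hc
  obtain ⟨x₁, hx₁⟩ : ∃ x, φ x ≠ 0 := by
    by_contra! hne
    exact hφ (ContinuousLinearMap.ext hne)
  obtain ⟨T, hT, u, x, -, hx, h0, h1⟩ := hc 0 x₁
  have hy : ∀ t ∈ Icc 0 T, HasDerivWithinAt (fun t => φ (x t)) (Λ (φ (x t))) (Icc 0 T) t := by
    intro t ht
    have := φ.hasFDerivAt.comp_hasDerivWithinAt t (hx t ht)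
    rwa [map_add, hA, hB, add_zero] at this
  -- Whatever the input, the image under `φ` solves an autonomous linear equation from zero, so it
  -- never reaches `φ x₁ ≠ 0`.
  have huniq : EqOn (fun t => φ (x t)) (fun _ => 0) (Icc 0 T) := by
    refine ODE_solution_unique_of_mem_Icc_right (v := fun _ y => Λ y) (s := fun _ => univ)
      (K := ‖Λ‖₊) (fun t _ => Λ.lipschitz.lipschitzOnWith) (fun t ht => (hy t ht).continuousWithinAt)
      (fun t ht => ?_) (fun _ _ => mem_univ _) continuousOn_const
      (fun t ht => ?_) (fun _ _ => mem_univ _) (by simp [h0])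
    · exact (hy t (Ico_subset_Icc_self ht)).mono_of_mem_nhdsWithin
        (mem_of_superset (Icc_mem_nhdsGE_of_mem ht) subset_rfl)
    · simpa using hasDerivWithinAt_const t (Ici t) (0 : H)
  have := huniq (right_mem_Icc.2 hT.le)
  simp only [h1] at this
  exact hx₁ this

theorem apply_eq_zero_of_mem_controllableSubspace {H : Type*} [AddCommGroup H] [Module ℝ H]
    {A : E →L[ℝ] E} {B : W →L[ℝ] E} (φ : E →ₗ[ℝ] H)
    (h : ∀ (k : ℕ) w, φ ((A ^ k) (B w)) = 0) {x : E} (hx : x ∈ controllableSubspace A B) :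
    φ x = 0 := by
  have : controllableSubspace A B ≤ LinearMap.ker φ := by
    refine iSup_le fun k => ?_
    rintro _ ⟨w, rfl⟩
    exact h k w
  exact this hx

/-- A polynomial relation on the dual of the uncontrollable dynamics holds for the dynamics. -/
theorem uncontrollablePart_sq_eq [FiniteDimensional ℝ E] {A : E →L[ℝ] E} {B : W →L[ℝ] E} {c : ℝ}
    (h : ∀ φ : E →L[ℝ] ℝ, (∀ (k : ℕ) w, φ ((A ^ k) (B w)) = 0) →
      ∀ x, φ (A (A x)) = -c * φ x) (y : E ⧸ controllableSubspace A B) :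
    uncontrollablePart A B (uncontrollablePart A B y) = -c • y := by
  obtain ⟨x, rfl⟩ := Submodule.mkQ_surjective _ y
  simp only [uncontrollablePart, Submodule.mkQ_apply, Submodule.mapQ_apply]
  rw [← Submodule.Quotient.mk_smul, Submodule.Quotient.eq]
  by_contra hne
  obtain ⟨φ, hφx, hφ⟩ := Submodule.exists_le_ker_of_notMem hne
  apply hφx
  have h1 := h (LinearMap.toContinuousLinearMap φ) (fun k w => hφ
    (Submodule.mem_iSup_of_mem k ⟨w, rfl⟩)) x
  simp only [LinearMap.coe_toContinuousLinearMap'] at h1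
  simp [h1]

/-- The real number `μ` differs from every eigenvalue, these being nonzero and imaginary. The
complexified functional therefore kills each eigenspace, and the eigenspaces span. -/
theorem IsOscillatory.eq_zero_of_comp_eq_smul {X : Type*} [AddCommGroup X] [Module ℝ X]
    {A : Module.End ℝ X} (hA : IsOscillatory A) {φ : X →ₗ[ℝ] ℝ} {μ : ℝ}
    (h : ∀ x, φ (A x) = μ * φ x) : φ = 0 := by
  let AC : Module.End ℂ (TensorProduct ℝ ℂ X) := LinearMap.baseChange ℂ A
  let φC : TensorProduct ℝ ℂ X →ₗ[ℂ] TensorProduct ℝ ℂ ℝ := LinearMap.baseChange ℂ φ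
  have h1 : φC ∘ₗ AC = (μ : ℂ) • φC := by
    ext x
    simp only [φC, AC, TensorProduct.AlgebraTensorModule.curry_apply, LinearMap.restrictScalars_comp,
      TensorProduct.curry_apply,
      LinearMap.coe_comp, LinearMap.coe_restrictScalars, Function.comp_apply,
      LinearMap.baseChange_tmul, LinearMap.smul_apply, h,
      TensorProduct.smul_tmul', smul_eq_mul, mul_one]
    rw [← smul_eq_mul, ← TensorProduct.smul_tmul]
    simp
  have h2 : ∀ ν : ℂ, Module.End.eigenspace AC ν ≤ LinearMap.ker φC := by
    intro ν v hv
    by_cases hv0 : v = 0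
    · simp [hv0]
    have hν := hA.2 ν (Module.End.hasEigenvalue_of_hasEigenvector ⟨hv, hv0⟩)
    have h3 : φC (AC v) = (μ : ℂ) • φC v := congrArg (fun L => L v) h1
    rw [Module.End.mem_eigenspace_iff.1 hv, map_smul, ← sub_eq_zero, ← sub_smul,
      smul_eq_zero] at h3
    refine h3.resolve_left fun h4 => ?_
    have h5 : ν = (μ : ℂ) := sub_eq_zero.1 h4
    rw [h5] at hν
    exact hν.1 (by rw [← Complex.ofReal_re μ, hν.2]; simp)
  have h3 : (⊤ : Submodule ℂ (TensorProduct ℝ ℂ X)) ≤ LinearMap.ker φC := by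
    rw [← hA.1]
    exact iSup_le h2
  ext x
  have h4 : φC ((1 : ℂ) ⊗ₜ[ℝ] x) = 0 := h3 (Submodule.mem_top)
  have h5 := congrArg (TensorProduct.rid ℝ ℂ) h4
  simpa [φC] using h5

/-- With `s = √c`, the polynomial X² + s² has the two distinct roots ±is; every vector is half the
sum of `v - (ε / s) • A v` for `ε = ±i`, each an eigenvector or zero. -/
theorem isOscillatory_of_sq {X : Type*} [AddCommGroup X] [Module ℝ X]
    {A : Module.End ℝ X} {c : ℝ} (hc : 0 < c) (h : ∀ x, A (A x) = -c • x) :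
    IsOscillatory A := by
  let AC : Module.End ℂ (TensorProduct ℝ ℂ X) := LinearMap.baseChange ℂ A
  have hAC : ∀ v, AC (AC v) = (-c : ℂ) • v := by
    have : AC ∘ₗ AC = (-c : ℂ) • LinearMap.id := by
      ext x
      simp only [AC, TensorProduct.AlgebraTensorModule.curry_apply, LinearMap.restrictScalars_comp,
      TensorProduct.curry_apply,
        LinearMap.coe_comp, LinearMap.coe_restrictScalars, Function.comp_apply,
        LinearMap.baseChange_tmul, LinearMap.smul_apply, h, LinearMap.id_apply,
        TensorProduct.smul_tmul', smul_eq_mul, mul_one]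
      rw [← TensorProduct.smul_tmul]
      simp
    exact fun v => congrArg (fun L => L v) this
  obtain ⟨s, hs, rfl⟩ : ∃ s : ℝ, 0 < s ∧ s ^ 2 = c :=
    ⟨√c, Real.sqrt_pos.2 hc, Real.sq_sqrt hc.le⟩
  have hs' : (s : ℂ) ≠ 0 := by exact_mod_cast hs.ne'
  have hI : Complex.I ^ 2 = -1 := Complex.I_sq
  have hmem : ∀ (v : TensorProduct ℝ ℂ X) (ε : ℂ), ε ^ 2 = -1 →
      v - (ε / s) • AC v ∈ Module.End.eigenspace AC (ε * s) := by
    intro v ε hε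
    rw [Module.End.mem_eigenspace_iff, map_sub, map_smul, hAC, smul_sub, smul_smul, smul_smul]
    have e1 : ε / s * -((s ^ 2 : ℝ) : ℂ) = -(ε * s) := by
      push_cast
      field_simp
    have e2 : ε * s * (ε / s) = -1 := by
      field_simp
      exact hε
    rw [e1, e2]
    module
  refine ⟨?_, fun μ hμ => ?_⟩
  · rw [eq_top_iff]
    intro v _
    have h1 := hmem v Complex.I hI
    have h2 := hmem v (-Complex.I) (by simp)
    have hv : v = (1 / 2 : ℂ) • (v - (Complex.I / s) • AC v) +
        (1 / 2 : ℂ) • (v - (-Complex.I / s) • AC v) := by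
      rw [neg_div]
      module
    rw [hv]
    exact add_mem
      (Submodule.smul_mem _ _ (Submodule.mem_iSup_of_mem (Complex.I * s) h1))
      (Submodule.smul_mem _ _ (Submodule.mem_iSup_of_mem (-Complex.I * s) h2))
  · obtain ⟨v, hv⟩ := hμ.exists_hasEigenvector
    have hv1 : AC v = μ • v := hv.apply_eq_smul
    have h1 := hAC v
    rw [hv1, map_smul, hv1, smul_smul, ← sub_eq_zero, ← sub_smul, smul_eq_zero] at h1
    have h2 := h1.resolve_right hv.2
    have hre := congrArg Complex.re h2
    have him := congrArg Complex.im h2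
    simp [sq] at hre him
    have h3 : μ.re = 0 ∨ μ.im = 0 := by
      have : μ.re * μ.im = 0 := by linarith
      exact mul_eq_zero.1 this
    refine ⟨?_, ?_⟩
    · rintro rfl
      simp at hre
      exact hs.ne' hre
    · rcases h3 with h3 | h3
      · exact h3
      · rw [h3] at hre
        nlinarith [sq_nonneg μ.re, mul_pos hs hs]

end LinearControl

/-! ### Lyapunov functions and exponential stability -/

section Stability
open scoped Topology
open Set Filter

variable {E : Type*} [NormedAddCommGroup E] [NormedSpace ℝ E]

/-- A quadratic Lyapunov function whose dissipation is observable can be averaged along the flow to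
a strict one. -/
theorem exists_strict_lyapunov [FiniteDimensional ℝ E] {H : Type*} [NormedAddCommGroup H]
    [NormedSpace ℝ H] (F : E →L[ℝ] E) (P : E →L[ℝ] E →L[ℝ] ℝ) (L : E →L[ℝ] H)
    (hsymm : ∀ x y, P x y = P y x) (hpos : ∀ x, x ≠ 0 → 0 < P x x)
    (hdiss : ∀ x, P x (F x) ≤ 0) (hzero : ∀ x, P x (F x) = 0 → L x = 0)
    (hobs : ∀ x, (∀ k : ℕ, L ((F ^ k) x) = 0) → x = 0) :
    ∃ (W : E →L[ℝ] E →L[ℝ] ℝ) (κ₁ κ₂ : ℝ), 0 < κ₁ ∧ 0 < κ₂ ∧ (∀ x y, W x y = W y x) ∧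
      (∀ x, κ₁ * ‖x‖ ^ 2 ≤ W x x) ∧ ∀ x, W x (F x) ≤ -κ₂ * ‖x‖ ^ 2 := by
  have hcP : Continuous fun t : ℝ => P.bilinearComp (linFlow F t) (linFlow F t) := by
    have hc := continuous_linFlow F
    have h1 : Continuous fun t : ℝ => (P.comp (linFlow F t)).flip :=
      (ContinuousLinearMap.flipₗᵢ ℝ E E ℝ).continuous.comp (continuous_const.clm_comp hc)
    exact (ContinuousLinearMap.flipₗᵢ ℝ E E ℝ).continuous.comp (h1.clm_comp hc)
  -- The average of `P` over one unit of time along the flow: zero dissipation of `W` at `x` means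
  -- zero dissipation of `P` on a whole time interval.
  let W : E →L[ℝ] E →L[ℝ] ℝ :=
    ∫ t in (0 : ℝ)..1, P.bilinearComp (linFlow F t) (linFlow F t)
  have hW : ∀ x y, W x y = ∫ t in (0 : ℝ)..1, P (linFlow F t x) (linFlow F t y) := by
    intro x y
    have h1 : W x = ∫ t in (0 : ℝ)..1, P.bilinearComp (linFlow F t) (linFlow F t) x :=
      (ContinuousLinearMap.intervalIntegral_apply (hcP.intervalIntegrable 0 1) x)
    have h2 : Continuous fun t : ℝ => P.bilinearComp (linFlow F t) (linFlow F t) x :=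
      hcP.clm_apply continuous_const
    rw [h1]
    exact ContinuousLinearMap.intervalIntegral_apply (h2.intervalIntegrable 0 1) y
  have hcont : ∀ x y, Continuous fun t : ℝ => P (linFlow F t x) (linFlow F t y) := fun x y =>
    (hcP.clm_apply continuous_const).clm_apply continuous_const
  have hinj : ∀ t x, x ≠ 0 → linFlow F t x ≠ 0 := by
    intro t x hx h0
    have := linFlow_mul_linFlow_neg (-F) t x
    rw [neg_neg, h0, map_zero] at this
    exact hx this.symm
  have hWpos : ∀ x, x ≠ 0 → 0 < W x x := by
    intro x hx
    rw [hW]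
    exact intervalIntegral.integral_pos zero_lt_one (hcont x x).continuousOn
      (fun t _ => (hpos _ (hinj t x hx)).le) ⟨0, by simp, hpos _ (hinj 0 x hx)⟩
  have hWneg : ∀ x, x ≠ 0 → 0 < -W x (F x) := by
    intro x hx
    rw [hW, ← intervalIntegral.integral_neg]
    refine intervalIntegral.integral_pos zero_lt_one (hcont x (F x)).neg.continuousOn
      (fun t _ => ?_) ?_
    · rw [linFlow_comm]
      exact neg_nonneg.2 (hdiss _)
    -- If the integrand is never positive, then `L` vanishes along the flow of `x` on the unit
    -- interval, and observability gives `x = 0`.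
    · by_contra! hne
      refine hx (hobs x fun k => ?_)
      have := apply_pow_linFlow_eq_zero F L x (fun t ht => hzero _ ?_) k 0 (by simp)
      · simpa [linFlow_zero] using this
      · have h1 := hne t ht
        rw [linFlow_comm] at h1
        exact le_antisymm (hdiss _) (neg_nonpos.1 h1)
  obtain ⟨κ₁, hκ₁, h₁⟩ := exists_coercive (Q := fun x => W x x) (by fun_prop)
    (fun t x => by simp; ring) hWpos
  obtain ⟨κ₂, hκ₂, h₂⟩ := exists_coercive (Q := fun x => -W x (F x)) (by fun_prop)
    (fun t x => by simp; ring) hWneg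
  refine ⟨W, κ₁, κ₂, hκ₁, hκ₂, fun x y => ?_, h₁, fun x => by linarith [h₂ x]⟩
  rw [hW, hW]
  simp only [hsymm]

/-- Solutions of a bounded, globally Lipschitz autonomous equation exist for all positive times. -/
theorem exists_solution_Ici [CompleteSpace E] {f : E → E} {K : NNReal} (hf : LipschitzWith K f)
    {b : NNReal} (hb : ∀ x, ‖f x‖ ≤ b) (x₀ : E) :
    ∃ x : ℝ → E, x 0 = x₀ ∧ ∀ t, 0 ≤ t → HasDerivWithinAt x (f (x t)) (Ici 0) t := by
  have hex : ∀ N : ℕ, ∃ x : ℝ → E, x 0 = x₀ ∧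
      ∀ t ∈ Icc (0 : ℝ) N, HasDerivWithinAt x (f (x t)) (Icc 0 N) t := by
    intro N
    -- A field bounded by `b` moves a point by at most `b * N` in time `N`, so a ball of this radius
    -- serves on the whole interval.
    have hpl : IsPicardLindelof (fun _ => f) (tmin := 0) (tmax := (N : ℝ))
        ⟨0, left_mem_Icc.2 N.cast_nonneg⟩ x₀ (b * N) 0 b K := by
      refine IsPicardLindelof.of_time_independent (fun x _ => hb x) hf.lipschitzOnWith ?_
      simp
    exact hpl.exists_eq_forall_mem_Icc_hasDerivWithinAt₀
  choose X hX0 hX using hex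
  have hagree : ∀ N M : ℕ, N ≤ M → EqOn (X N) (X M) (Icc 0 N) := by
    intro N M hNM
    have hsub : Icc (0 : ℝ) N ⊆ Icc 0 M := Icc_subset_Icc_right (by exact_mod_cast hNM)
    have hXM : ∀ t ∈ Icc (0 : ℝ) N, HasDerivWithinAt (X M) (f (X M t)) (Icc 0 N) t :=
      fun t ht => (hX M t (hsub ht)).mono hsub
    refine ODE_solution_unique_of_mem_Icc_right (v := fun _ => f) (s := fun _ => univ)
      (K := K) (fun t _ => hf.lipschitzOnWith) (fun t ht => (hX N t ht).continuousWithinAt)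
      (fun t ht => ?_) (fun _ _ => mem_univ _) (fun t ht => (hXM t ht).continuousWithinAt)
      (fun t ht => ?_) (fun _ _ => mem_univ _) (by rw [hX0, hX0])
    · exact (hX N t (Ico_subset_Icc_self ht)).mono_of_mem_nhdsWithin (Icc_mem_nhdsGE_of_mem ht)
    · exact (hXM t (Ico_subset_Icc_self ht)).mono_of_mem_nhdsWithin (Icc_mem_nhdsGE_of_mem ht)
  refine ⟨fun t => X (⌈t⌉₊ + 1) t, by simp [hX0], fun t ht => ?_⟩
  -- Near `t` all the pieces agree with the single solution of index `⌈t⌉₊ + 2`, whose interval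
  -- reaches beyond `t`.
  have hloc : ∀ s ∈ Ico (0 : ℝ) (t + 1), X (⌈s⌉₊ + 1) s = X (⌈t⌉₊ + 2) s := by
    intro s hs
    refine hagree _ _ ?_ ⟨hs.1, ?_⟩
    · have h1 : ⌈s⌉₊ ≤ ⌈t⌉₊ + 1 := by
        rw [Nat.ceil_le]
        push_cast
        linarith [Nat.le_ceil t, hs.2]
      omega
    · push_cast
      linarith [Nat.le_ceil s]
  have htM : t ∈ Icc (0 : ℝ) ((⌈t⌉₊ + 2 : ℕ) : ℝ) :=
    ⟨ht, by push_cast; linarith [Nat.le_ceil t]⟩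
  have h1 : HasDerivWithinAt (X (⌈t⌉₊ + 2)) (f (X (⌈t⌉₊ + 2) t)) (Ici 0) t := by
    refine (hX (⌈t⌉₊ + 2) t htM).mono_of_mem_nhdsWithin ?_
    have h2 : Iio ((⌈t⌉₊ + 2 : ℕ) : ℝ) ∈ 𝓝 t :=
      Iio_mem_nhds (by push_cast; linarith [Nat.le_ceil t])
    filter_upwards [self_mem_nhdsWithin, mem_nhdsWithin_of_mem_nhds h2] with s hs hs'
    exact ⟨hs, le_of_lt hs'⟩
  have ht1 : t ∈ Ico (0 : ℝ) (t + 1) := ⟨ht, by linarith⟩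
  beta_reduce
  rw [hloc t ht1]
  refine h1.congr_of_eventuallyEq ?_ (hloc t ht1)
  have h2 : Iio (t + 1) ∈ 𝓝 t := Iio_mem_nhds (by linarith)
  filter_upwards [self_mem_nhdsWithin, mem_nhdsWithin_of_mem_nhds h2] with s hs hs'
  exact hloc s ⟨hs, hs'⟩

/-- Exponential decay along solutions starting well inside a ball on which a quadratic Lyapunov
function decays. -/
theorem norm_le_exp_of_lyapunov {f : E → E} {W : E →L[ℝ] E →L[ℝ] ℝ}
    (hsymm : ∀ x y, W x y = W y x) {κ b a r : ℝ} (hκ : 0 < κ) (hb : 0 < b) (ha : 0 < a)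
    (hlow : ∀ x, κ * ‖x‖ ^ 2 ≤ W x x) (hup : ∀ x, W x x ≤ b * ‖x‖ ^ 2)
    (hdecay : ∀ x, ‖x‖ < r → W x (f x) ≤ -a * W x x)
    {x : ℝ → E} (hx : ∀ t, 0 ≤ t → HasDerivWithinAt x (f (x t)) (Ici 0) t)
    (h0 : b * ‖x 0‖ ^ 2 < κ * r ^ 2) (hr : 0 < r) {t : ℝ} (ht : 0 ≤ t) :
    ‖x t‖ < r ∧ κ * ‖x t‖ ^ 2 ≤ Real.exp (-(2 * a) * t) * (b * ‖x 0‖ ^ 2) := by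
  have hcx : ContinuousOn x (Ici 0) := fun t ht => (hx t ht).continuousWithinAt
  -- As long as the trajectory stays in the ball, `exp (2 a s) W` decreases.
  have hanti : ∀ τ, (∀ s ∈ Ioo 0 τ, ‖x s‖ < r) →
      AntitoneOn (fun s => Real.exp (2 * a * s) * W (x s) (x s)) (Icc 0 τ) := by
    intro τ hτ
    refine antitoneOn_of_hasDerivWithinAt_nonpos (convex_Icc 0 τ)
      (f' := fun s => Real.exp (2 * a * s) * (2 * a) * W (x s) (x s) +
        Real.exp (2 * a * s) * (2 * W (x s) (f (x s)))) ?_ (fun s hs => ?_) (fun s hs => ?_)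
    · have hcx' := hcx.mono (Icc_subset_Ici_self : Icc 0 τ ⊆ Ici 0)
      exact (by fun_prop : ContinuousOn (fun s => Real.exp (2 * a * s)) (Icc 0 τ)).mul
        ((W.continuous.comp_continuousOn hcx').clm_apply hcx')
    · rw [interior_Icc] at hs
      have h1 : HasDerivAt x (f (x s)) s :=
        (hx s hs.1.le).hasDerivAt (Ici_mem_nhds hs.1)
      have h2 : HasDerivAt (fun s => W (x s) (x s)) (2 * W (x s) (f (x s))) s := by
        have h3 : HasDerivAt (fun s => W (x s)) (W (f (x s))) s :=
          W.hasFDerivAt.comp_hasDerivAt s h1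
        refine (h3.clm_apply h1).congr_deriv ?_
        rw [hsymm (f (x s))]
        ring
      have h4 : HasDerivAt (fun s => Real.exp (2 * a * s)) (Real.exp (2 * a * s) * (2 * a)) s := by
        simpa using ((hasDerivAt_id s).const_mul (2 * a)).exp
      exact (h4.mul h2).hasDerivWithinAt
    · rw [interior_Icc] at hs
      have h1 := hdecay _ (hτ s hs)
      have h2 := Real.exp_pos (2 * a * s)
      nlinarith
  have hest : ∀ τ, 0 ≤ τ → (∀ s ∈ Ioo 0 τ, ‖x s‖ < r) →
      κ * ‖x τ‖ ^ 2 ≤ Real.exp (-(2 * a) * τ) * (b * ‖x 0‖ ^ 2) := by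
    intro τ hτ0 hτ
    have h1 := hanti τ hτ (left_mem_Icc.2 hτ0) (right_mem_Icc.2 hτ0) hτ0
    simp only [mul_zero, Real.exp_zero, one_mul] at h1
    have h2 := hlow (x τ)
    have h3 := hup (x 0)
    have h4 : Real.exp (-(2 * a) * τ) * Real.exp (2 * a * τ) = 1 := by
      rw [← Real.exp_add]; simp
    have h5 := Real.exp_pos (-(2 * a) * τ)
    calc κ * ‖x τ‖ ^ 2 ≤ W (x τ) (x τ) := h2
      _ = Real.exp (-(2 * a) * τ) * (Real.exp (2 * a * τ) * W (x τ) (x τ)) := by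
        rw [← mul_assoc, h4, one_mul]
      _ ≤ _ := mul_le_mul_of_nonneg_left (h1.trans h3) h5.le
  have hin : ∀ s, 0 ≤ s → ‖x s‖ < r := by
    by_contra! hne
    obtain ⟨t₁, ht₁, hrt₁⟩ := hne
    -- At the first exit time the decay estimate still holds, and it contradicts the smallness of
    -- the initial state.
    let A : Set ℝ := {s | s ∈ Icc 0 t₁ ∧ r ≤ ‖x s‖}
    have hAne : A.Nonempty := ⟨t₁, ⟨ht₁, le_rfl⟩, hrt₁⟩
    have hAcl : IsClosed A :=
      ContinuousOn.preimage_isClosed_of_isClosed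
        (hcx.mono Icc_subset_Ici_self).norm isClosed_Icc isClosed_Ici
    have hbdd : BddBelow A := ⟨0, fun s hs => hs.1.1⟩
    have hmem := hAcl.csInf_mem hAne hbdd
    have hlt : ∀ s ∈ Ioo 0 (sInf A), ‖x s‖ < r := by
      intro s hs
      by_contra! hge
      exact notMem_of_lt_csInf hs.2 hbdd ⟨⟨hs.1.le, hs.2.le.trans hmem.1.2⟩, hge⟩
    have h1 := hest _ hmem.1.1 hlt
    have h2 : Real.exp (-(2 * a) * sInf A) ≤ 1 := by
      rw [Real.exp_le_one_iff]
      nlinarith [hmem.1.1]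
    have h3 : 0 ≤ b * ‖x 0‖ ^ 2 := by positivity
    have h4 : κ * r ^ 2 ≤ κ * ‖x (sInf A)‖ ^ 2 := by
      have := hmem.2
      gcongr
    nlinarith
  exact ⟨hin t ht, hest t ht fun s hs => hin s hs.1.le⟩

/-- Lyapunov's indirect method: a strict quadratic Lyapunov function for the linearization gives
local exponential stability. -/
theorem isLocallyExponentiallyStable_of_lyapunov [FiniteDimensional ℝ E] {f : E → E} {Ω : Set E}
    (hΩ : IsOpen Ω) (h0Ω : (0 : E) ∈ Ω) (hf : ContDiffOn ℝ ∞ f Ω) (hf0 : f 0 = 0)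
    {F : E →L[ℝ] E} (hF : HasFDerivAt f F 0) {W : E →L[ℝ] E →L[ℝ] ℝ} {κ₁ κ₂ : ℝ}
    (hκ₁ : 0 < κ₁) (hκ₂ : 0 < κ₂) (hsymm : ∀ x y, W x y = W y x)
    (hlow : ∀ x, κ₁ * ‖x‖ ^ 2 ≤ W x x) (hdec : ∀ x, W x (F x) ≤ -κ₂ * ‖x‖ ^ 2) :
    IsLocallyExponentiallyStable f Ω := by
  have : CompleteSpace E := FiniteDimensional.complete ℝ E
  set b : ℝ := ‖W‖ + 1 with hb_def
  have hb : 0 < b := by positivity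
  have hWle : ∀ x y, |W x y| ≤ b * ‖x‖ * ‖y‖ := by
    intro x y
    have h1 := W.le_opNorm₂ x y
    rw [Real.norm_eq_abs] at h1
    refine h1.trans ?_
    gcongr
    linarith
  have hup : ∀ x, W x x ≤ b * ‖x‖ ^ 2 := fun x => by
    have := (le_abs_self _).trans (hWle x x)
    linarith [this, sq ‖x‖, mul_assoc b ‖x‖ ‖x‖, congrArg (b * ·) (sq ‖x‖)]
  obtain ⟨χ, hχ, hχc, hχs, hχ1⟩ := exists_bump (hΩ.mem_nhds h0Ω)
  -- With this tolerance the nonlinear remainder consumes half of the dissipation `κ₂ ‖x‖²`; the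
  -- other half dominates `a W` for `a = κ₂ / (2 b)`.
  have hlo := hF.isLittleO.def (c := κ₂ / (2 * b)) (by positivity)
  simp only [hf0, sub_zero] at hlo
  obtain ⟨r, hr, hball⟩ := Metric.eventually_nhds_iff_ball.1
    (hlo.and (hχ1.and (hΩ.mem_nhds h0Ω)))
  have hball' : ∀ x, ‖x‖ < r → ‖f x - F x‖ ≤ κ₂ / (2 * b) * ‖x‖ ∧ χ x = 1 ∧ x ∈ Ω :=
    fun x hx => hball x (mem_ball_zero_iff.2 hx)
  set a : ℝ := κ₂ / (2 * b) with ha_def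
  have ha : 0 < a := by positivity
  have hab : a * b = κ₂ / 2 := by rw [ha_def]; field_simp
  have hdecay : ∀ x, ‖x‖ < r → W x (f x) ≤ -a * W x x := by
    intro x hx
    have h1 : W x (f x) = W x (F x) + W x (f x - F x) := by simp
    have h2 : W x (f x - F x) ≤ b * ‖x‖ * (a * ‖x‖) :=
      (le_abs_self _).trans ((hWle _ _).trans
        (mul_le_mul_of_nonneg_left (hball' x hx).1 (by positivity)))
    have h3 : b * ‖x‖ * (a * ‖x‖) = κ₂ / 2 * ‖x‖ ^ 2 := by rw [← hab]; ring
    have h4 := mul_le_mul_of_nonneg_left (hup x) ha.le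
    have h5 : a * (b * ‖x‖ ^ 2) = κ₂ / 2 * ‖x‖ ^ 2 := by rw [← hab]; ring
    linarith [hdec x]
  -- The ratio of the two bounds on `W`: starting within `r / c` keeps the trajectory within `r`.
  set c : ℝ := √(b / κ₁) with hc_def
  have hc : 0 < c := Real.sqrt_pos.2 (by positivity)
  have hc2 : κ₁ * c ^ 2 = b := by
    rw [hc_def, Real.sq_sqrt (by positivity)]
    field_simp
  have hinit : ∀ x : E, ‖x‖ < r / c → b * ‖x‖ ^ 2 < κ₁ * r ^ 2 := by
    intro x hx
    rw [lt_div_iff₀ hc] at hx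
    have h1 : (‖x‖ * c) ^ 2 < r ^ 2 := by
      have := norm_nonneg x
      gcongr
    calc b * ‖x‖ ^ 2 = κ₁ * (‖x‖ * c) ^ 2 := by rw [← hc2]; ring
      _ < κ₁ * r ^ 2 := by gcongr
  refine ⟨r / c, c, a, by positivity, hc, ha, fun x₀ hx₀ => ?_, fun x hx hx0 t ht => ?_⟩
  -- The truncated field is bounded and globally Lipschitz, hence has global forward solutions. They
  -- stay where `χ = 1` and so solve the original equation.
  · have hsm : ContDiff ℝ ∞ fun x => χ x • f x :=
      contDiff_smul_of_tsupport_subset hχ hΩ hχs hf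
    have hcs : HasCompactSupport fun x => χ x • f x := hχc.smul_right
    obtain ⟨K, hK⟩ := hsm.lipschitzWith_of_hasCompactSupport hcs (by simp)
    obtain ⟨B, hB⟩ := hsm.continuous.bounded_above_of_compact_support hcs
    obtain ⟨x, hx0, hx⟩ := exists_solution_Ici hK (b := B.toNNReal)
      (fun y => (hB y).trans (Real.le_coe_toNNReal B)) x₀
    have hst : ∀ t, 0 ≤ t → ‖x t‖ < r := fun t ht =>
      (norm_le_exp_of_lyapunov (f := fun x => χ x • f x) hsymm hκ₁ hb ha hlow hup (fun y hy => by
        simp only [(hball' y hy).2.1, one_smul]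
        exact hdecay y hy) hx (by rw [hx0]; exact hinit x₀ hx₀) hr ht).1
    refine ⟨x, fun t ht => ⟨(hball' _ (hst t ht)).2.2, ?_⟩, hx0⟩
    have h1 := hx t ht
    rwa [(hball' _ (hst t ht)).2.1, one_smul] at h1
  · have h1 := (norm_le_exp_of_lyapunov hsymm hκ₁ hb ha hlow hup hdecay
      (fun t ht => (hx t ht).2) (hinit _ hx0) hr ht).2
    have h2 : Real.exp (-(2 * a) * t) = Real.exp (-a * t) ^ 2 := by
      rw [← Real.exp_nat_mul]
      congr 1
      push_cast
      ring
    rw [h2, ← hc2] at h1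
    have h3 : ‖x t‖ ^ 2 ≤ (c * Real.exp (-a * t) * ‖x 0‖) ^ 2 := by
      refine le_of_mul_le_mul_left (h1.trans_eq ?_) hκ₁
      ring
    exact le_of_sq_le_sq h3 (by positivity)

/-- A linear oscillator that is a quotient of the linearization rules out exponential stability. -/
theorem not_isLocallyExponentiallyStable_of_oscillator {f : E → E} {Ω : Set E} (hf0 : f 0 = 0)
    {F : E →L[ℝ] E} (hF : HasFDerivAt f F 0) (φ₁ φ₂ : E →L[ℝ] ℝ) {c : ℝ} (hc : 0 < c)
    (h₁ : ∀ x, φ₁ (F x) = φ₂ x) (h₂ : ∀ x, φ₂ (F x) = -c * φ₁ x) (hφ : φ₁ ≠ 0) :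
    ¬ IsLocallyExponentiallyStable f Ω := by
  rintro ⟨δ, c₀, a, hδ, hc₀, ha, hex, hdec⟩
  obtain ⟨v, hv⟩ : ∃ x, φ₁ x ≠ 0 := by
    by_contra! hne
    exact hφ (ContinuousLinearMap.ext hne)
  have hv0 : 0 < ‖v‖ := norm_pos_iff.2 (by rintro rfl; simp at hv)
  -- The energy of the oscillator, conserved by the linear flow of `F`.
  let Q : E → ℝ := fun x => c * φ₁ x ^ 2 + φ₂ x ^ 2
  have hβ : 0 < Q v := by positivity
  set K : ℝ := 2 * c * ‖φ₁‖ ^ 2 + 2 * ‖φ₂‖ ^ 2 + 1 with hK_def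
  have hK : 0 < K := by positivity
  have hbil : ∀ x y, |2 * c * φ₁ x * φ₁ y + 2 * φ₂ x * φ₂ y| ≤ K * ‖x‖ * ‖y‖ := by
    intro x y
    have e1 := φ₁.le_opNorm x
    have e2 := φ₁.le_opNorm y
    have e3 := φ₂.le_opNorm x
    have e4 := φ₂.le_opNorm y
    calc |2 * c * φ₁ x * φ₁ y + 2 * φ₂ x * φ₂ y|
        ≤ |2 * c * φ₁ x * φ₁ y| + |2 * φ₂ x * φ₂ y| := abs_add_le _ _
      _ = 2 * c * (‖φ₁ x‖ * ‖φ₁ y‖) + 2 * (‖φ₂ x‖ * ‖φ₂ y‖) := by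
        simp only [abs_mul, Real.norm_eq_abs, abs_two, abs_of_pos hc]; ring
      _ ≤ 2 * c * ((‖φ₁‖ * ‖x‖) * (‖φ₁‖ * ‖y‖)) + 2 * ((‖φ₂‖ * ‖x‖) * (‖φ₂‖ * ‖y‖)) := by
        gcongr
      _ ≤ K * ‖x‖ * ‖y‖ := by
        rw [hK_def]
        nlinarith [mul_nonneg (norm_nonneg x) (norm_nonneg y)]
  have hQle : ∀ x, Q x ≤ K * ‖x‖ ^ 2 := by
    intro x
    have h3 := (le_abs_self _).trans (hbil x x)
    have h4 : 0 ≤ c * φ₁ x ^ 2 + φ₂ x ^ 2 := by positivity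
    simp only [Q]
    nlinarith
  have hlo := hF.isLittleO.def (c := a * Q v / (K * c₀ ^ 2 * ‖v‖ ^ 2)) (by positivity)
  simp only [hf0, sub_zero] at hlo
  -- The remainder changes `Q` at a rate of at most `K η ‖x‖²`. Under the assumed decay the total
  -- change is then at most half of the initial energy; this fixes `η`.
  set η : ℝ := a * Q v / (K * c₀ ^ 2 * ‖v‖ ^ 2) with hη_def
  have hη : 0 < η := by positivity
  obtain ⟨ρ, hρ, hball⟩ := Metric.eventually_nhds_iff_ball.1 hlo
  obtain ⟨ε, hε, hεδ, hερ⟩ : ∃ ε : ℝ, 0 < ε ∧ ε * ‖v‖ < δ ∧ c₀ * (ε * ‖v‖) < ρ := by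
    refine ⟨min (δ / (2 * ‖v‖)) (ρ / (2 * (c₀ * ‖v‖))), by positivity, ?_, ?_⟩
    · have : δ / (2 * ‖v‖) * ‖v‖ = δ / 2 := by field_simp
      nlinarith [mul_le_mul_of_nonneg_right
        (min_le_left (δ / (2 * ‖v‖)) (ρ / (2 * (c₀ * ‖v‖)))) hv0.le]
    · have : ρ / (2 * (c₀ * ‖v‖)) * (c₀ * ‖v‖) = ρ / 2 := by field_simp
      nlinarith [mul_le_mul_of_nonneg_right
        (min_le_right (δ / (2 * ‖v‖)) (ρ / (2 * (c₀ * ‖v‖)))) (mul_pos hc₀ hv0).le]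
  have hnorm : ‖ε • v‖ = ε * ‖v‖ := by rw [norm_smul, Real.norm_of_nonneg hε.le]
  obtain ⟨x, hx, hx0⟩ := hex (ε • v) (by rw [hnorm]; exact hεδ)
  have hxt := hdec x hx (by rw [hx0, hnorm]; exact hεδ)
  rw [hx0, hnorm] at hxt
  have hxρ : ∀ t, 0 ≤ t → ‖f (x t) - F (x t)‖ ≤ η * ‖x t‖ := by
    intro t ht
    refine hball _ (mem_ball_zero_iff.2 ((hxt t ht).trans_lt ?_))
    have h3 : Real.exp (-a * t) ≤ 1 := Real.exp_le_one_iff.2 (by nlinarith)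
    have h4 : 0 ≤ c₀ * (ε * ‖v‖) := by positivity
    nlinarith
  set d : ℝ := ε ^ 2 * Q v / 2 with hd_def
  have hd : 2 * a * d = K * η * (c₀ * (ε * ‖v‖)) ^ 2 := by
    rw [hd_def, hη_def]
    field_simp
  -- The term `d * exp (-2 a t)` absorbs the remainder, so the energy stays above `d`, half its
  -- initial value, which contradicts the decay of `x`.
  have hmono : MonotoneOn (fun t => Q (x t) - d * Real.exp (-(2 * a) * t)) (Ici 0) := by
    have hcx : ContinuousOn x (Ici 0) := fun t ht => (hx t ht).2.continuousWithinAt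
    refine monotoneOn_of_hasDerivWithinAt_nonneg (convex_Ici 0)
      (f' := fun t => (2 * c * φ₁ (x t) * φ₁ (f (x t)) + 2 * φ₂ (x t) * φ₂ (f (x t))) -
        d * (Real.exp (-(2 * a) * t) * (-(2 * a)))) ?_ (fun t ht => ?_) (fun t ht => ?_)
    · have hQ : Continuous Q := by fun_prop
      exact (hQ.comp_continuousOn hcx).sub (by fun_prop)
    · rw [interior_Ici] at ht
      have e0 : HasDerivAt x (f (x t)) t := (hx t (le_of_lt ht)).2.hasDerivAt (Ici_mem_nhds ht)
      have e1 : HasDerivAt (fun t => φ₁ (x t)) (φ₁ (f (x t))) t :=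
        φ₁.hasFDerivAt.comp_hasDerivAt t e0
      have e2 : HasDerivAt (fun t => φ₂ (x t)) (φ₂ (f (x t))) t :=
        φ₂.hasFDerivAt.comp_hasDerivAt t e0
      have e3 : HasDerivAt (fun t => Real.exp (-(2 * a) * t))
          (Real.exp (-(2 * a) * t) * (-(2 * a))) t := by
        simpa using ((hasDerivAt_id t).const_mul (-(2 * a))).exp
      refine HasDerivAt.hasDerivWithinAt ?_
      refine ((((e1.pow 2).const_mul c).add (e2.pow 2)).sub (e3.const_mul d)).congr_deriv ?_
      push_cast
      ring
    · rw [interior_Ici] at ht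
      have ht' : 0 ≤ t := le_of_lt ht
      have e1 : 2 * c * φ₁ (x t) * φ₁ (f (x t)) + 2 * φ₂ (x t) * φ₂ (f (x t)) =
          2 * c * φ₁ (x t) * φ₁ (f (x t) - F (x t)) +
            2 * φ₂ (x t) * φ₂ (f (x t) - F (x t)) := by
        rw [map_sub, map_sub, h₁, h₂]
        ring
      have e2 := (abs_le.1 (hbil (x t) (f (x t) - F (x t)))).1
      have e3 : K * ‖x t‖ * ‖f (x t) - F (x t)‖ ≤
          K * η * (c₀ * Real.exp (-a * t) * (ε * ‖v‖)) ^ 2 := by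
        calc K * ‖x t‖ * ‖f (x t) - F (x t)‖ ≤ K * ‖x t‖ * (η * ‖x t‖) := by
              gcongr
              exact hxρ t ht'
          _ = K * η * ‖x t‖ ^ 2 := by ring
          _ ≤ _ := by
            have := hxt t ht'
            gcongr
      have e4 : Real.exp (-(2 * a) * t) = Real.exp (-a * t) ^ 2 := by
        rw [← Real.exp_nat_mul]
        congr 1
        push_cast
        ring
      have e5 : d * (Real.exp (-(2 * a) * t) * (-(2 * a))) =
          -(K * η * (c₀ * Real.exp (-a * t) * (ε * ‖v‖)) ^ 2) := by
        rw [e4]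
        linear_combination (-(Real.exp (-a * t) ^ 2)) * hd
      rw [e1, e5]
      linarith
  have hlim : Tendsto (fun t => K * (c₀ * Real.exp (-a * t) * (ε * ‖v‖)) ^ 2) atTop (𝓝 0) := by
    have h3 : Tendsto (fun t : ℝ => Real.exp (-a * t)) atTop (𝓝 0) := by
      refine Real.tendsto_exp_atBot.comp ?_
      exact tendsto_id.const_mul_atTop_of_neg (by linarith)
    have h4 := (((h3.const_mul c₀).mul_const (ε * ‖v‖)).pow 2).const_mul K
    simpa using h4
  have hge : ∀ t, 0 ≤ t → d ≤ K * (c₀ * Real.exp (-a * t) * (ε * ‖v‖)) ^ 2 := by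
    intro t ht
    have h3 := hmono (mem_Ici.2 le_rfl) (mem_Ici.2 ht) ht
    simp only [mul_zero, Real.exp_zero, mul_one, hx0] at h3
    have h4 : Q (ε • v) = 2 * d := by
      simp only [Q, map_smul, smul_eq_mul, hd_def]
      ring
    have hdpos : 0 < d := by positivity
    have h5 : 0 < d * Real.exp (-(2 * a) * t) := by positivity
    have h6 : K * ‖x t‖ ^ 2 ≤ K * (c₀ * Real.exp (-a * t) * (ε * ‖v‖)) ^ 2 := by
      have := hxt t ht
      gcongr
    linarith [hQle (x t)]
  have hd0 : d ≤ 0 := ge_of_tendsto hlim ((eventually_ge_atTop 0).mono hge)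
  have : 0 < d := by positivity
  linarith

end Stability

/-! ### Entrywise calculus of matrix-valued functions, gradients and Hessians -/

section SmoothMatrices
open scoped Topology
open Set Filter

variable {E : Type*} [NormedAddCommGroup E] [NormedSpace ℝ E] {l m n : Type*}

/-- Entrywise smoothness of a matrix-valued function at a point. -/
def SmoothMatAt (A : E → Matrix m n ℝ) (x : E) : Prop :=
  ∀ i j, ContDiffAt ℝ ∞ (fun y => A y i j) x

theorem SmoothMatAt.const (A : Matrix m n ℝ) (x : E) : SmoothMatAt (fun _ : E => A) x :=
  fun _ _ => contDiffAt_const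

theorem SmoothMatAt.add {A B : E → Matrix m n ℝ} {x : E} (hA : SmoothMatAt A x)
    (hB : SmoothMatAt B x) : SmoothMatAt (fun y => A y + B y) x :=
  fun i j => (hA i j).add (hB i j)

theorem SmoothMatAt.sub {A B : E → Matrix m n ℝ} {x : E} (hA : SmoothMatAt A x)
    (hB : SmoothMatAt B x) : SmoothMatAt (fun y => A y - B y) x :=
  fun i j => (hA i j).sub (hB i j)

theorem SmoothMatAt.smul {f : E → ℝ} {A : E → Matrix m n ℝ} {x : E} (hf : ContDiffAt ℝ ∞ f x)
    (hA : SmoothMatAt A x) : SmoothMatAt (fun y => f y • A y) x :=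
  fun i j => hf.mul (hA i j)

theorem SmoothMatAt.transpose {A : E → Matrix m n ℝ} {x : E} (hA : SmoothMatAt A x) :
    SmoothMatAt (fun y => (A y)ᵀ) x :=
  fun i j => hA j i

theorem SmoothMatAt.mul [Fintype m] {A : E → Matrix l m ℝ} {B : E → Matrix m n ℝ} {x : E}
    (hA : SmoothMatAt A x) (hB : SmoothMatAt B x) : SmoothMatAt (fun y => A y * B y) x := by
  intro i j
  simp only [Matrix.mul_apply]
  exact ContDiffAt.sum fun k _ => (hA i k).mul (hB k j)

theorem ContDiffAt.dotProduct [Fintype m] {v w : E → m → ℝ} {x : E}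
    (hv : ContDiffAt ℝ ∞ v x) (hw : ContDiffAt ℝ ∞ w x) :
    ContDiffAt ℝ ∞ (fun y => v y ⬝ᵥ w y) x := by
  simp only [_root_.dotProduct]
  exact ContDiffAt.sum fun k _ => (contDiffAt_pi.1 hv k).mul (contDiffAt_pi.1 hw k)

theorem SmoothMatAt.mulVec [Fintype m] [Fintype n] {A : E → Matrix m n ℝ} {w : E → n → ℝ} {x : E}
    (hA : SmoothMatAt A x) (hw : ContDiffAt ℝ ∞ w x) :
    ContDiffAt ℝ ∞ (fun y => A y *ᵥ w y) x := by
  refine contDiffAt_pi.2 fun i => ?_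
  exact ContDiffAt.dotProduct (contDiffAt_pi.2 fun j => hA i j) hw

theorem SmoothMatAt.vecMulVec [Fintype m] [Fintype n] {v : E → m → ℝ} {w : E → n → ℝ} {x : E}
    (hv : ContDiffAt ℝ ∞ v x) (hw : ContDiffAt ℝ ∞ w x) :
    SmoothMatAt (fun y => Matrix.vecMulVec (v y) (w y)) x :=
  fun i j => (contDiffAt_pi.1 hv i).mul (contDiffAt_pi.1 hw j)

theorem SmoothMatAt.det [Fintype n] [DecidableEq n] {A : E → Matrix n n ℝ} {x : E}
    (hA : SmoothMatAt A x) : ContDiffAt ℝ ∞ (fun y => (A y).det) x := by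
  simp only [Matrix.det_apply']
  exact ContDiffAt.sum fun σ _ => contDiffAt_const.mul (contDiffAt_prod fun i _ => hA _ _)

theorem SmoothMatAt.inv [Fintype n] [DecidableEq n] {A : E → Matrix n n ℝ} {x : E}
    (hA : SmoothMatAt A x) (hdet : (A x).det ≠ 0) : SmoothMatAt (fun y => (A y)⁻¹) x := by
  intro i j
  simp only [Matrix.inv_def, Matrix.smul_apply, smul_eq_mul, Ring.inverse_eq_inv',
    Matrix.adjugate_apply]
  refine (hA.det.inv hdet).mul (SmoothMatAt.det fun a b => ?_)
  by_cases h : a = j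
  · subst h
    simp only [Matrix.updateRow_self]
    exact contDiffAt_const
  · simp only [Matrix.updateRow_ne h]
    exact hA a b

theorem SmoothMatAt.comp_fst {F : Type*} [NormedAddCommGroup F] [NormedSpace ℝ F]
    {A : E → Matrix m n ℝ} {x : E × F} (hA : SmoothMatAt A x.1) :
    SmoothMatAt (fun y : E × F => A y.1) x :=
  fun i j => (hA i j).comp x contDiffAt_fst

/-- The derivative of a matrix-valued function in a given direction. -/
def dMat (A : E → Matrix m n ℝ) (x v : E) : Matrix m n ℝ :=
  Matrix.of fun i j => fderiv ℝ (fun y => A y i j) x v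

theorem SmoothMatAt.dMat {A : E → Matrix m n ℝ} {x : E} (hA : SmoothMatAt A x) {v : E → E}
    (hv : ContDiffAt ℝ ∞ v x) : SmoothMatAt (fun y => dMat A y (v y)) x :=
  fun i j => ((hA i j).fderiv_right (m := ∞) (by simp)).clm_apply hv

/-- The vector of partial derivatives. -/
def grad {n : ℕ} (V : (Fin n → ℝ) → ℝ) (q : Fin n → ℝ) : Fin n → ℝ :=
  fun i => fderiv ℝ V q (Pi.single i 1)

theorem dotProduct_grad {n : ℕ} (V : (Fin n → ℝ) → ℝ) (q w : Fin n → ℝ) :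
    w ⬝ᵥ grad V q = fderiv ℝ V q w := by
  conv_rhs => rw [pi_eq_sum_univ' w]
  simp [dotProduct, grad]

theorem ContDiffAt.grad {n : ℕ} {V : (Fin n → ℝ) → ℝ} {q : Fin n → ℝ}
    (hV : ContDiffAt ℝ ∞ V q) : ContDiffAt ℝ ∞ (grad V) q :=
  contDiffAt_pi.2 fun _ => (hV.fderiv_right (m := ∞) (by simp)).clm_apply contDiffAt_const

/-- The Hessian matrix at the origin. -/
def hess {n : ℕ} (V : (Fin n → ℝ) → ℝ) : Matrix (Fin n) (Fin n) ℝ :=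
  Matrix.of fun i j => fderiv ℝ (fderiv ℝ V) 0 (Pi.single i 1) (Pi.single j 1)

theorem dotProduct_hess_mulVec {n : ℕ} (V : (Fin n → ℝ) → ℝ) (v w : Fin n → ℝ) :
    v ⬝ᵥ (hess V *ᵥ w) = fderiv ℝ (fderiv ℝ V) 0 v w := by
  conv_rhs => rw [pi_eq_sum_univ' v, pi_eq_sum_univ' w]
  simp only [dotProduct, Matrix.mulVec, hess, Finset.mul_sum, map_sum, map_smul, smul_eq_mul,
    sum_apply, smul_apply, Matrix.of_apply]
  rw [Finset.sum_comm]
  refine Finset.sum_congr rfl fun i _ => Finset.sum_congr rfl fun j _ => by ring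

theorem fderiv_fderiv_symm {E : Type*} [NormedAddCommGroup E] [NormedSpace ℝ E] {f : E → ℝ}
    {x : E} (hf : ContDiffAt ℝ ∞ f x) (v w : E) :
    fderiv ℝ (fderiv ℝ f) x v w = fderiv ℝ (fderiv ℝ f) x w v :=
  (hf.isSymmSndFDerivAt (by simp; exact WithTop.coe_le_coe.2 le_top)).eq v w

theorem hess_transpose {n : ℕ} {V : (Fin n → ℝ) → ℝ} (hV : ContDiffAt ℝ ∞ V 0) :
    (hess V)ᵀ = hess V := by
  ext i j
  exact fderiv_fderiv_symm hV _ _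

/-- Multiplication by a matrix as a continuous linear map. -/
def mulVecCLM {m n : ℕ} (A : Matrix (Fin m) (Fin n) ℝ) : (Fin n → ℝ) →L[ℝ] (Fin m → ℝ) :=
  LinearMap.toContinuousLinearMap (Matrix.mulVecLin A)

@[simp]
theorem mulVecCLM_apply {m n : ℕ} (A : Matrix (Fin m) (Fin n) ℝ) (v : Fin n → ℝ) :
    mulVecCLM A v = A *ᵥ v := rfl

/-- Pairing with a vector as a continuous linear functional. -/
def dotCLM {n : ℕ} (a : Fin n → ℝ) : (Fin n → ℝ) →L[ℝ] ℝ :=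
  LinearMap.toContinuousLinearMap (dotProductBilin ℝ ℝ a)

@[simp]
theorem dotCLM_apply {n : ℕ} (a v : Fin n → ℝ) : dotCLM a v = a ⬝ᵥ v := rfl

theorem differentiableAt_fderiv {E : Type*} [NormedAddCommGroup E] [NormedSpace ℝ E] {f : E → ℝ}
    {x : E} (hf : ContDiffAt ℝ ∞ f x) : DifferentiableAt ℝ (fderiv ℝ f) x :=
  (hf.fderiv_right (m := ∞) (by simp)).differentiableAt (by simp)

theorem hasFDerivAt_grad {n : ℕ} {V : (Fin n → ℝ) → ℝ} (hV : ContDiffAt ℝ ∞ V 0) :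
    HasFDerivAt (grad V) (mulVecCLM (hess V)) 0 := by
  refine hasFDerivAt_pi'.2 fun i => ?_
  have h := (differentiableAt_fderiv hV).hasFDerivAt.clm_apply
    (hasFDerivAt_const (Pi.single i (1 : ℝ)) (0 : Fin n → ℝ))
  refine h.congr_fderiv ?_
  ext v
  have h1 := dotProduct_hess_mulVec V (Pi.single i 1) v
  rw [fderiv_fderiv_symm hV] at h1
  simpa using h1.symm

/-- A function with values in matrices, continuous at a point, times a vector-valued function
vanishing there. -/
theorem hasFDerivAt_mulVec_of_eq_zero {m n : ℕ} {A : E → Matrix (Fin m) (Fin n) ℝ}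
    {w : E → Fin n → ℝ} {w' : E →L[ℝ] (Fin n → ℝ)} {x : E} (hA : SmoothMatAt A x)
    (hw : HasFDerivAt w w' x) (h0 : w x = 0) :
    HasFDerivAt (fun y => A y *ᵥ w y) ((mulVecCLM (A x)).comp w') x := by
  refine hasFDerivAt_pi'.2 fun i => ?_
  have h1 : HasFDerivAt (fun y => ∑ j, A y i j * w y j)
      (∑ j, (A x i j • ((ContinuousLinearMap.proj j).comp w') +
        w x j • fderiv ℝ (fun y => A y i j) x)) x :=
    HasFDerivAt.fun_sum fun j _ =>
      ((hA i j).differentiableAt (by simp)).hasFDerivAt.mul (hasFDerivAt_pi'.1 hw j)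
  refine h1.congr_fderiv ?_
  ext v
  simp [h0, Matrix.mulVec, dotProduct]

/-- This removes from the linearizations the terms quadratic in the momenta: the kinetic part of the
position gradient and the gyroscopic force. -/
theorem hasFDerivAt_mul_mul_zero {f g h : E → ℝ} {x : E} (hf : DifferentiableAt ℝ f x)
    (hg : DifferentiableAt ℝ g x) (hh : DifferentiableAt ℝ h x) (g0 : g x = 0) (h0 : h x = 0) :
    HasFDerivAt (fun y => f y * g y * h y) (0 : E →L[ℝ] ℝ) x := by
  refine ((hf.hasFDerivAt.mul hg.hasFDerivAt).mul hh.hasFDerivAt).congr_fderiv ?_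
  ext v
  simp [g0, h0]

theorem dotProduct_mulVec_comm {n : ℕ} {A : Matrix (Fin n) (Fin n) ℝ} (hA : Aᵀ = A)
    (v w : Fin n → ℝ) : v ⬝ᵥ (A *ᵥ w) = w ⬝ᵥ (A *ᵥ v) := by
  rw [Matrix.dotProduct_mulVec, ← Matrix.mulVec_transpose, hA, dotProduct_comm]

end SmoothMatrices

/-! ### Gradients and second derivatives of mechanical Hamiltonians -/

section Mechanical
open scoped Topology
open Set Filter

/-- `M` and `V` are smooth on the open neighbourhood `U` of the origin and `M` is positive
definite there. -/
structure IsMechOn {n : ℕ} (M : (Fin n → ℝ) → Matrix (Fin n) (Fin n) ℝ) (V : (Fin n → ℝ) → ℝ)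
    (U : Set (Fin n → ℝ)) : Prop where
  isOpen : IsOpen U
  zero_mem : (0 : Fin n → ℝ) ∈ U
  smooth_M : ∀ q ∈ U, SmoothMatAt M q
  posDef : ∀ q ∈ U, (M q).PosDef
  smooth_V : ∀ q ∈ U, ContDiffAt ℝ ∞ V q

variable {n m : ℕ} {M : (Fin n → ℝ) → Matrix (Fin n) (Fin n) ℝ} {V : (Fin n → ℝ) → ℝ}
  {U : Set (Fin n → ℝ)}

theorem posDef_transpose {A : Matrix (Fin n) (Fin n) ℝ} (hA : A.PosDef) : Aᵀ = A := by
  simpa using hA.isHermitian.eq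

theorem posDef_pos {A : Matrix (Fin n) (Fin n) ℝ} (hA : A.PosDef) {v : Fin n → ℝ} (hv : v ≠ 0) :
    0 < v ⬝ᵥ (A *ᵥ v) := by
  simpa using hA.dotProduct_mulVec_pos hv

theorem posDef_mulVec_inv {A : Matrix (Fin n) (Fin n) ℝ} (hA : A.PosDef) (v : Fin n → ℝ) :
    A *ᵥ (A⁻¹ *ᵥ v) = v := by
  rw [Matrix.mulVec_mulVec, Matrix.mul_nonsing_inv _ (isUnit_iff_ne_zero.2 hA.det_pos.ne'),
    Matrix.one_mulVec]

theorem posDef_inv_mulVec {A : Matrix (Fin n) (Fin n) ℝ} (hA : A.PosDef) (v : Fin n → ℝ) :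
    A⁻¹ *ᵥ (A *ᵥ v) = v := by
  rw [Matrix.mulVec_mulVec, Matrix.nonsing_inv_mul _ (isUnit_iff_ne_zero.2 hA.det_pos.ne'),
    Matrix.one_mulVec]

namespace IsMechOn

theorem smooth_inv (h : IsMechOn M V U) {q : Fin n → ℝ} (hq : q ∈ U) :
    SmoothMatAt (fun q => (M q)⁻¹) q :=
  (h.smooth_M q hq).inv (h.posDef q hq).det_pos.ne'

theorem contDiffAt_mechHamiltonian (h : IsMechOn M V U) {x : Phase n} (hx : x.1 ∈ U) :
    ContDiffAt ℝ ∞ (mechHamiltonian M V) x := by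
  have h1 : ContDiffAt ℝ ∞ (fun x : Phase n => x.2 ⬝ᵥ ((M x.1)⁻¹ *ᵥ x.2)) x :=
    ContDiffAt.dotProduct contDiffAt_snd ((h.smooth_inv hx).comp_fst.mulVec contDiffAt_snd)
  exact (contDiffAt_const.mul h1).add ((h.smooth_V _ hx).comp x contDiffAt_fst)

theorem eventually_mem (h : IsMechOn M V U) {x : Phase n} (hx : x.1 ∈ U) :
    ∀ᶠ y in 𝓝 x, y.1 ∈ U :=
  continuous_fst.continuousAt.eventually (h.isOpen.mem_nhds hx)

theorem gradQ_apply (h : IsMechOn M V U) {x : Phase n} (hx : x.1 ∈ U) (i : Fin n) :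
    gradQ (mechHamiltonian M V) x i =
      fderiv ℝ (mechHamiltonian M V) x (Pi.single i 1, 0) := by
  have h1 := ((h.contDiffAt_mechHamiltonian hx).differentiableAt (by simp)).hasFDerivAt
  have h2 := HasFDerivAt.comp (g := mechHamiltonian M V) (f := fun q => (q, x.2)) x.1 h1
    (hasFDerivAt_prodMk_left x.1 x.2)
  exact congrArg (fun L => L (Pi.single i 1)) h2.fderiv

theorem gradP_apply (h : IsMechOn M V U) {x : Phase n} (hx : x.1 ∈ U) (i : Fin n) :
    gradP (mechHamiltonian M V) x i =
      fderiv ℝ (mechHamiltonian M V) x (0, Pi.single i 1) := by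
  have h1 := ((h.contDiffAt_mechHamiltonian hx).differentiableAt (by simp)).hasFDerivAt
  have h2 := HasFDerivAt.comp (g := mechHamiltonian M V) (f := fun p => (x.1, p)) x.2 h1
    (hasFDerivAt_prodMk_right x.1 x.2)
  exact congrArg (fun L => L (Pi.single i 1)) h2.fderiv

theorem contDiffAt_gradQ (h : IsMechOn M V U) {x : Phase n} (hx : x.1 ∈ U) :
    ContDiffAt ℝ ∞ (gradQ (mechHamiltonian M V)) x := by
  refine contDiffAt_pi.2 fun i => ?_
  have h1 : ContDiffAt ℝ ∞ (fun y => fderiv ℝ (mechHamiltonian M V) y (Pi.single i 1, 0)) x :=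
    ((h.contDiffAt_mechHamiltonian hx).fderiv_right (m := ∞) (by simp)).clm_apply contDiffAt_const
  exact h1.congr_of_eventuallyEq ((h.eventually_mem hx).mono fun y hy => h.gradQ_apply hy i)

theorem gradP_eq (h : IsMechOn M V U) {x : Phase n} (hx : x.1 ∈ U) :
    gradP (mechHamiltonian M V) x = (M x.1)⁻¹ *ᵥ x.2 := by
  funext i
  set N := (M x.1)⁻¹ with hN
  have hNs : Nᵀ = N := by rw [hN, Matrix.transpose_nonsing_inv, posDef_transpose (h.posDef _ hx)]
  have h1 : ∀ j, HasFDerivAt (fun p : Fin n → ℝ => p j)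
      (ContinuousLinearMap.proj j : (Fin n → ℝ) →L[ℝ] ℝ) x.2 :=
    fun j => hasFDerivAt_apply j x.2
  have h2 : HasFDerivAt (fun p : Fin n → ℝ => (N *ᵥ p)) (mulVecCLM N) x.2 :=
    (mulVecCLM N).hasFDerivAt
  have h3 : HasFDerivAt (fun p : Fin n → ℝ => ∑ j, p j * (N *ᵥ p) j)
      (∑ j, (x.2 j • ((ContinuousLinearMap.proj j).comp (mulVecCLM N)) +
        (N *ᵥ x.2) j • (ContinuousLinearMap.proj j : (Fin n → ℝ) →L[ℝ] ℝ))) x.2 :=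
    HasFDerivAt.fun_sum fun j _ => (h1 j).mul (hasFDerivAt_pi'.1 h2 j)
  have h4 : HasFDerivAt (fun p : Fin n → ℝ => mechHamiltonian M V (x.1, p)) _ x.2 :=
    (h3.const_mul (1 / 2)).add_const (V x.1)
  unfold gradP
  rw [h4.fderiv]
  have h5 : x.2 ⬝ᵥ (N *ᵥ Pi.single i 1) = (N *ᵥ x.2) i := by
    rw [dotProduct_mulVec_comm hNs]
    simp
  have h6 : (N *ᵥ x.2) ⬝ᵥ Pi.single i 1 = (N *ᵥ x.2) i := by simp
  have h7 : ((1 / 2 : ℝ) • ∑ j, (x.2 j • ((ContinuousLinearMap.proj j).comp (mulVecCLM N)) +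
        (N *ᵥ x.2) j • (ContinuousLinearMap.proj j : (Fin n → ℝ) →L[ℝ] ℝ))) (Pi.single i 1) =
      (1 / 2) * (x.2 ⬝ᵥ (N *ᵥ Pi.single i 1) + (N *ᵥ x.2) ⬝ᵥ Pi.single i 1) := by
    simp only [dotProduct, ← Finset.sum_add_distrib]
    simp
  rw [h7, h5, h6]
  ring

theorem contDiffAt_gradP (h : IsMechOn M V U) {x : Phase n} (hx : x.1 ∈ U) :
    ContDiffAt ℝ ∞ (gradP (mechHamiltonian M V)) x :=
  ((h.smooth_inv hx).comp_fst.mulVec contDiffAt_snd).congr_of_eventuallyEq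
    ((h.eventually_mem hx).mono fun _ hy => h.gradP_eq hy)

theorem gradQ_eq (h : IsMechOn M V U) {x : Phase n} (hx : x.1 ∈ U) (i : Fin n) :
    gradQ (mechHamiltonian M V) x i =
      (1 / 2) * (x.2 ⬝ᵥ (dMat (fun q => (M q)⁻¹) x.1 (Pi.single i 1) *ᵥ x.2)) +
        grad V x.1 i := by
  have hN := h.smooth_inv hx
  have h1 : HasFDerivAt (fun q : Fin n → ℝ => ∑ j, x.2 j * ∑ k, (M q)⁻¹ j k * x.2 k)
      (∑ j, x.2 j • ∑ k, x.2 k • fderiv ℝ (fun q => (M q)⁻¹ j k) x.1) x.1 :=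
    HasFDerivAt.fun_sum fun j _ => (HasFDerivAt.fun_sum fun k _ =>
      ((hN j k).differentiableAt (by simp)).hasFDerivAt.mul_const (x.2 k)).const_mul (x.2 j)
  have h2 : HasFDerivAt (fun q : Fin n → ℝ => mechHamiltonian M V (q, x.2)) _ x.1 :=
    (h1.const_mul (1 / 2)).add ((h.smooth_V _ hx).differentiableAt (by simp)).hasFDerivAt
  unfold gradQ
  rw [h2.fderiv]
  simp [grad, dMat, dotProduct, Matrix.mulVec, mul_comm]

theorem dotProduct_gradQ (h : IsMechOn M V U) {x : Phase n} (hx : x.1 ∈ U) (w : Fin n → ℝ) :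
    w ⬝ᵥ gradQ (mechHamiltonian M V) x =
      (1 / 2) * (x.2 ⬝ᵥ (dMat (fun q => (M q)⁻¹) x.1 w *ᵥ x.2)) + w ⬝ᵥ grad V x.1 := by
  have h1 : ∀ j k, dMat (fun q => (M q)⁻¹) x.1 w j k =
      ∑ i, w i * dMat (fun q => (M q)⁻¹) x.1 (Pi.single i 1) j k := fun j k =>
    (dotProduct_grad (fun q => (M q)⁻¹ j k) x.1 w).symm
  have h2 : x.2 ⬝ᵥ (dMat (fun q => (M q)⁻¹) x.1 w *ᵥ x.2) =
      ∑ i, w i * (x.2 ⬝ᵥ (dMat (fun q => (M q)⁻¹) x.1 (Pi.single i 1) *ᵥ x.2)) := by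
    simp only [dotProduct, Matrix.mulVec, h1, Finset.mul_sum, Finset.sum_mul]
    rw [Finset.sum_comm' (t' := Finset.univ) (s' := fun _ => Finset.univ) (by simp)]
    conv_lhs =>
      enter [2, j]
      rw [Finset.sum_comm]
    rw [Finset.sum_comm]
    conv_lhs =>
      enter [2, j]
      rw [Finset.sum_comm]
    refine Finset.sum_congr rfl fun i _ => Finset.sum_congr rfl fun j _ =>
      Finset.sum_congr rfl fun k _ => by ring
  rw [h2, Finset.mul_sum]
  simp only [dotProduct, h.gradQ_eq hx]
  rw [← Finset.sum_add_distrib]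
  refine Finset.sum_congr rfl fun i _ => by ring

theorem gradQ_zero (h : IsMechOn M V U) {q : Fin n → ℝ} (hq : q ∈ U) :
    gradQ (mechHamiltonian M V) (q, 0) = grad V q := by
  funext i
  rw [h.gradQ_eq hq]
  simp

theorem hasFDerivAt_gradP (h : IsMechOn M V U) :
    HasFDerivAt (gradP (mechHamiltonian M V))
      ((mulVecCLM (M 0)⁻¹).comp (ContinuousLinearMap.snd ℝ _ _)) (0 : Phase n) := by
  have h1 : HasFDerivAt (fun x : Phase n => (M x.1)⁻¹ *ᵥ x.2)
      ((mulVecCLM (M 0)⁻¹).comp (ContinuousLinearMap.snd ℝ _ _)) (0 : Phase n) :=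
    hasFDerivAt_mulVec_of_eq_zero (x := (0 : Phase n)) (A := fun x : Phase n => (M x.1)⁻¹)
      (SmoothMatAt.comp_fst (x := (0 : Phase n)) (h.smooth_inv h.zero_mem)) hasFDerivAt_snd rfl
  exact h1.congr_of_eventuallyEq ((h.eventually_mem h.zero_mem).mono fun y hy => h.gradP_eq hy)

theorem hasFDerivAt_gradQ (h : IsMechOn M V U) :
    HasFDerivAt (gradQ (mechHamiltonian M V))
      ((mulVecCLM (hess V)).comp (ContinuousLinearMap.fst ℝ _ _)) (0 : Phase n) := by
  refine hasFDerivAt_pi'.2 fun i => ?_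
  have hd : ∀ j k, DifferentiableAt ℝ
      (fun x : Phase n => (1 / 2) * dMat (fun q => (M q)⁻¹) x.1 (Pi.single i 1) j k) 0 :=
    fun j k => (((h.smooth_inv h.zero_mem).dMat contDiffAt_const).comp_fst (x := (0 : Phase n))
      j k).differentiableAt (by simp) |>.const_mul _
  have hp : ∀ j, DifferentiableAt ℝ (fun x : Phase n => x.2 j) 0 := fun j => by fun_prop
  have h1 : HasFDerivAt (fun x : Phase n => ∑ j, ∑ k,
      (1 / 2) * dMat (fun q => (M q)⁻¹) x.1 (Pi.single i 1) j k * x.2 j * x.2 k)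
      (∑ _j : Fin n, ∑ _k : Fin n, (0 : Phase n →L[ℝ] ℝ)) 0 :=
    HasFDerivAt.fun_sum fun j _ => HasFDerivAt.fun_sum fun k _ =>
      hasFDerivAt_mul_mul_zero (hd j k) (hp j) (hp k) rfl rfl
  have h2 : HasFDerivAt (fun x : Phase n => grad V x.1)
      ((mulVecCLM (hess V)).comp (ContinuousLinearMap.fst ℝ _ _)) 0 :=
    HasFDerivAt.comp (0 : Phase n) (g := grad V)
      (hasFDerivAt_grad (h.smooth_V 0 h.zero_mem)) hasFDerivAt_fst
  have h3 := h1.add (hasFDerivAt_pi'.1 h2 i)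
  simp only [Finset.sum_const_zero, zero_add] at h3
  refine h3.congr_of_eventuallyEq ((h.eventually_mem h.zero_mem).mono fun y hy => ?_)
  refine (h.gradQ_eq hy i).trans ?_
  simp only [dotProduct, Matrix.mulVec, Finset.mul_sum, Pi.add_apply]
  congr 1
  refine Finset.sum_congr rfl fun i _ => Finset.sum_congr rfl fun j _ => by ring

theorem fderiv_mechHamiltonian_apply (h : IsMechOn M V U) {x : Phase n} (hx : x.1 ∈ U)
    (y : Phase n) : fderiv ℝ (mechHamiltonian M V) x y =
      y.1 ⬝ᵥ gradQ (mechHamiltonian M V) x + y.2 ⬝ᵥ gradP (mechHamiltonian M V) x := by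
  have h1 : y = ∑ i, y.1 i • ((Pi.single i 1, 0) : Phase n) +
      ∑ i, y.2 i • ((0, Pi.single i 1) : Phase n) := by
    refine Prod.ext ?_ ?_
    · simp [Prod.fst_sum, ← pi_eq_sum_univ']
    · simp [Prod.snd_sum, ← pi_eq_sum_univ']
  conv_lhs => rw [h1]
  simp only [map_add, map_sum, map_smul, smul_eq_mul, dotProduct, h.gradQ_apply hx,
    h.gradP_apply hx]

theorem fderiv_fderiv_mechHamiltonian (h : IsMechOn M V U) (x y : Phase n) :
    fderiv ℝ (fderiv ℝ (mechHamiltonian M V)) 0 x y =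
      y.1 ⬝ᵥ (hess V *ᵥ x.1) + y.2 ⬝ᵥ ((M 0)⁻¹ *ᵥ x.2) := by
  have h0 : (0 : Phase n).1 ∈ U := h.zero_mem
  have h1 := (differentiableAt_fderiv (h.contDiffAt_mechHamiltonian h0)).hasFDerivAt.clm_apply
    (hasFDerivAt_const y (0 : Phase n))
  have h2 : HasFDerivAt (fun z => y.1 ⬝ᵥ gradQ (mechHamiltonian M V) z +
      y.2 ⬝ᵥ gradP (mechHamiltonian M V) z) _ (0 : Phase n) :=
    ((dotCLM y.1).hasFDerivAt.comp (0 : Phase n) h.hasFDerivAt_gradQ).add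
      ((dotCLM y.2).hasFDerivAt.comp (0 : Phase n) h.hasFDerivAt_gradP)
  have h3 := h2.congr_of_eventuallyEq ((h.eventually_mem h0).mono fun z hz =>
    h.fderiv_mechHamiltonian_apply hz y)
  have h4 := congrArg (fun L => L x) (h1.unique h3)
  simpa using h4

/-- The potential of a Hamiltonian with a nondegenerate local minimum at the origin. -/
theorem hess_pos (h : IsMechOn M V U)
    (hmin : HasNondegenerateLocalMin (mechHamiltonian M V) (0 : Phase n)) :
    fderiv ℝ V 0 = 0 ∧ ∀ v, v ≠ 0 → 0 < v ⬝ᵥ (hess V *ᵥ v) := by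
  have h0 : (0 : Phase n).1 ∈ U := h.zero_mem
  have hs := h.contDiffAt_mechHamiltonian h0
  have hd : ∀ᶠ x in 𝓝 (0 : Phase n), DifferentiableAt ℝ (mechHamiltonian M V) x :=
    (h.eventually_mem h0).mono fun x hx =>
      (h.contDiffAt_mechHamiltonian hx).differentiableAt (by simp)
  have hnn := snd_deriv_nonneg_of_isLocalMin hd (differentiableAt_fderiv hs).hasFDerivAt hmin.1
  refine ⟨?_, fun v hv => ?_⟩
  · ext v
    have h1 := h.fderiv_mechHamiltonian_apply h0 (v, 0)
    rw [hmin.1.fderiv_eq_zero] at h1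
    have h2 : gradQ (mechHamiltonian M V) (0 : Phase n) = grad V 0 := h.gradQ_zero h.zero_mem
    rw [← dotProduct_grad, ← h2]
    simpa using h1.symm
  · have hq : ∀ w, 0 ≤ w ⬝ᵥ (hess V *ᵥ w) := fun w => by
      have := hnn (w, 0)
      rw [h.fderiv_fderiv_mechHamiltonian] at this
      simpa using this
    refine lt_of_le_of_ne (hq v) fun heq => hv ?_
    have hsym := hess_transpose (h.smooth_V 0 h.zero_mem)
    -- A null vector of a nonnegative form lies in its kernel, and nondegeneracy excludes this for
    -- `v ≠ 0`.
    have hz : ∀ w, w ⬝ᵥ (hess V *ᵥ v) = 0 := by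
      intro w
      by_contra hne
      set b := w ⬝ᵥ (hess V *ᵥ v) with hb
      set c := w ⬝ᵥ (hess V *ᵥ w) with hc
      have h1 : ∀ t : ℝ, 0 ≤ 2 * t * b + t ^ 2 * c := by
        intro t
        have h2 := hq (v + t • w)
        simp only [Matrix.mulVec_add, Matrix.mulVec_smul, dotProduct_add, add_dotProduct,
          dotProduct_smul, smul_dotProduct, smul_eq_mul] at h2
        rw [dotProduct_mulVec_comm hsym v w, ← heq, ← hb, ← hc] at h2
        linarith
      have hc0 : 0 ≤ c := hq w
      -- Near the minimizer `-b / c` of the quadratic polynomial; the `+ 1` covers `c = 0`.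
      have h2 := h1 (-b / (c + 1))
      have h3 : 2 * (-b / (c + 1)) * b + (-b / (c + 1)) ^ 2 * c =
          -(b ^ 2 * (c + 2)) / (c + 1) ^ 2 := by
        field_simp
        ring
      rw [h3] at h2
      have h4 : 0 < b ^ 2 * (c + 2) / (c + 1) ^ 2 := by positivity
      rw [neg_div] at h2
      linarith
    have h2 := hmin.2 (v, 0) fun w => by
      rw [h.fderiv_fderiv_mechHamiltonian]
      simp [hz]
    exact congrArg Prod.fst h2

/-- The second derivative at the origin is block diagonal with blocks Hess V and M(0)⁻¹, so
definiteness of the first block suffices. -/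
theorem hasNondegenerateLocalMin (h : IsMechOn M V U) (hV : fderiv ℝ V 0 = 0)
    (hpos : ∀ v, v ≠ 0 → 0 < v ⬝ᵥ (hess V *ᵥ v)) :
    HasNondegenerateLocalMin (mechHamiltonian M V) (0 : Phase n) := by
  have h0 : (0 : Phase n).1 ∈ U := h.zero_mem
  have hs := h.contDiffAt_mechHamiltonian h0
  have hd : ∀ᶠ x in 𝓝 (0 : Phase n), DifferentiableAt ℝ (mechHamiltonian M V) x :=
    (h.eventually_mem h0).mono fun x hx =>
      (h.contDiffAt_mechHamiltonian hx).differentiableAt (by simp)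
  have hN := (h.posDef 0 h.zero_mem).inv
  have hpos' : ∀ x : Phase n, x ≠ 0 → 0 < fderiv ℝ (fderiv ℝ (mechHamiltonian M V)) 0 x x := by
    intro x hx
    rw [h.fderiv_fderiv_mechHamiltonian]
    by_cases h1 : x.1 = 0
    · have h2 : x.2 ≠ 0 := fun h2 => hx (Prod.ext h1 h2)
      simpa [h1] using posDef_pos hN h2
    · have h2 : 0 ≤ x.2 ⬝ᵥ ((M 0)⁻¹ *ᵥ x.2) := by
        simpa using hN.posSemidef.dotProduct_mulVec_nonneg x.2
      linarith [hpos _ h1]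
  obtain ⟨κ, hκ, hco⟩ := exists_coercive
    (Q := fun x => fderiv ℝ (fderiv ℝ (mechHamiltonian M V)) 0 x x) (by fun_prop)
    (fun t x => by simp; ring) hpos'
  refine ⟨isLocalMin_of_coercive_snd_deriv hd ?_ (differentiableAt_fderiv hs).hasFDerivAt hκ hco,
    fun v hv => ?_⟩
  · refine ContinuousLinearMap.ext fun y => ?_
    rw [h.fderiv_mechHamiltonian_apply h0, h.gradP_eq h0, show (0 : Phase n) = (0, 0) from rfl,
      h.gradQ_zero h.zero_mem, dotProduct_grad, hV]
    simp
  · by_contra hne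
    exact (hpos' v hne).ne' (hv v)

end IsMechOn

end Mechanical

/-! ### The linearization: controllable or a free oscillator equation -/

section LinearizedSystem
open scoped Topology
open Set Filter

/-- The left kernel of an `(m + 1) × m` matrix of rank `m` is a line. -/
theorem exists_eq_smul_of_rank {m : ℕ} {G : Matrix (Fin (m + 1)) (Fin m) ℝ} (hG : G.rank = m)
    {g : Fin (m + 1) → ℝ} (hg : g ≠ 0) (hGg : Gᵀ *ᵥ g = 0) {w : Fin (m + 1) → ℝ}
    (hw : Gᵀ *ᵥ w = 0) : ∃ t : ℝ, w = t • g := by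
  have h1 := LinearMap.finrank_range_add_finrank_ker (Matrix.mulVecLin Gᵀ)
  have h2 : Module.finrank ℝ (LinearMap.range (Matrix.mulVecLin Gᵀ)) = m := by
    have := Matrix.rank_transpose G
    rw [hG] at this
    exact this
  rw [h2, Module.finrank_fin_fun] at h1
  have h3 : Module.finrank ℝ (LinearMap.ker (Matrix.mulVecLin Gᵀ)) = 1 := by omega
  obtain ⟨t, ht⟩ := (finrank_eq_one_iff_of_nonzero'
    (⟨g, hGg⟩ : LinearMap.ker (Matrix.mulVecLin Gᵀ)) (fun h => hg (congrArg Subtype.val h))).1 h3 ⟨w, hw⟩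
  exact ⟨t, (congrArg Subtype.val ht).symm⟩

theorem exists_transpose_mulVec_eq_zero {m : ℕ} (G : Matrix (Fin (m + 1)) (Fin m) ℝ) :
    ∃ g : Fin (m + 1) → ℝ, g ≠ 0 ∧ Gᵀ *ᵥ g = 0 := by
  have h1 : LinearMap.ker (Matrix.mulVecLin Gᵀ) ≠ ⊥ :=
    LinearMap.ker_ne_bot_of_finrank_lt (by simp)
  obtain ⟨g, hg, hg0⟩ := Submodule.exists_mem_ne_zero_of_ne_bot h1
  exact ⟨g, hg0, hg⟩

theorem mulVec_dotProduct_eq {m n : ℕ} (A : Matrix (Fin m) (Fin n) ℝ) (v : Fin n → ℝ)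
    (w : Fin m → ℝ) : w ⬝ᵥ (A *ᵥ v) = (Aᵀ *ᵥ w) ⬝ᵥ v := by
  rw [Matrix.dotProduct_mulVec, Matrix.mulVec_transpose]

theorem exists_dotProduct_repr {n : ℕ} (φ : Phase n →L[ℝ] ℝ) :
    ∃ a b : Fin n → ℝ, ∀ x, φ x = a ⬝ᵥ x.1 + b ⬝ᵥ x.2 := by
  refine ⟨fun i => φ (Pi.single i 1, 0), fun i => φ (0, Pi.single i 1), fun y => ?_⟩
  have h1 : y = ∑ i, y.1 i • ((Pi.single i 1, 0) : Phase n) +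
      ∑ i, y.2 i • ((0, Pi.single i 1) : Phase n) := by
    refine Prod.ext ?_ ?_
    · simp [Prod.fst_sum, ← pi_eq_sum_univ']
    · simp [Prod.snd_sum, ← pi_eq_sum_univ']
  conv_lhs => rw [h1]
  simp only [map_add, map_sum, map_smul, smul_eq_mul, dotProduct, mul_comm]

namespace ControlledHamiltonian

variable {n m : ℕ}

theorem isMechOn (S : ControlledHamiltonian n m) : IsMechOn S.M S.V univ where
  isOpen := isOpen_univ
  zero_mem := mem_univ _
  smooth_M := fun _ _ i j => (S.smooth_M i j).contDiffAt
  posDef := fun q _ => S.posDef_M q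
  smooth_V := fun _ _ => S.smooth_V.contDiffAt

theorem smoothMatAt_G (S : ControlledHamiltonian n m) (q : Fin n → ℝ) : SmoothMatAt S.G q :=
  fun i j => (S.smooth_G i j).contDiffAt

theorem mulVec_injective_G (S : ControlledHamiltonian n m) (q : Fin n → ℝ) :
    Function.Injective (S.G q).mulVec := by
  rw [Matrix.mulVec_injective_iff, linearIndependent_iff_card_eq_finrank_span,
    Set.finrank, ← Matrix.rank_eq_finrank_span_cols, S.rank_G, Fintype.card_fin]

theorem hasFDerivAt_field (S : ControlledHamiltonian n m) :
    ∃ A : Phase n →L[ℝ] Phase n, HasFDerivAt (fun x => S.field x 0) A 0 ∧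
      ∀ x, A x = ((S.M 0)⁻¹ *ᵥ x.2, -(hess S.V *ᵥ x.1)) := by
  refine ⟨_, HasFDerivAt.prodMk S.isMechOn.hasFDerivAt_gradP
    (S.isMechOn.hasFDerivAt_gradQ.neg.add_const (0 : Fin n → ℝ)) |>.congr_of_eventuallyEq
      (Eventually.of_forall fun x => ?_), fun x => rfl⟩
  simp [field, H]

theorem linA_apply (S : ControlledHamiltonian n m) (x : Phase n) :
    S.linA x = ((S.M 0)⁻¹ *ᵥ x.2, -(hess S.V *ᵥ x.1)) := by
  obtain ⟨A, hA, hx⟩ := S.hasFDerivAt_field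
  rw [linA, hA.fderiv, hx]

theorem linB_apply (S : ControlledHamiltonian n m) (u : Fin m → ℝ) :
    S.linB u = (0, S.G 0 *ᵥ u) := by
  have h1 : HasFDerivAt (fun u => S.field 0 u)
      ((0 : (Fin m → ℝ) →L[ℝ] (Fin n → ℝ)).prod (mulVecCLM (S.G 0))) 0 :=
    (hasFDerivAt_const _ _).prodMk
      ((mulVecCLM (S.G 0)).hasFDerivAt.const_add (-gradQ S.H 0))
  rw [linB, h1.fderiv]
  rfl

/-- Since `u` vanishes at the origin, the derivative of `G` does not contribute. -/
theorem hasFDerivAt_field_feedback (S : ControlledHamiltonian n m) {u : Phase n → Fin m → ℝ}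
    {K : Phase n →L[ℝ] (Fin m → ℝ)} (hu : HasFDerivAt u K 0) (hu0 : u 0 = 0) :
    HasFDerivAt (fun x => S.field x (u x)) (S.linA + S.linB.comp K) 0 := by
  obtain ⟨A, hA, hx⟩ := S.hasFDerivAt_field
  have h1 : HasFDerivAt (fun x : Phase n => S.G x.1 *ᵥ u x) ((mulVecCLM (S.G 0)).comp K) 0 :=
    hasFDerivAt_mulVec_of_eq_zero (x := (0 : Phase n)) (A := fun x : Phase n => S.G x.1)
      (SmoothMatAt.comp_fst (x := (0 : Phase n)) (S.smoothMatAt_G 0)) hu hu0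
  have h2 := hA.add ((hasFDerivAt_const (0 : Fin n → ℝ) (0 : Phase n)).prodMk h1)
  refine (h2.congr_fderiv ?_).congr_of_eventuallyEq (Eventually.of_forall fun x => ?_)
  · refine ContinuousLinearMap.ext fun x => ?_
    rw [add_apply, add_apply, hx, ← S.linA_apply, ContinuousLinearMap.comp_apply, S.linB_apply]
    rfl
  · simp [field]

theorem grad_eq_zero (S : ControlledHamiltonian n m) (hEq : S.field 0 0 = 0) :
    grad S.V 0 = 0 := by
  have h1 := congrArg Prod.snd hEq
  have h2 : gradQ S.H (0 : Phase n) = grad S.V 0 := S.isMechOn.gradQ_zero (mem_univ 0)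
  simpa [field, h2] using h1

theorem hess_transpose (S : ControlledHamiltonian n m) : (hess S.V)ᵀ = hess S.V :=
  IDAPBC.hess_transpose S.smooth_V.contDiffAt

section Underactuated

variable (S : ControlledHamiltonian (m + 1) m) {g : Fin (m + 1) → ℝ}

/-- The position coordinate in the unactuated direction. -/
def unactuatedQ (g : Fin (m + 1) → ℝ) : Phase (m + 1) →L[ℝ] ℝ :=
  (dotCLM (S.M 0 *ᵥ g)).comp (ContinuousLinearMap.fst ℝ _ _)

/-- The rate of `unactuatedQ` along the linearization. -/
def unactuatedP (g : Fin (m + 1) → ℝ) : Phase (m + 1) →L[ℝ] ℝ :=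
  (dotCLM g).comp (ContinuousLinearMap.snd ℝ _ _)

@[simp]
theorem unactuatedQ_apply (x : Phase (m + 1)) :
    S.unactuatedQ g x = (S.M 0 *ᵥ g) ⬝ᵥ x.1 := rfl

@[simp]
theorem unactuatedP_apply (x : Phase (m + 1)) :
    unactuatedP g x = g ⬝ᵥ x.2 := rfl

theorem dotProduct_inv_mulVec (v w : Fin (m + 1) → ℝ) :
    (S.M 0 *ᵥ v) ⬝ᵥ ((S.M 0)⁻¹ *ᵥ w) = v ⬝ᵥ w := by
  rw [dotProduct_comm, dotProduct_mulVec_comm (posDef_transpose (S.posDef_M 0)),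
    posDef_mulVec_inv (S.posDef_M 0)]

theorem unactuatedQ_linA (x : Phase (m + 1)) :
    S.unactuatedQ g (S.linA x) = unactuatedP g x := by
  rw [S.linA_apply, unactuatedQ_apply, unactuatedP_apply, S.dotProduct_inv_mulVec]

theorem unactuatedP_linA (x : Phase (m + 1)) :
    unactuatedP g (S.linA x) = -((hess S.V *ᵥ g) ⬝ᵥ x.1) := by
  rw [S.linA_apply, unactuatedP_apply, dotProduct_neg, mulVec_dotProduct_eq, S.hess_transpose]

theorem unactuatedQ_linB (u : Fin m → ℝ) : S.unactuatedQ g (S.linB u) = 0 := by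
  simp [S.linB_apply]

theorem unactuatedP_linB (hg : (S.G 0)ᵀ *ᵥ g = 0) (u : Fin m → ℝ) :
    unactuatedP g (S.linB u) = 0 := by
  rw [S.linB_apply, unactuatedP_apply, mulVec_dotProduct_eq, hg, zero_dotProduct]

theorem unactuatedQ_ne_zero (hg0 : g ≠ 0) : S.unactuatedQ g ≠ 0 := by
  intro h
  have h1 := congrArg (fun L => L ((g, 0) : Phase (m + 1))) h
  simp only [unactuatedQ_apply, zero_apply] at h1
  rw [dotProduct_comm] at h1
  exact (posDef_pos (S.posDef_M 0) hg0).ne' h1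

/-- Functionals annihilating the controllable subspace are combinations of the unactuated
coordinate and its rate. -/
theorem exists_unactuated_repr (hg0 : g ≠ 0) (hg : (S.G 0)ᵀ *ᵥ g = 0)
    {φ : Phase (m + 1) →L[ℝ] ℝ} (h : ∀ (k : ℕ) w, φ ((S.linA ^ k) (S.linB w)) = 0) :
    ∃ α β : ℝ, ∀ x, φ x = α * S.unactuatedQ g x + β * unactuatedP g x := by
  obtain ⟨a, b, hab⟩ := exists_dotProduct_repr φ
  have hker : ∀ b : Fin (m + 1) → ℝ, (∀ w, b ⬝ᵥ (S.G 0 *ᵥ w) = 0) → ∃ t : ℝ, b = t • g := by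
    intro b hb
    refine exists_eq_smul_of_rank (S.rank_G 0) hg0 hg (dotProduct_eq_zero _ fun w => ?_)
    rw [← mulVec_dotProduct_eq, hb]
  -- The images of `B` and `AB` already suffice: `k = 0` determines the momentum part, `k = 1` the
  -- position part.
  obtain ⟨β, hβ⟩ := hker b fun w => by
    have h1 := h 0 w
    rw [pow_zero, one_apply_eq_self, S.linB_apply, hab] at h1
    simpa using h1
  obtain ⟨α, hα⟩ := hker ((S.M 0)⁻¹ *ᵥ a) fun w => by
    have h1 := h 1 w
    rw [pow_one, S.linB_apply, S.linA_apply, hab] at h1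
    simp only [Matrix.mulVec_zero, neg_zero, dotProduct_zero, add_zero] at h1
    rw [mulVec_dotProduct_eq, Matrix.transpose_nonsing_inv,
      posDef_transpose (S.posDef_M 0)] at h1
    exact h1
  have hα' : a = α • (S.M 0 *ᵥ g) := by
    rw [← Matrix.mulVec_smul, ← hα, posDef_mulVec_inv (S.posDef_M 0)]
  refine ⟨α, β, fun x => ?_⟩
  rw [hab, hα', hβ]
  simp

/-- The annihilator of the controllable subspace is stable under composition with A. A component β
along ẏ would put -β (Hess V g)·q in the span of y, making Hess V g parallel to Mg. So only αy
remains; its composition with A is αẏ, whence α = 0. -/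
theorem isControllable_of_not_parallel (hg0 : g ≠ 0) (hg : (S.G 0)ᵀ *ᵥ g = 0)
    (hpar : ∀ c : ℝ, hess S.V *ᵥ g ≠ c • (S.M 0 *ᵥ g)) : IsControllable S.linA S.linB := by
  refine isControllable_of_dual _ _ fun φ hφ => ?_
  have hstep : ∀ ψ : Phase (m + 1) →L[ℝ] ℝ, (∀ (k : ℕ) w, ψ ((S.linA ^ k) (S.linB w)) = 0) →
      ∀ (k : ℕ) w, (ψ.comp S.linA) ((S.linA ^ k) (S.linB w)) = 0 := by
    intro ψ hψ k w
    have := hψ (k + 1) w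
    rwa [pow_succ'] at this
  have key : ∀ ψ : Phase (m + 1) →L[ℝ] ℝ, (∀ (k : ℕ) w, ψ ((S.linA ^ k) (S.linB w)) = 0) →
      ∃ α : ℝ, ∀ x, ψ x = α * S.unactuatedQ g x := by
    intro ψ hψ
    obtain ⟨α, β, hab⟩ := S.exists_unactuated_repr hg0 hg hψ
    obtain ⟨α', β', hab'⟩ := S.exists_unactuated_repr hg0 hg (hstep ψ hψ)
    have hβ : β = 0 := by
      by_contra hβ
      refine hpar (-α' / β) ?_
      have h1 : ∀ v, (β • (hess S.V *ᵥ g) + α' • (S.M 0 *ᵥ g)) ⬝ᵥ v = 0 := by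
        intro v
        have h2 := hab' (v, 0)
        rw [ContinuousLinearMap.comp_apply, hab, unactuatedQ_linA, unactuatedP_linA] at h2
        simp only [unactuatedQ_apply, unactuatedP_apply, dotProduct_zero, mul_zero, zero_add,
          add_zero] at h2
        rw [add_dotProduct, smul_dotProduct, smul_dotProduct, smul_eq_mul, smul_eq_mul]
        linarith
      have h2 := dotProduct_eq_zero _ h1
      have h3 : β • (hess S.V *ᵥ g) = -α' • (S.M 0 *ᵥ g) := by
        rw [neg_smul]
        exact eq_neg_of_add_eq_zero_left h2
      rw [div_eq_inv_mul, mul_smul, ← h3, smul_smul, inv_mul_cancel₀ hβ, one_smul]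
    exact ⟨α, fun x => by rw [hab, hβ]; ring⟩
  obtain ⟨α, hα⟩ := key φ hφ
  obtain ⟨α', hα'⟩ := key _ (hstep φ hφ)
  have h1 := hα' (0, g)
  rw [ContinuousLinearMap.comp_apply, hα, unactuatedQ_linA] at h1
  simp only [unactuatedQ_apply, unactuatedP_apply, dotProduct_zero, mul_zero] at h1
  have h2 : α = 0 := (mul_eq_zero.1 h1).resolve_right fun h => hg0 (dotProduct_self_eq_zero.1 h)
  refine ContinuousLinearMap.ext fun x => ?_
  rw [hα, h2]
  simp

theorem unactuatedP_linA_of_parallel {c : ℝ} (hpar : hess S.V *ᵥ g = c • (S.M 0 *ᵥ g))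
    (x : Phase (m + 1)) : unactuatedP g (S.linA x) = -c * S.unactuatedQ g x := by
  rw [unactuatedP_linA, hpar, smul_dotProduct, unactuatedQ_apply, smul_eq_mul]
  ring

/-- The pair (y, ẏ) evolves autonomously, untouched by the input, whatever the sign of `c`. -/
theorem not_isControllable_of_parallel (hg0 : g ≠ 0) (hg : (S.G 0)ᵀ *ᵥ g = 0) {c : ℝ}
    (hpar : hess S.V *ᵥ g = c • (S.M 0 *ᵥ g)) : ¬ IsControllable S.linA S.linB := by
  refine not_isControllable_of_intertwines ((S.unactuatedQ g).prod (unactuatedP g))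
    ((ContinuousLinearMap.snd ℝ ℝ ℝ).prod (-c • ContinuousLinearMap.fst ℝ ℝ ℝ)) (fun x => ?_)
    (fun w => ?_) fun h => ?_
  · refine Prod.ext ?_ ?_
    · exact S.unactuatedQ_linA x
    · exact S.unactuatedP_linA_of_parallel hpar x
  · exact Prod.ext (S.unactuatedQ_linB w) (S.unactuatedP_linB hg w)
  · refine S.unactuatedQ_ne_zero hg0 (ContinuousLinearMap.ext fun x => ?_)
    exact congrArg (fun L => (L x).1) h

theorem isOscillatory_of_parallel (hg0 : g ≠ 0) (hg : (S.G 0)ᵀ *ᵥ g = 0) {c : ℝ} (hc : 0 < c)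
    (hpar : hess S.V *ᵥ g = c • (S.M 0 *ᵥ g)) :
    IsOscillatory (uncontrollablePart S.linA S.linB) := by
  refine isOscillatory_of_sq hc (uncontrollablePart_sq_eq fun φ hφ x => ?_)
  obtain ⟨α, β, hab⟩ := S.exists_unactuated_repr hg0 hg hφ
  rw [hab, hab, unactuatedQ_linA, S.unactuatedP_linA_of_parallel hpar,
    S.unactuatedP_linA_of_parallel hpar, unactuatedQ_linA]
  ring

/-- With s = √(-c), the functional s y + ẏ is a left eigenvector of A with the real eigenvalue s. It
annihilates the controllable subspace, so it descends to the quotient. This includes c = 0. -/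
theorem not_isOscillatory_of_parallel (hg0 : g ≠ 0) (hg : (S.G 0)ᵀ *ᵥ g = 0) {c : ℝ} (hc : c ≤ 0)
    (hpar : hess S.V *ᵥ g = c • (S.M 0 *ᵥ g)) :
    ¬ IsOscillatory (uncontrollablePart S.linA S.linB) := by
  intro hosc
  let s := √(-c)
  have hs : s * s = -c := Real.mul_self_sqrt (by linarith)
  let ψ : Phase (m + 1) →L[ℝ] ℝ := s • S.unactuatedQ g + unactuatedP g
  have hψ : ∀ x, ψ (S.linA x) = s * ψ x := by
    intro x
    simp only [ψ, add_apply, smul_apply, smul_eq_mul, unactuatedQ_linA,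
      S.unactuatedP_linA_of_parallel hpar, ← hs]
    ring
  have hψB : ∀ w, ψ (S.linB w) = 0 := by
    intro w
    simp only [ψ, add_apply, smul_apply, unactuatedQ_linB, S.unactuatedP_linB hg, smul_zero,
      add_zero]
  have hann : ∀ (k : ℕ) w, ψ ((S.linA ^ k) (S.linB w)) = 0 := by
    intro k w
    induction k with
    | zero => exact hψB w
    | succ k ih =>
      have h1 : (S.linA ^ (k + 1)) (S.linB w) = S.linA ((S.linA ^ k) (S.linB w)) := by
        rw [pow_succ']; rfl
      rw [h1, hψ, ih, mul_zero]
  let ψq : (Phase (m + 1) ⧸ controllableSubspace S.linA S.linB) →ₗ[ℝ] ℝ :=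
    Submodule.liftQ _ ψ.toLinearMap fun x hx =>
      apply_eq_zero_of_mem_controllableSubspace ψ.toLinearMap hann hx
  have h0 : ψq = 0 := by
    refine hosc.eq_zero_of_comp_eq_smul (μ := s) fun y => ?_
    obtain ⟨x, rfl⟩ := Submodule.mkQ_surjective _ y
    exact hψ x
  have h1 : ψ (0, g) = 0 := congrArg (fun L => L (Submodule.Quotient.mk ((0, g) : Phase (m + 1)))) h0
  simp only [ψ, add_apply, smul_apply, unactuatedQ_apply, unactuatedP_apply, dotProduct_zero,
    smul_zero, zero_add] at h1
  exact hg0 (dotProduct_self_eq_zero.1 h1)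

end Underactuated

end ControlledHamiltonian

end LinearizedSystem

/-! ### Closed-loop linearization, necessity and exponential stability -/

section ClosedLoop
open scoped Topology
open Set Filter

namespace IsTransformedBy

variable {n m : ℕ}

section General

variable {S : ControlledHamiltonian n m} {D : Design n m}

theorem isMechOn (h : IsTransformedBy S D) : IsMechOn D.Mhat D.Vhat D.U where
  isOpen := h.isOpen_U
  zero_mem := h.zero_mem_U
  smooth_M := fun _ hq i j => (h.smooth_Mhat i j).contDiffAt (h.isOpen_U.mem_nhds hq)
  posDef := h.posDef_Mhat
  smooth_V := fun _ hq => h.smooth_Vhat.contDiffAt (h.isOpen_U.mem_nhds hq)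

theorem isOpen_domain (h : IsTransformedBy S D) : IsOpen D.domain :=
  h.isOpen_U.prod isOpen_univ

theorem zero_mem_domain (h : IsTransformedBy S D) : (0 : Phase n) ∈ D.domain :=
  ⟨h.zero_mem_U, mem_univ _⟩

/-- By matching this is the original field under a smooth feedback, so no term of the desired form
has to be examined. -/
theorem contDiffOn_desiredField (h : IsTransformedBy S D) :
    ContDiffOn ℝ ∞ (D.desiredField S) D.domain := by
  have h1 : ContDiffOn ℝ ∞ (fun x => S.field x (D.u x)) D.domain := by
    intro x hx
    have hu := h.smooth_u.contDiffAt (h.isOpen_domain.mem_nhds hx)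
    have hQ : ContDiffAt ℝ ∞ (gradQ S.H) x := S.isMechOn.contDiffAt_gradQ (mem_univ x.1)
    have hP : ContDiffAt ℝ ∞ (gradP S.H) x := S.isMechOn.contDiffAt_gradP (mem_univ x.1)
    exact (hP.prodMk (hQ.neg.add
      ((S.smoothMatAt_G x.1).comp_fst.mulVec hu))).contDiffWithinAt
  exact h1.congr fun x hx => (h.matching x hx).symm

theorem gradQ_Hhat_zero (h : IsTransformedBy S D) : gradQ D.Hhat 0 = 0 := by
  have h1 : gradQ D.Hhat (0 : Phase n) = grad D.Vhat 0 := h.isMechOn.gradQ_zero h.zero_mem_U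
  rw [h1]
  funext i
  simp [grad, (h.isMechOn.hess_pos h.nondegenerate_min).1]

theorem gradP_Hhat_zero (h : IsTransformedBy S D) : gradP D.Hhat 0 = 0 := by
  have h1 := h.isMechOn.gradP_eq (x := 0) h.zero_mem_U
  rw [Design.Hhat, h1]
  simp

theorem desiredField_zero (h : IsTransformedBy S D) : D.desiredField S 0 = 0 := by
  simp only [Design.desiredField, h.gradQ_Hhat_zero, h.gradP_Hhat_zero, Matrix.mulVec_zero]
  refine Prod.ext rfl (funext fun k => ?_)
  simp [contract]

/-- The linearization of the closed loop, read off from the desired form. -/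
theorem hasFDerivAt_desiredField (h : IsTransformedBy S D) :
    ∃ F : Phase n →L[ℝ] Phase n, HasFDerivAt (D.desiredField S) F 0 ∧
      ∀ x, F x = ((S.M 0)⁻¹ *ᵥ x.2,
        -(D.Mhat 0 *ᵥ ((S.M 0)⁻¹ *ᵥ (hess D.Vhat *ᵥ x.1))) -
          S.G 0 *ᵥ (D.Kv 0 *ᵥ ((S.G 0)ᵀ *ᵥ ((D.Mhat 0)⁻¹ *ᵥ x.2)))) := by
  have hM := h.isMechOn.smooth_M 0 h.zero_mem_U
  have hMi := h.isMechOn.smooth_inv h.zero_mem_U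
  have hSi := S.isMechOn.smooth_inv (mem_univ (0 : Fin n → ℝ))
  have hG := S.smoothMatAt_G 0
  have hK : SmoothMatAt D.Kv 0 := fun i j =>
    (h.smooth_Kv i j).contDiffAt (h.isOpen_U.mem_nhds h.zero_mem_U)
  have hC : ∀ i j k, ContDiffAt ℝ ∞ (fun q => D.C q i j k) 0 := fun i j k =>
    (h.gyroscopic_C.1 i j k).contDiffAt
  have h1 := hasFDerivAt_mulVec_of_eq_zero (x := (0 : Phase n))
    (A := fun x : Phase n => (S.M x.1)⁻¹ * D.Mhat x.1)
    (SmoothMatAt.comp_fst (x := (0 : Phase n)) (hSi.mul hM)) h.isMechOn.hasFDerivAt_gradP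
    h.gradP_Hhat_zero
  have h2 := hasFDerivAt_mulVec_of_eq_zero (x := (0 : Phase n))
    (A := fun x : Phase n => D.Mhat x.1 * (S.M x.1)⁻¹)
    (SmoothMatAt.comp_fst (x := (0 : Phase n)) (hM.mul hSi)) h.isMechOn.hasFDerivAt_gradQ
    h.gradQ_Hhat_zero
  have h3 := hasFDerivAt_mulVec_of_eq_zero (x := (0 : Phase n))
    (A := fun x : Phase n => S.G x.1 * D.Kv x.1 * (S.G x.1)ᵀ)
    (SmoothMatAt.comp_fst (x := (0 : Phase n)) ((hG.mul hK).mul hG.transpose))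
    h.isMechOn.hasFDerivAt_gradP h.gradP_Hhat_zero
  have hv : ContDiffAt ℝ ∞ (fun x : Phase n => (D.Mhat x.1)⁻¹ *ᵥ x.2) 0 :=
    (SmoothMatAt.comp_fst (x := (0 : Phase n)) hMi).mulVec contDiffAt_snd
  have hv' : ∀ i, DifferentiableAt ℝ (fun x : Phase n => ((D.Mhat x.1)⁻¹ *ᵥ x.2) i) 0 :=
    fun i => (contDiffAt_pi.1 hv i).differentiableAt (by simp)
  have h4 : HasFDerivAt (fun x : Phase n => contract (D.C x.1) ((D.Mhat x.1)⁻¹ *ᵥ x.2))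
      (0 : Phase n →L[ℝ] (Fin n → ℝ)) 0 := by
    refine hasFDerivAt_pi'.2 fun k => ?_
    have h5 : HasFDerivAt (fun x : Phase n => ∑ i, ∑ j,
        D.C x.1 i j k * ((D.Mhat x.1)⁻¹ *ᵥ x.2) i * ((D.Mhat x.1)⁻¹ *ᵥ x.2) j)
        (∑ _i : Fin n, ∑ _j : Fin n, (0 : Phase n →L[ℝ] ℝ)) 0 :=
      HasFDerivAt.fun_sum fun i _ => HasFDerivAt.fun_sum fun j _ =>
        hasFDerivAt_mul_mul_zero
          (((hC i j k).comp (0 : Phase n) contDiffAt_fst).differentiableAt (by simp))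
          (hv' i) (hv' j) (by simp) (by simp)
    refine h5.congr_fderiv ?_
    simp
  refine ⟨_, h1.prodMk ((h2.neg.sub h3).add h4), fun x => ?_⟩
  refine Prod.ext ?_ ?_
  · change ((S.M 0)⁻¹ * D.Mhat 0) *ᵥ ((D.Mhat 0)⁻¹ *ᵥ x.2) = _
    rw [← Matrix.mulVec_mulVec, posDef_mulVec_inv (h.posDef_Mhat 0 h.zero_mem_U)]
  · change -((D.Mhat 0 * (S.M 0)⁻¹) *ᵥ (hess D.Vhat *ᵥ x.1)) -
      (S.G 0 * D.Kv 0 * (S.G 0)ᵀ) *ᵥ ((D.Mhat 0)⁻¹ *ᵥ x.2) + 0 = _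
    simp only [← Matrix.mulVec_mulVec, add_zero]

end General

section Underactuated

variable {S : ControlledHamiltonian (m + 1) m} {D : Design (m + 1) m}

/-- The feedback vanishes at the origin. -/
theorem u_zero (h : IsTransformedBy S D) (hEq : S.field 0 0 = 0) : D.u 0 = 0 := by
  have h1 := h.matching 0 h.zero_mem_domain
  rw [h.desiredField_zero] at h1
  have h2 := congrArg Prod.snd h1
  have h3 := congrArg Prod.snd hEq
  simp only [ControlledHamiltonian.field, Prod.snd_zero, Matrix.mulVec_zero, add_zero] at h2 h3
  rw [h3, zero_add] at h2
  exact S.mulVec_injective_G 0 (h2.trans (Matrix.mulVec_zero _).symm)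

theorem exists_linear_feedback (h : IsTransformedBy S D) (hEq : S.field 0 0 = 0)
    {F : Phase (m + 1) →L[ℝ] Phase (m + 1)} (hF : HasFDerivAt (D.desiredField S) F 0) :
    ∃ K : Phase (m + 1) →L[ℝ] (Fin m → ℝ), F = S.linA + S.linB.comp K := by
  have hu := (h.smooth_u.contDiffAt (h.isOpen_domain.mem_nhds h.zero_mem_domain)).differentiableAt
    (by simp)
  refine ⟨fderiv ℝ D.u 0, hF.unique ?_⟩
  refine (S.hasFDerivAt_field_feedback hu.hasFDerivAt (h.u_zero hEq)).congr_of_eventuallyEq ?_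
  filter_upwards [h.isOpen_domain.mem_nhds h.zero_mem_domain] with x hx
  exact (h.matching x hx).symm

variable {g : Fin (m + 1) → ℝ}

/-- The linearized potential matching condition. -/
theorem hess_mulVec_eq (h : IsTransformedBy S D) (hEq : S.field 0 0 = 0)
    (hg : (S.G 0)ᵀ *ᵥ g = 0) :
    hess S.V *ᵥ g = hess D.Vhat *ᵥ ((S.M 0)⁻¹ *ᵥ (D.Mhat 0 *ᵥ g)) := by
  obtain ⟨F, hF, hFx⟩ := h.hasFDerivAt_desiredField
  obtain ⟨K, hK⟩ := h.exists_linear_feedback hEq hF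
  rw [← sub_eq_zero]
  refine dotProduct_eq_zero _ fun v => ?_
  -- Pairing with `g` removes the feedback term; at zero momentum the damping also disappears and
  -- only the potentials are compared.
  have h1 : ControlledHamiltonian.unactuatedP g (F (v, 0)) =
      ControlledHamiltonian.unactuatedP g (S.linA (v, 0)) := by
    rw [hK, add_apply, map_add, ContinuousLinearMap.comp_apply, S.unactuatedP_linB hg, add_zero]
  rw [S.unactuatedP_linA, hFx] at h1
  simp only [ControlledHamiltonian.unactuatedP_apply, Matrix.mulVec_zero, sub_zero,
    dotProduct_neg, neg_inj] at h1
  rw [mulVec_dotProduct_eq, mulVec_dotProduct_eq, mulVec_dotProduct_eq,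
    Matrix.transpose_nonsing_inv, posDef_transpose (S.posDef_M 0),
    posDef_transpose (h.posDef_Mhat 0 h.zero_mem_U),
    hess_transpose (h.isMechOn.smooth_V 0 h.zero_mem_U)] at h1
  rw [sub_dotProduct, h1, sub_self]

/-- With z = M⁻¹M̂g, linearized matching gives z·Hess V̂ z = c z·Mg = c g·M̂g, where the left side
and g·M̂g are both positive. -/
theorem pos_of_parallel (h : IsTransformedBy S D) (hEq : S.field 0 0 = 0) (hg0 : g ≠ 0)
    (hg : (S.G 0)ᵀ *ᵥ g = 0) {c : ℝ} (hpar : hess S.V *ᵥ g = c • (S.M 0 *ᵥ g)) : 0 < c := by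
  set z := (S.M 0)⁻¹ *ᵥ (D.Mhat 0 *ᵥ g) with hz
  have hMz : S.M 0 *ᵥ z = D.Mhat 0 *ᵥ g := posDef_mulVec_inv (S.posDef_M 0) _
  have hpos : 0 < g ⬝ᵥ (D.Mhat 0 *ᵥ g) := posDef_pos (h.posDef_Mhat 0 h.zero_mem_U) hg0
  have hz0 : z ≠ 0 := by
    intro h0
    rw [h0, Matrix.mulVec_zero] at hMz
    rw [← hMz, dotProduct_zero] at hpos
    exact lt_irrefl _ hpos
  have h1 := (h.isMechOn.hess_pos h.nondegenerate_min).2 z hz0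
  rw [← h.hess_mulVec_eq hEq hg, hpar, dotProduct_smul, smul_eq_mul,
    dotProduct_mulVec_comm (posDef_transpose (S.posDef_M 0)), hMz] at h1
  exact (pos_iff_pos_of_mul_pos h1).2 hpos

theorem isControllable_or_isOscillatory (h : IsTransformedBy S D) (hEq : S.field 0 0 = 0) :
    IsControllable S.linA S.linB ∨ IsOscillatory (uncontrollablePart S.linA S.linB) := by
  obtain ⟨g, hg0, hg⟩ := exists_transpose_mulVec_eq_zero (S.G 0)
  by_cases hpar : ∃ c : ℝ, hess S.V *ᵥ g = c • (S.M 0 *ᵥ g)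
  · obtain ⟨c, hc⟩ := hpar
    exact Or.inr (S.isOscillatory_of_parallel hg0 hg (h.pos_of_parallel hEq hg0 hg hc) hc)
  · push Not at hpar
    exact Or.inl (S.isControllable_of_not_parallel hg0 hg hpar)

/-- In the parallel case `c > 0`, and no feedback reaches (y, ẏ): the closed-loop linearization
keeps an undamped oscillator as a quotient. -/
theorem isControllable_of_stable (h : IsTransformedBy S D) (hEq : S.field 0 0 = 0)
    (hst : IsLocallyExponentiallyStable (D.desiredField S) D.domain) :
    IsControllable S.linA S.linB := by
  obtain ⟨g, hg0, hg⟩ := exists_transpose_mulVec_eq_zero (S.G 0)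
  by_cases hpar : ∃ c : ℝ, hess S.V *ᵥ g = c • (S.M 0 *ᵥ g)
  · exfalso
    obtain ⟨c, hc⟩ := hpar
    obtain ⟨F, hF, -⟩ := h.hasFDerivAt_desiredField
    obtain ⟨K, hK⟩ := h.exists_linear_feedback hEq hF
    refine not_isLocallyExponentiallyStable_of_oscillator h.desiredField_zero hF
      (S.unactuatedQ g) (ControlledHamiltonian.unactuatedP g) (h.pos_of_parallel hEq hg0 hg hc)
      (fun x => ?_) (fun x => ?_) (S.unactuatedQ_ne_zero hg0) hst
    · rw [hK, add_apply, map_add, ContinuousLinearMap.comp_apply, S.unactuatedQ_linB, add_zero,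
        S.unactuatedQ_linA]
    · rw [hK, add_apply, map_add, ContinuousLinearMap.comp_apply, S.unactuatedP_linB hg, add_zero,
        S.unactuatedP_linA_of_parallel hc]
  · push Not at hpar
    exact S.isControllable_of_not_parallel hg0 hg hpar

/-- The Hessian of Ĥ dissipates exactly through the damped output L = GᵀM̂⁻¹p. Observability is a
LaSalle argument: if L and all its iterates along F vanish, then p = β M̂g and Hess V̂ q = α Mg; the
second relation applied to Fx gives β Hess V g = α' Mg, hence β = 0 as the two are not parallel. -/
theorem stable_of_isControllable (h : IsTransformedBy S D) (hEq : S.field 0 0 = 0)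
    (hctr : IsControllable S.linA S.linB) :
    IsLocallyExponentiallyStable (D.desiredField S) D.domain := by
  obtain ⟨g, hg0, hg⟩ := exists_transpose_mulVec_eq_zero (S.G 0)
  have hpar : ∀ c : ℝ, hess S.V *ᵥ g ≠ c • (S.M 0 *ᵥ g) := fun c hc =>
    S.not_isControllable_of_parallel hg0 hg hc hctr
  obtain ⟨F, hF, hFx⟩ := h.hasFDerivAt_desiredField
  have hMh := h.posDef_Mhat 0 h.zero_mem_U
  have hKv := h.posDef_Kv 0 h.zero_mem_U
  have hVpos := (h.isMechOn.hess_pos h.nondegenerate_min).2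
  have hs := h.isMechOn.contDiffAt_mechHamiltonian (x := 0) h.zero_mem_U
  have hPx := h.isMechOn.fderiv_fderiv_mechHamiltonian
  set P := fderiv ℝ (fderiv ℝ (mechHamiltonian D.Mhat D.Vhat)) 0 with hP
  let L : Phase (m + 1) →L[ℝ] (Fin m → ℝ) :=
    (mulVecCLM (S.G 0)ᵀ).comp ((mulVecCLM (D.Mhat 0)⁻¹).comp (ContinuousLinearMap.snd ℝ _ _))
  have hL : ∀ x, L x = (S.G 0)ᵀ *ᵥ ((D.Mhat 0)⁻¹ *ᵥ x.2) := fun x => rfl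
  have hdiss : ∀ x, P x (F x) = -(L x ⬝ᵥ (D.Kv 0 *ᵥ L x)) := by
    intro x
    rw [hPx, hFx, hL]
    simp only [sub_dotProduct, neg_dotProduct]
    have e1 : (D.Mhat 0 *ᵥ ((S.M 0)⁻¹ *ᵥ (hess D.Vhat *ᵥ x.1))) ⬝ᵥ ((D.Mhat 0)⁻¹ *ᵥ x.2) =
        ((S.M 0)⁻¹ *ᵥ x.2) ⬝ᵥ (hess D.Vhat *ᵥ x.1) := by
      rw [dotProduct_comm, dotProduct_mulVec_comm (posDef_transpose hMh), posDef_mulVec_inv hMh,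
        dotProduct_comm, dotProduct_mulVec_comm (by
          rw [Matrix.transpose_nonsing_inv, posDef_transpose (S.posDef_M 0)]), dotProduct_comm]
    have e2 : (S.G 0 *ᵥ (D.Kv 0 *ᵥ ((S.G 0)ᵀ *ᵥ ((D.Mhat 0)⁻¹ *ᵥ x.2)))) ⬝ᵥ
        ((D.Mhat 0)⁻¹ *ᵥ x.2) = ((S.G 0)ᵀ *ᵥ ((D.Mhat 0)⁻¹ *ᵥ x.2)) ⬝ᵥ
          (D.Kv 0 *ᵥ ((S.G 0)ᵀ *ᵥ ((D.Mhat 0)⁻¹ *ᵥ x.2))) := by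
      rw [dotProduct_comm, mulVec_dotProduct_eq]
    rw [e1, e2]
    ring
  have hFker : ∀ x, L x = 0 →
      F x = ((S.M 0)⁻¹ *ᵥ x.2, -(D.Mhat 0 *ᵥ ((S.M 0)⁻¹ *ᵥ (hess D.Vhat *ᵥ x.1)))) := by
    intro x hx
    rw [hFx, ← hL, hx]
    simp
  have hstep : ∀ x, (∀ k : ℕ, L ((F ^ k) x) = 0) → ∀ k : ℕ, L ((F ^ k) (F x)) = 0 := by
    intro x hx k
    have := hx (k + 1)
    rwa [pow_succ] at this
  have hker : ∀ x, L x = 0 → ∃ β : ℝ, x.2 = β • (D.Mhat 0 *ᵥ g) := by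
    intro x hx
    obtain ⟨β, hβ⟩ := exists_eq_smul_of_rank (S.rank_G 0) hg0 hg (hL x ▸ hx)
    exact ⟨β, by rw [← Matrix.mulVec_smul, ← hβ, posDef_mulVec_inv hMh]⟩
  have hforce : ∀ x, (∀ k : ℕ, L ((F ^ k) x) = 0) →
      ∃ α : ℝ, hess D.Vhat *ᵥ x.1 = α • (S.M 0 *ᵥ g) := by
    intro x hx
    obtain ⟨β, hβ⟩ := hker (F x) (hstep x hx 0)
    rw [hFker x (hx 0)] at hβ
    refine ⟨-β, ?_⟩
    have e1 := congrArg (fun v => S.M 0 *ᵥ ((D.Mhat 0)⁻¹ *ᵥ v)) hβ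
    simp only [Matrix.mulVec_neg, Matrix.mulVec_smul, posDef_inv_mulVec hMh,
      posDef_mulVec_inv (S.posDef_M 0)] at e1
    rw [neg_smul, ← e1, neg_neg]
  have hmom : ∀ x, (∀ k : ℕ, L ((F ^ k) x) = 0) → x.2 = 0 := by
    intro x hx
    obtain ⟨β, hβ⟩ := hker x (hx 0)
    obtain ⟨α, hα⟩ := hforce (F x) (hstep x hx)
    rw [hFker x (hx 0)] at hα
    simp only [hβ, Matrix.mulVec_smul] at hα
    rw [← h.hess_mulVec_eq hEq hg] at hα
    by_cases hβ0 : β = 0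
    · rw [hβ, hβ0, zero_smul]
    · exfalso
      refine hpar (β⁻¹ * α) ?_
      rw [mul_smul, ← hα, smul_smul, inv_mul_cancel₀ hβ0, one_smul]
  have hobs : ∀ x, (∀ k : ℕ, L ((F ^ k) x) = 0) → x = 0 := by
    intro x hx
    refine Prod.ext ?_ (hmom x hx)
    -- Zero momentum at all iterates means zero force, and Hess V̂ is definite.
    have h1 := hmom (F x) (hstep x hx)
    rw [hFker x (hx 0)] at h1
    have e1 := congrArg (fun v => S.M 0 *ᵥ ((D.Mhat 0)⁻¹ *ᵥ v)) h1
    simp only [Matrix.mulVec_neg, posDef_inv_mulVec hMh,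
      posDef_mulVec_inv (S.posDef_M 0), Matrix.mulVec_zero, neg_eq_zero] at e1
    by_contra hne
    have h2 := hVpos x.1 hne
    rw [e1, dotProduct_zero] at h2
    exact lt_irrefl _ h2
  have hPpos : ∀ x, x ≠ 0 → 0 < P x x := by
    intro x hx
    rw [hPx]
    by_cases h1 : x.1 = 0
    · have h2 : x.2 ≠ 0 := fun h2 => hx (Prod.ext h1 h2)
      simpa [h1] using posDef_pos hMh.inv h2
    · have h2 : 0 ≤ x.2 ⬝ᵥ ((D.Mhat 0)⁻¹ *ᵥ x.2) := by
        simpa using hMh.inv.posSemidef.dotProduct_mulVec_nonneg x.2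
      linarith [hVpos _ h1]
  obtain ⟨W, κ₁, κ₂, hκ₁, hκ₂, hsymm, hlow, hdec⟩ := exists_strict_lyapunov F P L
    (fun x y => fderiv_fderiv_symm hs x y) hPpos
    (fun x => by
      rw [hdiss, neg_nonpos]
      simpa using hKv.posSemidef.dotProduct_mulVec_nonneg (L x))
    (fun x hx => by
      rw [hdiss, neg_eq_zero] at hx
      by_contra hne
      exact (posDef_pos hKv hne).ne' hx) hobs
  exact isLocallyExponentiallyStable_of_lyapunov h.isOpen_domain h.zero_mem_domain
    h.contDiffOn_desiredField h.desiredField_zero hF hκ₁ hκ₂ hsymm hlow hdec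

end Underactuated

end IsTransformedBy

end ClosedLoop

/-! ### Building blocks: gyroscopic tensors, potentials and mass matrices -/

section Shaping
open scoped Topology
open Set Filter

/-- Two covectors are simultaneously positive on some vector unless the second one is a
nonpositive multiple of the first. -/
theorem exists_dotProduct_pos {n : ℕ} {a b : Fin n → ℝ} (ha : a ≠ 0)
    (h : ∀ c : ℝ, b = c • a → 0 < c) : ∃ z : Fin n → ℝ, 0 < a ⬝ᵥ z ∧ 0 < b ⬝ᵥ z := by
  have haa : 0 < a ⬝ᵥ a := lt_of_le_of_ne (Finset.sum_nonneg fun i _ => mul_self_nonneg (a i))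
    fun h0 => ha (dotProduct_self_eq_zero.1 h0.symm)
  set c := (a ⬝ᵥ b) / (a ⬝ᵥ a) with hc
  set d := b - c • a with hd
  have had : a ⬝ᵥ d = 0 := by
    rw [hd, dotProduct_sub, dotProduct_smul, hc, smul_eq_mul, div_mul_cancel₀ _ haa.ne', sub_self]
  have hb : b = c • a + d := by rw [hd]; abel
  by_cases hd0 : d = 0
  · have hb' : b = c • a := by rw [hb, hd0, add_zero]
    refine ⟨a, haa, ?_⟩
    rw [hb', smul_dotProduct]
    exact mul_pos (h c hb') haa
  · have hdd : 0 < d ⬝ᵥ d := lt_of_le_of_ne (Finset.sum_nonneg fun i _ => mul_self_nonneg (d i))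
      fun h0 => hd0 (dotProduct_self_eq_zero.1 h0.symm)
    -- As `d` is orthogonal to `a`, adding a multiple of it leaves the first pairing alone; the
    -- coefficient makes the second at least 1.
    refine ⟨a + ((1 + |c * (a ⬝ᵥ a)|) / (d ⬝ᵥ d)) • d, ?_, ?_⟩
    · rw [dotProduct_add, dotProduct_smul, had]
      simpa using haa
    · have hda : d ⬝ᵥ a = 0 := by rw [dotProduct_comm, had]
      rw [hb]
      simp only [dotProduct_add, add_dotProduct, dotProduct_smul, smul_dotProduct, had, hda,
        smul_eq_mul, mul_zero, add_zero, zero_add]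
      rw [div_mul_cancel₀ _ hdd.ne']
      linarith [neg_abs_le (c * (a ⬝ᵥ a))]

/-- The gyroscopic tensor built from a symmetric matrix and a covector. -/
def gyroTensor {n : ℕ} (Q : Matrix (Fin n) (Fin n) ℝ) (l : Fin n → ℝ) (i j k : Fin n) : ℝ :=
  Q i j * l k - (1 / 2) * (Q j k * l i + Q i k * l j)

theorem isGyroscopic_smul_gyroTensor {n : ℕ} {Q : Matrix (Fin n) (Fin n) ℝ} (hQ : Qᵀ = Q)
    (t : ℝ) (l : Fin n → ℝ) : IsGyroscopic (fun i j k => t * gyroTensor Q l i j k) := by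
  have h : ∀ i j, Q i j = Q j i := fun i j => congrFun (congrFun hQ.symm i) j
  refine ⟨fun i j k => ?_, fun i j k => ?_⟩
  · simp only [gyroTensor]
    rw [h i j]
    ring
  · simp only [gyroTensor]
    rw [h k j, h k i, h j i]
    ring

/-- The second term compensates the first at `w = v`, as the cyclic condition requires. In the
direction in which force is needed it is an error, which `gyroForm` corrects. -/
theorem contract_gyroTensor {n : ℕ} {Q : Matrix (Fin n) (Fin n) ℝ} (l v w : Fin n → ℝ) :
    w ⬝ᵥ contract (gyroTensor Q l) v =
      (v ⬝ᵥ (Q *ᵥ v)) * (w ⬝ᵥ l) - (v ⬝ᵥ (Q *ᵥ w)) * (v ⬝ᵥ l) := by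
  have h1 : ∀ k, contract (gyroTensor Q l) v k =
      (v ⬝ᵥ (Q *ᵥ v)) * l k - (∑ j, v j * Q j k) * (v ⬝ᵥ l) := by
    intro k
    have e1 : (v ⬝ᵥ (Q *ᵥ v)) * l k = ∑ i, ∑ j, Q i j * l k * v i * v j := by
      simp only [dotProduct, Matrix.mulVec, Finset.mul_sum, Finset.sum_mul]
      exact Finset.sum_congr rfl fun i _ => Finset.sum_congr rfl fun j _ => by ring
    have e2 : (∑ j, v j * Q j k) * (v ⬝ᵥ l) = ∑ i, ∑ j, Q j k * l i * v i * v j := by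
      simp only [dotProduct, Finset.mul_sum, Finset.sum_mul]
      exact Finset.sum_congr rfl fun i _ => Finset.sum_congr rfl fun j _ => by ring
    have e3 : (∑ j, v j * Q j k) * (v ⬝ᵥ l) = ∑ i, ∑ j, Q i k * l j * v i * v j := by
      simp only [dotProduct, Finset.mul_sum, Finset.sum_mul]
      rw [Finset.sum_comm]
      exact Finset.sum_congr rfl fun i _ => Finset.sum_congr rfl fun j _ => by ring
    have e4 : contract (gyroTensor Q l) v k = ∑ i, ∑ j, Q i j * l k * v i * v j -
        (1 / 2) * (∑ i, ∑ j, Q j k * l i * v i * v j + ∑ i, ∑ j, Q i k * l j * v i * v j) := by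
      simp only [contract, gyroTensor, ← Finset.sum_add_distrib, Finset.mul_sum,
        ← Finset.sum_sub_distrib]
      exact Finset.sum_congr rfl fun i _ => Finset.sum_congr rfl fun j _ => by ring
    rw [e4, ← e1, ← e2, ← e3]
    ring
  have h2 : v ⬝ᵥ (Q *ᵥ w) = ∑ k, w k * ∑ j, v j * Q j k := by
    simp only [dotProduct, Matrix.mulVec, Finset.mul_sum]
    rw [Finset.sum_comm]
    exact Finset.sum_congr rfl fun i _ => Finset.sum_congr rfl fun j _ => by ring
  rw [h2]
  change ∑ k, w k * contract (gyroTensor Q l) v k = _ * (∑ k, w k * l k) - _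
  simp only [h1]
  generalize v ⬝ᵥ (Q *ᵥ v) = a
  generalize v ⬝ᵥ l = b
  simp only [mul_sub, Finset.sum_sub_distrib]
  rw [Finset.mul_sum, Finset.sum_mul]
  congr 1
  · exact Finset.sum_congr rfl fun i _ => by ring
  · exact Finset.sum_congr rfl fun i _ => by ring

/-- The correction of a quadratic form that makes its gyroscopic tensor contract to it. -/
def gyroForm {n : ℕ} (Q : Matrix (Fin n) (Fin n) ℝ) (g : Fin n → ℝ) : Matrix (Fin n) (Fin n) ℝ :=
  Q + (g ⬝ᵥ g)⁻¹ • (Matrix.vecMulVec g (Q *ᵥ g) + Matrix.vecMulVec (Q *ᵥ g) g)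

theorem gyroForm_transpose {n : ℕ} {Q : Matrix (Fin n) (Fin n) ℝ} (hQ : Qᵀ = Q)
    (g : Fin n → ℝ) : (gyroForm Q g)ᵀ = gyroForm Q g := by
  rw [gyroForm, Matrix.transpose_add, Matrix.transpose_smul, Matrix.transpose_add,
    Matrix.transpose_vecMulVec, Matrix.transpose_vecMulVec, hQ, add_comm (Matrix.vecMulVec _ g)]

/-- Write Q' for `gyroForm Q g`. As Q(g,g) = 0, one has Q'(v,g) = 2Q(v,g) and Q'(v,v) = Q(v,v) +
2(v·g)Q(v,g)/|g|², so the correction cancels the unwanted term. The condition on `g` is necessary,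
since a gyroscopic term does no work: C(g,g,g) = 0. -/
theorem dotProduct_contract_gyroForm {n : ℕ} {Q : Matrix (Fin n) (Fin n) ℝ}
    {g : Fin n → ℝ} (hg : g ≠ 0) (hgg : g ⬝ᵥ (Q *ᵥ g) = 0) (v : Fin n → ℝ) :
    g ⬝ᵥ contract (gyroTensor (gyroForm Q g) ((g ⬝ᵥ g)⁻¹ • g)) v = v ⬝ᵥ (Q *ᵥ v) := by
  have hg2 : g ⬝ᵥ g ≠ 0 := fun h => hg (dotProduct_self_eq_zero.1 h)
  have hvec : ∀ a b w x : Fin n → ℝ, x ⬝ᵥ (Matrix.vecMulVec a b *ᵥ w) = (x ⬝ᵥ a) * (b ⬝ᵥ w) := by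
    intro a b w x
    rw [Matrix.vecMulVec_mulVec]
    simp [dotProduct_smul, mul_comm]
  rw [contract_gyroTensor]
  simp only [gyroForm, Matrix.add_mulVec, Matrix.smul_mulVec, dotProduct_add, dotProduct_smul,
    hvec, smul_eq_mul]
  rw [dotProduct_comm (Q *ᵥ g) v, dotProduct_comm (Q *ᵥ g) g, hgg, dotProduct_comm g v]
  field_simp
  ring

/-- A potential with prescribed derivative in one direction and positive definite Hessian. -/
theorem exists_potential {n : ℕ} {z : Fin n → ℝ} (hz : z ≠ 0) {s : (Fin n → ℝ) → ℝ}
    (hs : ContDiff ℝ ∞ s) (hs0 : s 0 = 0) (hsz : 0 < fderiv ℝ s 0 z) :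
    ∃ V : (Fin n → ℝ) → ℝ, ContDiff ℝ ∞ V ∧ (∀ q, fderiv ℝ V q z = s q) ∧ fderiv ℝ V 0 = 0 ∧
      ∀ v, v ≠ 0 → 0 < v ⬝ᵥ (hess V *ᵥ v) := by
  obtain ⟨F, hF, hFz⟩ := exists_fderiv_apply_eq hz hs
  obtain ⟨l, hl⟩ := SeparatingDual.exists_eq_one (R := ℝ) hz
  -- The projection along `z` onto the kernel of `l`; functions of `T q` do not change along `z`.
  let T : (Fin n → ℝ) →L[ℝ] (Fin n → ℝ) := ContinuousLinearMap.id ℝ _ - l.smulRight z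
  have hT : ∀ q, T q = q - l q • z := fun q => rfl
  have hTz : T z = 0 := by rw [hT, hl, one_smul, sub_self]
  set B := fderiv ℝ (fderiv ℝ F) 0 with hB
  have hBsymm : ∀ v w, B v w = B w v := fderiv_fderiv_symm hF.contDiffAt
  have hBd : HasFDerivAt (fderiv ℝ F) B 0 := (differentiableAt_fderiv hF.contDiffAt).hasFDerivAt
  have hBz : B z z = fderiv ℝ s 0 z := by
    have h1 := hBd.clm_apply (hasFDerivAt_const z (0 : Fin n → ℝ))
    have h2 : (fun q => fderiv ℝ F q z) = s := funext hFz
    rw [h2] at h1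
    rw [h1.fderiv]
    simp
  have hb : 0 < B z z := hBz ▸ hsz
  obtain ⟨κ, hκ, hco⟩ := exists_coercive (Q := fun w : Fin n → ℝ => w ⬝ᵥ w)
    (by simp only [dotProduct]; fun_prop)
    (fun t x => by simp only [dotProduct_smul, smul_dotProduct, smul_eq_mul]; ring)
    (fun x hx => lt_of_le_of_ne (Finset.sum_nonneg fun i _ => mul_self_nonneg (x i))
      fun h0 => hx (dotProduct_self_eq_zero.1 h0.symm))
  set K₁ := (‖B‖ * ‖z‖) ^ 2 / κ with hK₁
  set K₂ := ‖B‖ / κ with hK₂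
  have hb1 : ∀ w, (B z w) ^ 2 ≤ K₁ * (w ⬝ᵥ w) := by
    intro w
    have h1 := B.le_opNorm₂ z w
    rw [Real.norm_eq_abs] at h1
    calc (B z w) ^ 2 = |B z w| ^ 2 := (sq_abs _).symm
      _ ≤ (‖B‖ * ‖z‖ * ‖w‖) ^ 2 := by gcongr
      _ = K₁ * (κ * ‖w‖ ^ 2) := by rw [hK₁]; field_simp
      _ ≤ K₁ * (w ⬝ᵥ w) := mul_le_mul_of_nonneg_left (hco w) (by positivity)
  have hb2 : ∀ w, -(K₂ * (w ⬝ᵥ w)) ≤ B w w := by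
    intro w
    have h1 := B.le_opNorm₂ w w
    rw [Real.norm_eq_abs] at h1
    have h2 : ‖B‖ * ‖w‖ * ‖w‖ = K₂ * (κ * ‖w‖ ^ 2) := by rw [hK₂]; field_simp
    have h3 := mul_le_mul_of_nonneg_left (hco w) (by positivity : 0 ≤ K₂)
    linarith [neg_abs_le (B w w)]
  -- Completing the square in the `z`-direction leaves a loss of at most `K₁ / B z z + K₂` times `w
  -- ⬝ᵥ w`; `2 k` exceeds it by one.
  set k := (K₁ / B z z + K₂ + 1) / 2 with hk
  -- Removing the linear part makes the origin critical without altering the derivative along `z`,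
  -- because `s 0 = 0`; the penalty convexifies transversally to `z`.
  let V : (Fin n → ℝ) → ℝ := fun q => F q - fderiv ℝ F 0 q + k * (T q ⬝ᵥ T q)
  have hFd : ∀ q, HasFDerivAt F (fderiv ℝ F q) q := fun q =>
    (hF.differentiable (by simp) q).hasFDerivAt
  have hVd : ∀ q, HasFDerivAt V (fderiv ℝ F q - fderiv ℝ F 0 +
      (2 * k) • (dotCLM (T q)).comp T) q := by
    intro q
    have h1 : HasFDerivAt (fun q => ∑ i, T q i * T q i)
        (∑ i, (T q i • ((ContinuousLinearMap.proj i).comp T) +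
          T q i • ((ContinuousLinearMap.proj i).comp T))) q :=
      HasFDerivAt.fun_sum fun i _ => (hasFDerivAt_pi'.1 T.hasFDerivAt i).mul
        (hasFDerivAt_pi'.1 T.hasFDerivAt i)
    have h2 := ((hFd q).sub (fderiv ℝ F 0).hasFDerivAt).add (h1.const_mul k)
    refine h2.congr_fderiv (ContinuousLinearMap.ext fun v => ?_)
    simp [dotProduct, Finset.mul_sum, sum_apply]
    refine Finset.sum_congr rfl fun i _ => by ring
  have hV : ContDiff ℝ ∞ V := by
    refine (hF.sub (fderiv ℝ F 0).contDiff).add (contDiff_const.mul ?_)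
    simp only [dotProduct]
    exact ContDiff.sum fun i _ => (contDiff_pi.1 T.contDiff i).mul (contDiff_pi.1 T.contDiff i)
  have hVf : ∀ q w, fderiv ℝ V q w =
      fderiv ℝ F q w - fderiv ℝ F 0 w + (2 * k) * (T q ⬝ᵥ T w) := fun q w => by
    rw [(hVd q).fderiv]
    rfl
  have hHess : ∀ v, v ⬝ᵥ (hess V *ᵥ v) = B v v + 2 * k * (T v ⬝ᵥ T v) := by
    intro v
    rw [dotProduct_hess_mulVec]
    have h1 := (differentiableAt_fderiv (hV.contDiffAt (x := 0))).hasFDerivAt.clm_apply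
      (hasFDerivAt_const v (0 : Fin n → ℝ))
    have h2 : HasFDerivAt (fun q => fderiv ℝ F q v - fderiv ℝ F 0 v + (2 * k) * (T v ⬝ᵥ T q)) _ 0 :=
      ((hBd.clm_apply (hasFDerivAt_const v (0 : Fin n → ℝ))).sub_const (fderiv ℝ F 0 v)).add
        (((dotCLM (T v)).comp T).hasFDerivAt.const_mul (2 * k))
    have h3 : (fun q => fderiv ℝ V q v) =
        fun q => fderiv ℝ F q v - fderiv ℝ F 0 v + (2 * k) * (T v ⬝ᵥ T q) := by
      funext q
      rw [hVf, dotProduct_comm (T q)]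
    rw [h3] at h1
    have h4 := congrArg (fun L => L v) (h1.unique h2)
    simpa using h4
  refine ⟨V, hV, fun q => ?_, ?_, fun v hv => ?_⟩
  · rw [hVf, hFz, hFz, hs0, hTz, dotProduct_zero]
    ring
  · refine ContinuousLinearMap.ext fun w => ?_
    rw [hVf]
    simp
  · rw [hHess]
    set w := T v with hw
    have hv' : v = l v • z + w := by rw [hw, hT]; abel
    have hww : 0 ≤ w ⬝ᵥ w := Finset.sum_nonneg fun i _ => mul_self_nonneg (w i)
    have e1 : B v v = B z z * (l v + B z w / B z z) ^ 2 - (B z w) ^ 2 / B z z + B w w := by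
      conv_lhs => rw [hv']
      simp only [map_add, map_smul, add_apply, smul_apply, smul_eq_mul, hBsymm w z]
      field_simp
      ring
    have e2 : (B z w) ^ 2 / B z z ≤ K₁ / B z z * (w ⬝ᵥ w) := by
      rw [div_mul_eq_mul_div]
      gcongr
      exact hb1 w
    have e3 : 2 * k * (w ⬝ᵥ w) = K₁ / B z z * (w ⬝ᵥ w) + K₂ * (w ⬝ᵥ w) + w ⬝ᵥ w := by
      rw [hk]; ring
    have e4 := hb2 w
    rw [e1, e3]
    by_cases hw0 : w = 0
    · have hlv : l v ≠ 0 := by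
        intro h0
        rw [h0, hw0, zero_smul, zero_add] at hv'
        exact hv hv'
      simp only [hw0, map_zero, dotProduct_zero, zero_div, add_zero]
      have := mul_pos hb (sq_pos_of_ne_zero hlv)
      simpa using this
    · have hww' : 0 < w ⬝ᵥ w := lt_of_le_of_ne hww
        fun h0 => hw0 (dotProduct_self_eq_zero.1 h0.symm)
      have := mul_nonneg hb.le (sq_nonneg (l v + B z w / B z z))
      linarith

/-- The directional derivative of a matrix-vector product. -/
theorem fderiv_mulVec {m n : ℕ} {E : Type*} [NormedAddCommGroup E] [NormedSpace ℝ E]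
    {A : E → Matrix (Fin m) (Fin n) ℝ} {w : E → Fin n → ℝ} {x : E} (hA : SmoothMatAt A x)
    (hw : ContDiffAt ℝ ∞ w x) (v : E) :
    fderiv ℝ (fun y => A y *ᵥ w y) x v = dMat A x v *ᵥ w x + A x *ᵥ fderiv ℝ w x v := by
  have hw' := (hw.differentiableAt (by simp)).hasFDerivAt
  have h1 : HasFDerivAt (fun y => A y *ᵥ w y) (ContinuousLinearMap.pi fun i =>
      ∑ j, (A x i j • ((ContinuousLinearMap.proj j).comp (fderiv ℝ w x)) +
        w x j • fderiv ℝ (fun y => A y i j) x)) x :=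
    hasFDerivAt_pi.2 fun i => by
      change HasFDerivAt (fun y => ∑ j, A y i j * w y j) _ x
      exact HasFDerivAt.fun_sum fun j _ =>
        ((hA i j).differentiableAt (by simp)).hasFDerivAt.mul (hasFDerivAt_pi'.1 hw' j)
  rw [h1.fderiv]
  funext i
  simp only [ContinuousLinearMap.coe_pi', sum_apply, add_apply, smul_apply,
    ContinuousLinearMap.comp_apply, ContinuousLinearMap.proj_apply, smul_eq_mul, Pi.add_apply,
    Matrix.mulVec, dotProduct, dMat, Matrix.of_apply, ← Finset.sum_add_distrib]
  exact Finset.sum_congr rfl fun j _ => by ring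

/-- A positive definite matrix mapping `g` to `y`. -/
def shapedMass {n : ℕ} (g y : Fin n → ℝ) : Matrix (Fin n) (Fin n) ℝ :=
  (g ⬝ᵥ y)⁻¹ • Matrix.vecMulVec y y + ((g ⬝ᵥ g) • (1 : Matrix (Fin n) (Fin n) ℝ) -
    Matrix.vecMulVec g g)

theorem shapedMass_mulVec {n : ℕ} {g y : Fin n → ℝ} (h : 0 < g ⬝ᵥ y) :
    shapedMass g y *ᵥ g = y := by
  simp only [shapedMass, Matrix.add_mulVec, Matrix.sub_mulVec, Matrix.smul_mulVec,
    Matrix.vecMulVec_mulVec, Matrix.one_mulVec]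
  rw [dotProduct_comm y g]
  funext i
  simp
  field_simp

/-- Both summands are nonnegative. The second is |g|² times the squared norm of the part orthogonal
to g, so it vanishes only on multiples of g, where the first is positive. -/
theorem shapedMass_posDef {n : ℕ} {g y : Fin n → ℝ} (h : 0 < g ⬝ᵥ y) :
    (shapedMass g y).PosDef := by
  refine Matrix.PosDef.of_dotProduct_mulVec_pos ?_ fun v hv => ?_
  · rw [Matrix.IsHermitian, Matrix.conjTranspose_eq_transpose_of_trivial, shapedMass]
    simp [Matrix.transpose_add, Matrix.transpose_sub, Matrix.transpose_smul,
      Matrix.transpose_vecMulVec]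
  · have hg : g ≠ 0 := by
      rintro rfl
      simp at h
    have hgg : 0 < g ⬝ᵥ g := lt_of_le_of_ne (Finset.sum_nonneg fun i _ => mul_self_nonneg (g i))
      fun h0 => hg (dotProduct_self_eq_zero.1 h0.symm)
    set t := (g ⬝ᵥ v) / (g ⬝ᵥ g) with ht
    set w := v - t • g with hw
    have hv' : v = t • g + w := by rw [hw]; abel
    have hgw : g ⬝ᵥ w = 0 := by
      rw [hw, dotProduct_sub, dotProduct_smul, ht, smul_eq_mul, div_mul_cancel₀ _ hgg.ne', sub_self]
    have hww : 0 ≤ w ⬝ᵥ w := Finset.sum_nonneg fun i _ => mul_self_nonneg (w i)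
    have e1 : star v ⬝ᵥ (shapedMass g y *ᵥ v) =
        (g ⬝ᵥ y)⁻¹ * (y ⬝ᵥ v) ^ 2 + (g ⬝ᵥ g) * (w ⬝ᵥ w) := by
      have e2 : v ⬝ᵥ v = t ^ 2 * (g ⬝ᵥ g) + w ⬝ᵥ w := by
        rw [hv']
        simp only [dotProduct_add, add_dotProduct, dotProduct_smul, smul_dotProduct, hgw,
          dotProduct_comm w g, smul_eq_mul]
        ring
      have e3 : g ⬝ᵥ v = t * (g ⬝ᵥ g) := by rw [ht, div_mul_cancel₀ _ hgg.ne']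
      simp only [shapedMass, Matrix.add_mulVec, Matrix.sub_mulVec, Matrix.smul_mulVec,
        Matrix.vecMulVec_mulVec, Matrix.one_mulVec, dotProduct_add, dotProduct_sub,
        dotProduct_smul, smul_eq_mul, star_trivial, op_smul_eq_smul, e2, dotProduct_comm v g, e3,
        dotProduct_comm v y]
      ring
    rw [e1]
    by_cases hw0 : w = 0
    · rw [hw0, add_zero] at hv'
      have ht0 : t ≠ 0 := by
        rintro h0
        rw [h0, zero_smul] at hv'
        exact hv hv'
      have e4 : y ⬝ᵥ v = t * (g ⬝ᵥ y) := by rw [hv', dotProduct_smul, dotProduct_comm, smul_eq_mul]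
      rw [e4]
      have := mul_nonneg hgg.le hww
      have : 0 < (g ⬝ᵥ y)⁻¹ * (t * (g ⬝ᵥ y)) ^ 2 := by positivity
      linarith
    · have hww' : 0 < w ⬝ᵥ w := lt_of_le_of_ne hww
        fun h0 => hw0 (dotProduct_self_eq_zero.1 h0.symm)
      have := mul_pos hgg hww'
      have : 0 ≤ (g ⬝ᵥ y)⁻¹ * (y ⬝ᵥ v) ^ 2 := by positivity
      linarith

end Shaping

/-! ### Solving the matching equations -/

section Construction
open scoped Topology
open Set Filter

theorem contDiffAt_contract {n : ℕ} {E : Type*} [NormedAddCommGroup E] [NormedSpace ℝ E]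
    {C : E → Fin n → Fin n → Fin n → ℝ} {v : E → Fin n → ℝ} {x : E}
    (hC : ∀ i j k, ContDiffAt ℝ ∞ (fun y => C y i j k) x) (hv : ContDiffAt ℝ ∞ v x) :
    ContDiffAt ℝ ∞ (fun y => contract (C y) (v y)) x :=
  contDiffAt_pi.2 fun k => ContDiffAt.sum fun i _ => ContDiffAt.sum fun j _ =>
    ((hC i j k).mul (contDiffAt_pi.1 hv i)).mul (contDiffAt_pi.1 hv j)

namespace ControlledHamiltonian

variable {m : ℕ} (S : ControlledHamiltonian (m + 1) m)

/-- The Moore–Penrose inverse of the input matrix. -/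
def pinvG (q : Fin (m + 1) → ℝ) : Matrix (Fin m) (Fin (m + 1)) ℝ :=
  ((S.G q)ᵀ * S.G q)⁻¹ * (S.G q)ᵀ

theorem posDef_gram (q : Fin (m + 1) → ℝ) : ((S.G q)ᵀ * S.G q).PosDef := by
  have := Matrix.PosDef.conjTranspose_mul_self (S.G q) (S.mulVec_injective_G q)
  rwa [Matrix.conjTranspose_eq_transpose_of_trivial] at this

theorem smoothMatAt_pinvG (q : Fin (m + 1) → ℝ) : SmoothMatAt S.pinvG q :=
  (((S.smoothMatAt_G q).transpose.mul (S.smoothMatAt_G q)).inv (S.posDef_gram q).det_pos.ne').mul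
    (S.smoothMatAt_G q).transpose

theorem transpose_mulVec_sub_pinvG (q w : Fin (m + 1) → ℝ) :
    (S.G q)ᵀ *ᵥ (w - S.G q *ᵥ (S.pinvG q *ᵥ w)) = 0 := by
  rw [Matrix.mulVec_sub, pinvG, ← Matrix.mulVec_mulVec, Matrix.mulVec_mulVec,
    posDef_mulVec_inv (S.posDef_gram q), sub_self]

/-- The residual lies in the left kernel, hence is a multiple of `g`, and pairing with `g` kills it.
So the momentum equation can be solved for the input once its `g`-component holds. -/
theorem mulVec_pinvG_of_dotProduct_eq_zero {q g w : Fin (m + 1) → ℝ} (hg0 : g ≠ 0)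
    (hg : (S.G q)ᵀ *ᵥ g = 0) (hw : g ⬝ᵥ w = 0) : S.G q *ᵥ (S.pinvG q *ᵥ w) = w := by
  obtain ⟨t, ht⟩ := exists_eq_smul_of_rank (S.rank_G q) hg0 hg (S.transpose_mulVec_sub_pinvG q w)
  have h1 := congrArg (fun v => g ⬝ᵥ v) ht
  simp only [dotProduct_sub, hw, mulVec_dotProduct_eq (S.G q), hg, zero_dotProduct, sub_zero,
    dotProduct_smul, smul_eq_mul] at h1
  have h2 : t = 0 := (mul_eq_zero.1 h1.symm).resolve_right
    fun h => hg0 (dotProduct_self_eq_zero.1 h)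
  rw [h2, zero_smul] at ht
  exact (sub_eq_zero.1 ht).symm

/-- A covector annihilating the input matrix at the origin extends to a smooth annihilator. -/
theorem exists_annihilator {g₀ : Fin (m + 1) → ℝ} (hg : (S.G 0)ᵀ *ᵥ g₀ = 0) :
    ∃ g : (Fin (m + 1) → ℝ) → Fin (m + 1) → ℝ, ContDiff ℝ ∞ g ∧ g 0 = g₀ ∧
      ∀ q, (S.G q)ᵀ *ᵥ g q = 0 := by
  refine ⟨fun q => g₀ - S.G q *ᵥ (S.pinvG q *ᵥ g₀), contDiff_iff_contDiffAt.2 fun q => ?_, ?_,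
    fun q => S.transpose_mulVec_sub_pinvG q g₀⟩
  · exact contDiffAt_const.sub
      ((S.smoothMatAt_G q).mulVec ((S.smoothMatAt_pinvG q).mulVec contDiffAt_const))
  · simp only [pinvG, ← Matrix.mulVec_mulVec, hg, Matrix.mulVec_zero, sub_zero]

section Kinetic

variable (g : (Fin (m + 1) → ℝ) → Fin (m + 1) → ℝ) (z : Fin (m + 1) → ℝ)

/-- The kinetic energy pairing of `g` and `z`. -/
def massPairing (q : Fin (m + 1) → ℝ) : ℝ := g q ⬝ᵥ (S.M q *ᵥ z)

/-- The derivative along `g` of the inverse mass matrix, evaluated at `M z`. -/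
def kineticForce (q : Fin (m + 1) → ℝ) : ℝ :=
  (S.M q *ᵥ z) ⬝ᵥ (dMat (fun q => (S.M q)⁻¹) q (g q) *ᵥ (S.M q *ᵥ z))

/-- The right-hand side of the kinetic matching equation for the factor `f`. -/
def kineticRhs (q : Fin (m + 1) → ℝ) : ℝ :=
  (S.M q *ᵥ z) ⬝ᵥ fderiv ℝ g q z - (dMat S.M q z *ᵥ z) ⬝ᵥ g q - S.kineticForce g z q

variable {g z}

theorem contDiff_massPairing (hg : ContDiff ℝ ∞ g) : ContDiff ℝ ∞ (S.massPairing g z) :=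
  contDiff_iff_contDiffAt.2 fun q => ContDiffAt.dotProduct hg.contDiffAt
    ((S.isMechOn.smooth_M q (mem_univ q)).mulVec contDiffAt_const)

theorem contDiff_kineticRhs (hg : ContDiff ℝ ∞ g) : ContDiff ℝ ∞ (S.kineticRhs g z) := by
  refine contDiff_iff_contDiffAt.2 fun q => ?_
  have hM := S.isMechOn.smooth_M q (mem_univ q)
  have hMz : ContDiffAt ℝ ∞ (fun q => S.M q *ᵥ z) q := hM.mulVec contDiffAt_const
  have hg' := hg.contDiffAt (x := q)
  refine ((ContDiffAt.dotProduct hMz ?_).sub (ContDiffAt.dotProduct ?_ hg')).sub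
    (ContDiffAt.dotProduct hMz (SmoothMatAt.mulVec ?_ hMz))
  · exact (hg'.fderiv_right (m := ∞) (by simp)).clm_apply contDiffAt_const
  · exact (hM.dMat contDiffAt_const).mulVec contDiffAt_const
  · exact (S.isMechOn.smooth_inv (mem_univ q)).dMat hg'

/-- A positive solution of the kinetic matching equation near the origin. -/
theorem exists_massFactor (hg : ContDiff ℝ ∞ g) (hz : z ≠ 0) (h0 : 0 < S.massPairing g z 0) :
    ∃ f : (Fin (m + 1) → ℝ) → ℝ, ContDiff ℝ ∞ f ∧ (∀ q, 0 < f q) ∧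
      ∀ᶠ q in 𝓝 0, fderiv ℝ f q z * S.massPairing g z q = f q * S.kineticRhs g z q := by
  have hh := S.contDiff_massPairing (z := z) hg
  have hU : IsOpen {q | 0 < S.massPairing g z q} := isOpen_lt continuous_const hh.continuous
  obtain ⟨χ, hχ, -, hχs, hχ1⟩ := exists_bump (hU.mem_nhds h0)
  -- The equation for `f` prescribes its logarithmic derivative along `z`, smooth only where the
  -- pairing is positive; the cut-off extends it, and `f = exp F` is automatically positive.
  have hρ : ContDiff ℝ ∞ fun q => χ q • (S.kineticRhs g z q / S.massPairing g z q) :=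
    contDiff_smul_of_tsupport_subset hχ hU hχs
      ((S.contDiff_kineticRhs hg).contDiffOn.div hh.contDiffOn fun q hq => ne_of_gt hq)
  obtain ⟨F, hF, hFz⟩ := exists_fderiv_apply_eq hz hρ
  refine ⟨fun q => Real.exp (F q), hF.exp, fun q => Real.exp_pos _, ?_⟩
  filter_upwards [hχ1, hU.mem_nhds h0] with q hq hq0
  have h1 : HasFDerivAt (fun q => Real.exp (F q)) (Real.exp (F q) • fderiv ℝ F q) q :=
    ((hF.differentiable (by simp)) q).hasFDerivAt.exp
  have hne : S.massPairing g z q ≠ 0 := ne_of_gt hq0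
  rw [h1.fderiv, smul_apply, hFz, hq]
  simp only [smul_eq_mul, one_mul]
  field_simp

/-- The kinetic matching equation in the unactuated direction. -/
theorem kinetic_matching (hg : ContDiff ℝ ∞ g) {f : (Fin (m + 1) → ℝ) → ℝ}
    (hf : ContDiff ℝ ∞ f) (hfpos : ∀ q, 0 < f q) {q : Fin (m + 1) → ℝ}
    (hq : 0 < S.massPairing g z q)
    (hode : fderiv ℝ f q z * S.massPairing g z q = f q * S.kineticRhs g z q)
    {Mh : (Fin (m + 1) → ℝ) → Matrix (Fin (m + 1)) (Fin (m + 1)) ℝ}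
    (hMh : ∀ q, Mh q = shapedMass (g q) (f q • (S.M q *ᵥ z))) (hsm : SmoothMatAt Mh q) :
    (S.M q *ᵥ z) ⬝ᵥ (dMat (fun q => (Mh q)⁻¹) q z *ᵥ (f q • (S.M q *ᵥ z))) =
      S.kineticForce g z q := by
  have hpair : ∀ q, g q ⬝ᵥ (f q • (S.M q *ᵥ z)) = f q * S.massPairing g z q := fun q => by
    rw [dotProduct_smul, smul_eq_mul, massPairing]
  have hpos : ∀ q, 0 < S.massPairing g z q → (Mh q).PosDef := fun q hq => by
    rw [hMh]
    exact shapedMass_posDef (by rw [hpair]; exact mul_pos (hfpos q) hq)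
  have hinv : ∀ q, 0 < S.massPairing g z q → (Mh q)⁻¹ *ᵥ (f q • (S.M q *ᵥ z)) = g q := by
    intro q hq
    have h1 : Mh q *ᵥ g q = f q • (S.M q *ᵥ z) := by
      rw [hMh]
      exact shapedMass_mulVec (by rw [hpair]; exact mul_pos (hfpos q) hq)
    rw [← h1, posDef_inv_mulVec (hpos q hq)]
  have hM := S.isMechOn.smooth_M q (mem_univ q)
  have hMz : ContDiffAt ℝ ∞ (fun q => S.M q *ᵥ z) q := hM.mulVec contDiffAt_const
  have hy : ContDiffAt ℝ ∞ (fun q => f q • (S.M q *ᵥ z)) q := hf.contDiffAt.smul hMz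
  have hdMz : fderiv ℝ (fun q => S.M q *ᵥ z) q z = dMat S.M q z *ᵥ z := by
    rw [fderiv_mulVec hM contDiffAt_const]
    simp
  have hdy : fderiv ℝ (fun q => f q • (S.M q *ᵥ z)) q z =
      f q • (dMat S.M q z *ᵥ z) + fderiv ℝ f q z • (S.M q *ᵥ z) := by
    have h1 := ((hf.differentiable (by simp)) q).hasFDerivAt.smul
      (hMz.differentiableAt (by simp)).hasFDerivAt
    have h2 := congrArg (fun L => L z) h1.fderiv
    refine h2.trans ?_
    simp [hdMz]
  -- The identity M̂⁻¹(f Mz) = g, differentiated along `z`. Paired with f Mz below, it expresses the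
  -- derivative of M̂⁻¹ through `f`, `M` and `g` alone.
  have hd : dMat (fun q => (Mh q)⁻¹) q z *ᵥ (f q • (S.M q *ᵥ z)) +
      (Mh q)⁻¹ *ᵥ fderiv ℝ (fun q => f q • (S.M q *ᵥ z)) q z = fderiv ℝ g q z := by
    rw [← fderiv_mulVec (hsm.inv (hpos q hq).det_pos.ne') hy]
    have h1 : (fun q => (Mh q)⁻¹ *ᵥ (f q • (S.M q *ᵥ z))) =ᶠ[𝓝 q] g := by
      have hU : IsOpen {q | 0 < S.massPairing g z q} :=
        isOpen_lt continuous_const (S.contDiff_massPairing hg).continuous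
      filter_upwards [hU.mem_nhds hq] with q' hq'
      exact hinv q' hq'
    rw [h1.fderiv_eq]
  have hsymm : ((Mh q)⁻¹)ᵀ = (Mh q)⁻¹ := by
    rw [Matrix.transpose_nonsing_inv, posDef_transpose (hpos q hq)]
  have h1 := congrArg (fun v => (f q • (S.M q *ᵥ z)) ⬝ᵥ v) hd
  simp only [dotProduct_add] at h1
  rw [dotProduct_mulVec_comm hsymm _ (fderiv ℝ _ q z), hinv q hq, hdy, add_dotProduct,
    smul_dotProduct, smul_dotProduct, smul_dotProduct, smul_dotProduct, smul_eq_mul, smul_eq_mul,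
    smul_eq_mul, smul_eq_mul, dotProduct_comm (S.M q *ᵥ z) (g q), ← massPairing, hode] at h1
  simp only [kineticRhs] at h1
  have h2 := (hfpos q).ne'
  refine mul_left_cancel₀ h2 ?_
  linarith

end Kinetic

/-- If some direction has positive mass and stiffness pairings with the annihilator of the input
matrix, then the system can be transformed to the desired form. -/
theorem exists_isTransformedBy (hEq : S.field 0 0 = 0) {g₀ z : Fin (m + 1) → ℝ}
    (hg₀ : (S.G 0)ᵀ *ᵥ g₀ = 0) (hM : 0 < g₀ ⬝ᵥ (S.M 0 *ᵥ z)) (hV : 0 < (hess S.V *ᵥ g₀) ⬝ᵥ z) :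
    ∃ D : Design (m + 1) m, IsTransformedBy S D := by
  have hz : z ≠ 0 := by
    rintro rfl
    simp at hV
  obtain ⟨g, hg, hg0, hGg⟩ := S.exists_annihilator hg₀
  have hh := S.contDiff_massPairing (z := z) hg
  have hh0 : 0 < S.massPairing g z 0 := by rwa [massPairing, hg0]
  obtain ⟨f, hf, hfpos, hode⟩ := S.exists_massFactor hg hz hh0
  have hgV : ContDiff ℝ ∞ fun q => g q ⬝ᵥ grad S.V q := contDiff_iff_contDiffAt.2 fun q =>
    ContDiffAt.dotProduct hg.contDiffAt (ContDiffAt.grad S.smooth_V.contDiffAt)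
  have hgrad0 := S.grad_eq_zero hEq
  obtain ⟨Vh, hVh, hVhz, hVh0, hVhpos⟩ : ∃ Vh : (Fin (m + 1) → ℝ) → ℝ, ContDiff ℝ ∞ Vh ∧
      (∀ q, fderiv ℝ Vh q z = (f q)⁻¹ * (g q ⬝ᵥ grad S.V q)) ∧ fderiv ℝ Vh 0 = 0 ∧
      ∀ v, v ≠ 0 → 0 < v ⬝ᵥ (hess Vh *ᵥ v) := by
    refine exists_potential hz ((hf.inv fun q => (hfpos q).ne').mul hgV) (by simp [hgrad0]) ?_
    have h1 : HasFDerivAt (fun q => g q ⬝ᵥ grad S.V q)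
        ((dotCLM g₀).comp (mulVecCLM (hess S.V))) 0 := by
      have h2 : HasFDerivAt (fun q => ∑ i, g q i * grad S.V q i) _ 0 :=
        HasFDerivAt.fun_sum (u := Finset.univ) fun i _ => (hasFDerivAt_pi'.1
          ((hg.differentiable (by simp)) 0).hasFDerivAt i).mul
          (hasFDerivAt_pi'.1 (hasFDerivAt_grad (S.smooth_V.contDiffAt (x := 0))) i)
      refine h2.congr_fderiv (ContinuousLinearMap.ext fun v => ?_)
      simp [hgrad0, hg0, sum_apply, dotProduct]
    have h3 := (((hf.inv fun q => (hfpos q).ne').differentiable (by simp)) 0).hasFDerivAt.mul h1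
    have h4 := congrArg (fun L => L z) h3.fderiv
    refine lt_of_lt_of_eq ?_ h4.symm
    simp only [smul_apply, hgrad0, dotProduct_zero, zero_smul, add_zero,
      ContinuousLinearMap.comp_apply, mulVecCLM_apply, dotCLM_apply, smul_eq_mul]
    rw [mulVec_dotProduct_eq, S.hess_transpose]
    exact mul_pos (inv_pos.2 (hfpos 0)) hV
  -- Chosen so that M̂g = f Mz: the `g`-component of M̂M⁻¹∂_qĤ becomes f times the derivative of Ĥ
  -- along the constant vector `z`.
  let Mh : (Fin (m + 1) → ℝ) → Matrix (Fin (m + 1)) (Fin (m + 1)) ℝ :=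
    fun q => shapedMass (g q) (f q • (S.M q *ᵥ z))
  have hU₀ : IsOpen {q | 0 < S.massPairing g z q} := isOpen_lt continuous_const hh.continuous
  obtain ⟨U₁, hU₁sub, hU₁, h0U₁⟩ := mem_nhds_iff.1 (hode.and (hU₀.mem_nhds hh0))
  have hpair : ∀ q, 0 < S.massPairing g z q → 0 < g q ⬝ᵥ (f q • (S.M q *ᵥ z)) := by
    intro q hq
    rw [dotProduct_smul, smul_eq_mul]
    exact mul_pos (hfpos q) hq
  have hMhpos : ∀ q ∈ U₁, (Mh q).PosDef := fun q hq =>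
    shapedMass_posDef (hpair q (hU₁sub hq).2)
  have hMhg : ∀ q ∈ U₁, Mh q *ᵥ g q = f q • (S.M q *ᵥ z) := fun q hq =>
    shapedMass_mulVec (hpair q (hU₁sub hq).2)
  have hgne : ∀ q ∈ U₁, g q ≠ 0 := by
    intro q hq h0
    have h1 : 0 < S.massPairing g z q := (hU₁sub hq).2
    simp [massPairing, h0] at h1
  have hSM : ∀ q, SmoothMatAt S.M q := fun q => S.isMechOn.smooth_M q (mem_univ q)
  have hSMi : ∀ q, SmoothMatAt (fun q => (S.M q)⁻¹) q := fun q =>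
    S.isMechOn.smooth_inv (mem_univ q)
  have hMhs : ∀ q ∈ U₁, SmoothMatAt Mh q := by
    intro q hq
    have hy : ContDiffAt ℝ ∞ (fun q => f q • (S.M q *ᵥ z)) q :=
      hf.contDiffAt.smul ((hSM q).mulVec contDiffAt_const)
    have hg' := hg.contDiffAt (x := q)
    exact (SmoothMatAt.smul ((ContDiffAt.dotProduct hg' hy).inv (hpair q (hU₁sub hq).2).ne')
      (SmoothMatAt.vecMulVec hy hy)).add
        ((SmoothMatAt.smul (ContDiffAt.dotProduct hg' hg') (SmoothMatAt.const _ _)).sub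
          (SmoothMatAt.vecMulVec hg' hg'))
  have hmech₁ : IsMechOn Mh Vh U₁ :=
    ⟨hU₁, h0U₁, hMhs, hMhpos, fun q _ => hVh.contDiffAt⟩
  -- The mismatch of the two kinetic energies in the direction `g`, as a form in the momenta; `Q` is
  -- half of it in the velocities M̂⁻¹p.
  let Δ : (Fin (m + 1) → ℝ) → Matrix (Fin (m + 1)) (Fin (m + 1)) ℝ := fun q =>
    f q • dMat (fun q => (Mh q)⁻¹) q z - dMat (fun q => (S.M q)⁻¹) q (g q)
  let Q : (Fin (m + 1) → ℝ) → Matrix (Fin (m + 1)) (Fin (m + 1)) ℝ := fun q =>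
    (1 / 2 : ℝ) • (Mh q * Δ q * Mh q)
  have hMht : ∀ q, (Mh q)ᵀ = Mh q := by
    intro q
    simp only [Mh, shapedMass]
    simp [Matrix.transpose_add, Matrix.transpose_sub, Matrix.transpose_smul,
      Matrix.transpose_vecMulVec]
  have hdMt : ∀ (N : (Fin (m + 1) → ℝ) → Matrix (Fin (m + 1)) (Fin (m + 1)) ℝ) (q v),
      (∀ q, (N q)ᵀ = N q) → (dMat N q v)ᵀ = dMat N q v := by
    intro N q v hN
    ext i j
    have h1 : (fun q => N q j i) = fun q => N q i j :=
      funext fun q => congrFun (congrFun (hN q) i) j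
    simp only [Matrix.transpose_apply, dMat, Matrix.of_apply, h1]
  have hQt : ∀ q, (Q q)ᵀ = Q q := by
    intro q
    simp only [Q, Δ, Matrix.transpose_smul, Matrix.transpose_mul, Matrix.transpose_sub, hMht,
      hdMt (fun q => (Mh q)⁻¹) q z fun q => by rw [Matrix.transpose_nonsing_inv, hMht],
      hdMt (fun q => (S.M q)⁻¹) q (g q) fun q => by
        rw [Matrix.transpose_nonsing_inv, posDef_transpose (S.posDef_M q)], Matrix.mul_assoc]
  have hQv : ∀ q v, v ⬝ᵥ (Q q *ᵥ v) = (1 / 2) * ((Mh q *ᵥ v) ⬝ᵥ (Δ q *ᵥ (Mh q *ᵥ v))) := by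
    intro q v
    simp only [Q]
    rw [Matrix.smul_mulVec, dotProduct_smul, smul_eq_mul, ← Matrix.mulVec_mulVec,
      ← Matrix.mulVec_mulVec, mulVec_dotProduct_eq, hMht]
  -- The solvability condition for the gyroscopic tensor, guaranteed by the choice of `f`.
  have hQg : ∀ q ∈ U₁, g q ⬝ᵥ (Q q *ᵥ g q) = 0 := by
    intro q hq
    have h1 := S.kinetic_matching hg hf hfpos (hU₁sub hq).2 (hU₁sub hq).1
      (Mh := Mh) (fun _ => rfl) (hMhs q hq)
    rw [hQv, hMhg q hq]
    simp only [Δ, Matrix.sub_mulVec, Matrix.smul_mulVec, dotProduct_sub, smul_dotProduct,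
      dotProduct_smul, smul_eq_mul, Matrix.mulVec_smul]
    simp only [dotProduct_smul, smul_eq_mul, Matrix.mulVec_smul, kineticForce] at h1
    linear_combination (1 / 2) * f q ^ 2 * h1
  let T : (Fin (m + 1) → ℝ) → Fin (m + 1) → Fin (m + 1) → Fin (m + 1) → ℝ := fun q =>
    gyroTensor (gyroForm (Q q) (g q)) ((g q ⬝ᵥ g q)⁻¹ • g q)
  have hTs : ∀ i j k, ContDiffOn ℝ ∞ (fun q => T q i j k) U₁ := by
    intro i j k q hq
    have hg' := hg.contDiffAt (x := q)
    have hgg : ContDiffAt ℝ ∞ (fun q => (g q ⬝ᵥ g q)⁻¹) q :=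
      (ContDiffAt.dotProduct hg' hg').inv fun h0 => hgne q hq (dotProduct_self_eq_zero.1 h0)
    have hl : ContDiffAt ℝ ∞ (fun q => (g q ⬝ᵥ g q)⁻¹ • g q) q := hgg.smul hg'
    have hΔ : SmoothMatAt Δ q := (SmoothMatAt.smul hf.contDiffAt
      ((hmech₁.smooth_inv hq).dMat contDiffAt_const)).sub ((hSMi q).dMat hg')
    have hQs : SmoothMatAt Q q :=
      SmoothMatAt.smul contDiffAt_const (((hMhs q hq).mul hΔ).mul (hMhs q hq))
    have hQ's : SmoothMatAt (fun q => gyroForm (Q q) (g q)) q :=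
      hQs.add (SmoothMatAt.smul hgg ((SmoothMatAt.vecMulVec hg' (hQs.mulVec hg')).add
        (SmoothMatAt.vecMulVec (hQs.mulVec hg') hg')))
    have hl' := contDiffAt_pi.1 hl
    exact (((hQ's i j).mul (hl' k)).sub (contDiffAt_const.mul
      (((hQ's j k).mul (hl' i)).add ((hQ's i k).mul (hl' j))))).contDiffWithinAt
  -- The gyroscopic field must be smooth on all of space: it is cut off by `χ`, and `U` is chosen
  -- inside the region where `χ = 1`.
  obtain ⟨χ, hχ, -, hχs, hχ1⟩ := exists_bump (hU₁.mem_nhds h0U₁)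
  obtain ⟨U, hUsub, hU, h0U⟩ := mem_nhds_iff.1 (hχ1.and (hU₁.mem_nhds h0U₁))
  have hUU₁ : ∀ q ∈ U, q ∈ U₁ := fun q hq => (hUsub hq).2
  -- The desired field does not involve the feedback, so it is formed with a dummy input and then
  -- solved for `u`. The damping gain is free, as G Kv Gᵀ has no `g`-component.
  let D₀ : Design (m + 1) m :=
    { U := U
      Mhat := Mh
      Vhat := Vh
      Kv := fun _ => 1
      C := fun q i j k => χ q * T q i j k
      u := 0 }
  let D : Design (m + 1) m :=
    { D₀ with u := fun x => S.pinvG x.1 *ᵥ (gradQ S.H x + (D₀.desiredField S x).2) }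
  have hmech : IsMechOn Mh Vh U := ⟨hU, h0U, fun q hq => hMhs q (hUU₁ q hq),
    fun q hq => hMhpos q (hUU₁ q hq), fun q _ => hVh.contDiffAt⟩
  have hCs : ∀ i j k, ContDiff ℝ ∞ fun q => χ q * T q i j k := fun i j k =>
    contDiff_smul_of_tsupport_subset hχ hU₁ hχs (hTs i j k)
  refine ⟨D, hU, h0U, fun i j q hq => (hmech.smooth_M q hq i j).contDiffWithinAt, hmech.posDef,
    hVh.contDiffOn, fun i j => contDiffOn_const, fun q _ => Matrix.PosDef.one,
    ⟨hCs, fun q => isGyroscopic_smul_gyroTensor (gyroForm_transpose (hQt q) _) _ _⟩, ?_,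
    hmech.hasNondegenerateLocalMin hVh0 hVhpos, ?_⟩
  · intro x hx
    have hx1 : x.1 ∈ U := hx.1
    have hMx := (hmech.smooth_M _ hx1).comp_fst (x := x)
    have hMix := (hmech.smooth_inv hx1).comp_fst (x := x)
    have hSx := (hSMi x.1).comp_fst (x := x)
    have hGx := (S.smoothMatAt_G x.1).comp_fst (x := x)
    have hQx : ContDiffAt ℝ ∞ (gradQ S.H) x := S.isMechOn.contDiffAt_gradQ (mem_univ x.1)
    have h1 : ContDiffAt ℝ ∞ (fun x => (D₀.desiredField S x).2) x := by
      refine (((hMx.mul hSx).mulVec (hmech.contDiffAt_gradQ hx1)).neg.sub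
        (((hGx.mul (SmoothMatAt.const 1 x)).mul hGx.transpose).mulVec
          (hmech.contDiffAt_gradP hx1))).add (contDiffAt_contract (fun i j k => ?_)
            (hMix.mulVec contDiffAt_snd))
      exact ((hCs i j k).contDiffAt).comp x contDiffAt_fst
    exact ((S.smoothMatAt_pinvG x.1).comp_fst.mulVec (hQx.add h1)).contDiffWithinAt
  · intro x hx
    have hx1 : x.1 ∈ U := hx.1
    have hx2 := hUU₁ _ hx1
    have hpd := hMhpos _ hx2
    refine Prod.ext ?_ ?_
    · change gradP S.H x = ((S.M x.1)⁻¹ * Mh x.1) *ᵥ gradP (mechHamiltonian Mh Vh) x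
      rw [hmech.gradP_eq hx1, ← Matrix.mulVec_mulVec, posDef_mulVec_inv hpd]
      exact S.isMechOn.gradP_eq (mem_univ x.1)
    · change -gradQ S.H x + S.G x.1 *ᵥ (S.pinvG x.1 *ᵥ
        (gradQ S.H x + (D₀.desiredField S x).2)) = (D₀.desiredField S x).2
      rw [S.mulVec_pinvG_of_dotProduct_eq_zero (hgne _ hx2) (hGg x.1), neg_add_cancel_left]
      have hC : (fun i j k => χ x.1 * T x.1 i j k) = T x.1 := by
        funext i j k
        rw [(hUsub hx1).1, one_mul]
      change g x.1 ⬝ᵥ (gradQ S.H x + (-((Mh x.1 * (S.M x.1)⁻¹) *ᵥ gradQ (mechHamiltonian Mh Vh) x)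
        - (S.G x.1 * (1 : Matrix (Fin m) (Fin m) ℝ) * (S.G x.1)ᵀ) *ᵥ gradP (mechHamiltonian Mh Vh) x
        + contract (fun i j k => χ x.1 * T x.1 i j k) ((Mh x.1)⁻¹ *ᵥ x.2))) = 0
      rw [hC]
      have e1 : g x.1 ⬝ᵥ gradQ S.H x = (1 / 2) *
          (x.2 ⬝ᵥ (dMat (fun q => (S.M q)⁻¹) x.1 (g x.1) *ᵥ x.2)) + g x.1 ⬝ᵥ grad S.V x.1 :=
        S.isMechOn.dotProduct_gradQ (mem_univ x.1) (g x.1)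
      -- Here gᵀM̂M⁻¹ = f zᵀ, and the potential equation turns f ∂_z V̂ into g·∂V, which cancels
      -- against `e1`.
      have e2 : g x.1 ⬝ᵥ ((Mh x.1 * (S.M x.1)⁻¹) *ᵥ gradQ (mechHamiltonian Mh Vh) x) =
          f x.1 * ((1 / 2) * (x.2 ⬝ᵥ (dMat (fun q => (Mh q)⁻¹) x.1 z *ᵥ x.2))) +
            g x.1 ⬝ᵥ grad S.V x.1 := by
        rw [← Matrix.mulVec_mulVec, mulVec_dotProduct_eq, mulVec_dotProduct_eq, hMht, hMhg _ hx2,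
          Matrix.transpose_nonsing_inv, posDef_transpose (S.posDef_M x.1), Matrix.mulVec_smul,
          posDef_inv_mulVec (S.posDef_M x.1), smul_dotProduct, hmech.dotProduct_gradQ hx1,
          dotProduct_grad Vh, hVhz, smul_eq_mul, mul_add, mul_inv_cancel_left₀ (hfpos x.1).ne']
      have e3 : g x.1 ⬝ᵥ ((S.G x.1 * (1 : Matrix (Fin m) (Fin m) ℝ) * (S.G x.1)ᵀ) *ᵥ
          gradP (mechHamiltonian Mh Vh) x) = 0 := by
        rw [Matrix.mul_one, ← Matrix.mulVec_mulVec, mulVec_dotProduct_eq, hGg, zero_dotProduct]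
      have e4 : g x.1 ⬝ᵥ contract (T x.1) ((Mh x.1)⁻¹ *ᵥ x.2) =
          (1 / 2) * (f x.1 * (x.2 ⬝ᵥ (dMat (fun q => (Mh q)⁻¹) x.1 z *ᵥ x.2)) -
            x.2 ⬝ᵥ (dMat (fun q => (S.M q)⁻¹) x.1 (g x.1) *ᵥ x.2)) := by
        rw [dotProduct_contract_gyroForm (hgne _ hx2) (hQg _ hx2), hQv, posDef_mulVec_inv hpd]
        simp only [Δ, Matrix.sub_mulVec, Matrix.smul_mulVec, dotProduct_sub, dotProduct_smul,
          smul_eq_mul]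
      rw [dotProduct_add, dotProduct_add, dotProduct_sub, dotProduct_neg, e1, e2, e3, e4]
      ring

/-- Either alternative excludes Hess V g = c Mg with c ≤ 0, which is all that could prevent the two
covectors from being positive on a common vector `z`. -/
theorem exists_isTransformedBy_of_controllable_or_oscillatory (hEq : S.field 0 0 = 0)
    (h : IsControllable S.linA S.linB ∨ IsOscillatory (uncontrollablePart S.linA S.linB)) :
    ∃ D : Design (m + 1) m, IsTransformedBy S D := by
  obtain ⟨g, hg0, hg⟩ := exists_transpose_mulVec_eq_zero (S.G 0)
  have hMg : S.M 0 *ᵥ g ≠ 0 := fun h0 => by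
    have := posDef_pos (S.posDef_M 0) hg0
    rw [h0, dotProduct_zero] at this
    exact lt_irrefl _ this
  obtain ⟨z, hz₁, hz₂⟩ := exists_dotProduct_pos (a := S.M 0 *ᵥ g) (b := hess S.V *ᵥ g) hMg
    fun c hc => by
      rcases h with h | h
      · exact absurd h (S.not_isControllable_of_parallel hg0 hg hc)
      · by_contra! hc0
        exact S.not_isOscillatory_of_parallel hg0 hg hc0 hc h
  refine S.exists_isTransformedBy hEq hg ?_ hz₂
  rwa [mulVec_dotProduct_eq, posDef_transpose (S.posDef_M 0)]

end ControlledHamiltonian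

end Construction

end IDAPBC

end

open IDAPBC in
theorem theorem1 (n m : ℕ) (hnm : n = m + 1) (S : ControlledHamiltonian n m)
    (hEq : S.field 0 0 = 0) :
    ((∃ D : Design n m, IsTransformedBy S D) ↔
      (IsControllable S.linA S.linB ∨ IsOscillatory (uncontrollablePart S.linA S.linB))) ∧
    (∀ D : Design n m, IsTransformedBy S D →
      (IsLocallyExponentiallyStable (D.desiredField S) D.domain ↔
        IsControllable S.linA S.linB)) := by
  subst hnm
  refine ⟨⟨fun ⟨_, hD⟩ => hD.isControllable_or_isOscillatory hEq,
    S.exists_isTransformedBy_of_controllable_or_oscillatory hEq⟩, fun _ hD =>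
    ⟨hD.isControllable_of_stable hEq, hD.stable_of_isControllable hEq⟩⟩
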